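/- Setting. Let $\mathcal X$ be a standard Borel space (e.g. a Borel subset of $\mathbb R^d$), $k\ge 1$, $1\le\Lambda<\infty$. The full data are $O=(X,Y(1),Y(0),A,U)$ with $X\in\mathcal X$, $Y(1),Y(0)\in\mathbb R$, $A\in\{0,1\}$, $U\in\mathbb R^k$; the observed data are $Z=(X,Y,A)$ with $Y=AY(1)+(1-A)Y(0)$. A law $Q$ of $O$ satisfies the marginal sensitivity model MSM$(\Lambda)$ if, under $Q$, $(Y(1),Y(0))$ and $A$ are conditionally independent given $(X,U)$ and $$\frac1\Lambda\le\frac{Q(A=1\mid X,U)/Q(A=0\mid X,U)}{Q(A=1\mid X)/Q(A=0\mid X)}\le\Lambda\quad Q\text{-a.s.}$$ Let the true law $P_o$ of $O$ satisfy MSM$(\Lambda)$, with $Y(1)$ and $Y(0)$ integrable, and let $P$ be the induced law of $Z$. Let $\mathcal P(\Lambda)$ be the set of all laws $Q$ of $O$ that satisfy MSM$(\Lambda)$ and induce the law $P$ for $Z$. For a measurable policy $\pi:\mathcal X\to[0,1]$ put $$\Delta_\Lambda(\pi)=\inf_{Q\in\mathcal P(\Lambda)}\mathbb E_Q[\pi(X)(Y(1)-Y(0))].$$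 Nuisances. Below, $\mathbb P$ and $\mathbb E$ refer to $P$. Let $e(x)=\mathbb P(A=1\mid X=x)$, $e_1=e$, $e_0=1-e$; with $F(\cdot\mid x,t)$ the distribution function of $Y$ given $X=x,A=t$, let $q^-(x,t)=\inf\{q:F(q\mid x,t)\ge\frac1{1+\Lambda}\}$ and $q^+(x,t)=\inf\{q:F(q\mid x,t)\ge\frac\Lambda{1+\Lambda}\}$; and let $$\rho_1^\pm(x,t)=\mathbb E[Y\mathbf 1\{Y<q^\pm(X,A)\}\mid X=x,A=t],\qquad \rho_0^\pm(x,t)=\mathbb E[Y\mathbf 1\{Y>q^\pm(X,A)\}\mid X=x,A=t].$$ Write $\eta=(e,q^\pm,\rho_1^\pm,\rho_0^\pm)$. Score. With $\mathrm{sgn}(s)=1$ for $s\ge0$ and $-1$ otherwise, and $z=(x,y,a)$, let $$\begin{aligned}\phi_t^-(z;\eta)={}&y\mathbf 1\{a=t\}\Big[1+\tfrac{1-e_t(x)}{e_t(x)}\Lambda^{-\mathrm{sgn}(y-q^-(x,t))}\Big]\\&+q^-(x,t)\mathbf 1\{a=t\}\tfrac{1-e_t(x)}{e_t(x)}(\Lambda-\Lambda^{-1})\Big[\tfrac1{1+\Lambda}-\mathbf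 1\{y<q^-(x,t)\}\Big]\\&-\tfrac1{e_t(x)}\big[\Lambda\rho_1^-(x,t)+\Lambda^{-1}\rho_0^-(x,t)\big]\big[\mathbf 1\{a=t\}-e_t(x)\big],\end{aligned}$$ $$\begin{aligned}\phi_t^+(z;\eta)={}&y\mathbf 1\{a=t\}\Big[1+\tfrac{1-e_t(x)}{e_t(x)}\Lambda^{\mathrm{sgn}(y-q^+(x,t))}\Big]\\&-q^+(x,t)\mathbf 1\{a=t\}\tfrac{1-e_t(x)}{e_t(x)}(\Lambda-\Lambda^{-1})\Big[\tfrac\Lambda{1+\Lambda}-\mathbf 1\{y<q^+(x,t)\}\Big]\\&-\tfrac1{e_t(x)}\big[\Lambda^{-1}\rho_1^+(x,t)+\Lambda\rho_0^+(x,t)\big]\big[\mathbf 1\{a=t\}-e_t(x)\big],\end{aligned}$$ and $\psi_\Delta(z,\pi;\eta)=\pi(x)\,[\phi_1^-(z;\eta)-\phi_0^+(z;\eta)]$. Proposition. For every measurable policy $\pi:\mathcal X\to[0,1]$: (1) $\pi(X)(Y(1)-Y(0))$ is $Q$-integrable for every $Q\in\mathcal P(\Lambda)$, the infimum $\Delta_\Lambda(\pi)$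 is finite, $\psi_\Delta(Z,\pi;\eta)$ is integrable, and $\mathbb E[\psi_\Delta(Z,\pi;\eta)]=\Delta_\Lambda(\pi)$. (2) (Neyman orthogonality) Suppose that $\mathbb P(A=1,\,Y=q^-(X,1))=\mathbb P(A=0,\,Y=q^+(X,0))=0$ (for instance, $Y$ has a conditional density given $(X,A)$). Let $\tilde\eta=(\tilde e,\tilde q^\pm,\tilde\rho_1^\pm,\tilde\rho_0^\pm)$ be measurable functions with $\tilde e:\mathcal X\to(0,1)$, with $\tilde q^\pm,\tilde\rho_1^\pm,\tilde\rho_0^\pm:\mathcal X\times\{0,1\}\to\mathbb R$ such that $\tilde q^\pm(X,t)$, $\tilde\rho_1^\pm(X,t)$, $\tilde\rho_0^\pm(X,t)$ are integrable for $t\in\{0,1\}$, and such that for some $r_0>0$, almost surely, $e(X)+r(\tilde e(X)-e(X))\in(0,1)$ for all $|r|<r_0$ (which holds for every $\tilde e:\mathcal X\to(0,1)$ if $e$ is bounded away from $0$ and $1$). Then $\psi_\Delta(Z,\pi;\eta+r(\tilde\eta-\eta))$ is integrable for all $r$ near $0$, the derivative below exists, and $$\frac{\mathrm d}{\mathrm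 dr}\,\mathbb E\big[\psi_\Delta(Z,\pi;\eta+r(\tilde\eta-\eta))\big]\Big|_{r=0}=0 .$$ -/

import Mathlib

open MeasureTheory ProbabilityTheory

noncomputable section

namespace RobustPolicy

/-- Observed data `z = (x, y, a)`: covariates, outcome, treatment (`true` is `1`, `false` is `0`). -/
abbrev Obs (𝒳 : Type*) := 𝒳 × ℝ × Bool

/-- Full data `o = (x, (y(1), y(0)), a, u)`, with `u ∈ ℝ^k` the unobserved confounders. -/
abbrev Full (𝒳 : Type*) (k : ℕ) := 𝒳 × (ℝ × ℝ) × Bool × EuclideanSpace ℝ (Fin k)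

namespace Obs
variable {𝒳 : Type*}
/-- The covariates. -/
def x (z : Obs 𝒳) : 𝒳 := z.1
/-- The observed outcome. -/
def y (z : Obs 𝒳) : ℝ := z.2.1
/-- The treatment. -/
def a (z : Obs 𝒳) : Bool := z.2.2
end Obs

namespace Full
variable {𝒳 : Type*} {k : ℕ}
/-- The covariates `X`. -/
def x (o : Full 𝒳 k) : 𝒳 := o.1
/-- The potential outcome under treatment, `Y(1)`. -/
def y1 (o : Full 𝒳 k) : ℝ := o.2.1.1
/-- The potential outcome under control, `Y(0)`. -/
def y0 (o : Full 𝒳 k) : ℝ := o.2.1.2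
/-- The treatment `A`. -/
def a (o : Full 𝒳 k) : Bool := o.2.2.1
/-- The unobserved confounders `U`. -/
def u (o : Full 𝒳 k) : EuclideanSpace ℝ (Fin k) := o.2.2.2
/-- The observed part `(X, Y, A)` of the full data, with `Y = A Y(1) + (1 - A) Y(0)`. -/
def obs (o : Full 𝒳 k) : Obs 𝒳 := (x o, if a o then y1 o else y0 o, a o)
/-- The pair `(X, U)`. -/
def xu (o : Full 𝒳 k) : 𝒳 × EuclideanSpace ℝ (Fin k) := (x o, u o)

variable [MeasurableSpace 𝒳]

lemma measurable_xu : Measurable (xu : Full 𝒳 k → _) := by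
  unfold xu x u; fun_prop

lemma measurable_obs : Measurable (obs : Full 𝒳 k → Obs 𝒳) := by
  have ha : Measurable (a : Full 𝒳 k → Bool) := by unfold a; fun_prop
  have h1 : Measurable (y1 : Full 𝒳 k → ℝ) := by unfold y1; fun_prop
  have h0 : Measurable (y0 : Full 𝒳 k → ℝ) := by unfold y0; fun_prop
  have hx : Measurable (x : Full 𝒳 k → 𝒳) := by unfold x; fun_prop
  exact hx.prodMk ((Measurable.ite (ha (measurableSet_singleton true)) h1 h0).prodMk ha)
end Full

/-- `P(A = 1 | V = v)` under `μ`. -/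
def condProbTreated {Ω 𝒱 : Type*} [MeasurableSpace Ω] [MeasurableSpace 𝒱]
    (μ : Measure Ω) [IsFiniteMeasure μ] (A : Ω → Bool) (V : Ω → 𝒱) (v : 𝒱) : ℝ :=
  (condDistrib A V μ v).real {true}

/-- The odds `p / (1 - p)`. -/
def odds (p : ℝ) : ℝ := p / (1 - p)

section Model
variable {𝒳 : Type*} [MeasurableSpace 𝒳] {k : ℕ}

/-- The law of `(X, Y, A)` when the full data have law `Q`. -/
def observedLaw (Q : ProbabilityMeasure (Full 𝒳 k)) : ProbabilityMeasure (Obs 𝒳) :=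
  Q.map Full.measurable_obs.aemeasurable

/-- The marginal sensitivity model with parameter `Λ`: `(Y(1), Y(0))` and `A` are conditionally
independent given `(X, U)`, and the ratio of the odds of the true propensity score `P(A = 1 | X, U)`
to those of the nominal one, `P(A = 1 | X)`, is almost surely in `[1/Λ, Λ]`. (A propensity score
equal to `0` or `1` makes the ratio `0` here, so it is excluded almost surely.) -/
structure MarginalSensitivityModel [StandardBorelSpace 𝒳] (Λ : ℝ)
    (Q : ProbabilityMeasure (Full 𝒳 k)) : Prop where
  condIndep : CondIndepFun (MeasurableSpace.comap Full.xu inferInstance)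
    Full.measurable_xu.comap_le (fun o : Full 𝒳 k => (o.y1, o.y0)) Full.a (Q : Measure (Full 𝒳 k))
  odds_ratio : ∀ᵐ o ∂(Q : Measure (Full 𝒳 k)),
    odds (condProbTreated (Q : Measure (Full 𝒳 k)) Full.a Full.xu o.xu) /
        odds (condProbTreated (Q : Measure (Full 𝒳 k)) Full.a Full.x o.x) ∈ Set.Icc (1 / Λ) Λ

/-- The uncertainty set `𝒫(Λ)`: all laws of the full data, with `k`-dimensional confounders, that
satisfy the marginal sensitivity model and induce the observed-data law `P`. -/
def uncertaintySet [StandardBorelSpace 𝒳] (k : ℕ) (Λ : ℝ) (P : ProbabilityMeasure (Obs 𝒳)) :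
    Set (ProbabilityMeasure (Full 𝒳 k)) :=
  {Q | MarginalSensitivityModel Λ Q ∧ observedLaw Q = P}

/-- The policy improvement `E_Q[π(X) (Y(1) - Y(0))]`. -/
def improvement (π : 𝒳 → ℝ) (Q : ProbabilityMeasure (Full 𝒳 k)) : ℝ :=
  ∫ o, π o.x * (o.y1 - o.y0) ∂(Q : Measure (Full 𝒳 k))

/-- The worst-case policy improvement `Δ_Λ(π)`, the infimum of the improvement over `𝒫(Λ)`. -/
def worstCaseImprovement [StandardBorelSpace 𝒳] (k : ℕ) (Λ : ℝ) (P : ProbabilityMeasure (Obs 𝒳))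
    (π : 𝒳 → ℝ) : ℝ :=
  sInf (improvement π '' uncertaintySet k Λ P)

/-- The conditional law of `Y` given `X = x` and `A = t`. -/
def outcomeLaw (P : ProbabilityMeasure (Obs 𝒳)) (x : 𝒳) (t : Bool) : Measure ℝ :=
  condDistrib Obs.y (fun z : Obs 𝒳 => (z.x, z.a)) (P : Measure (Obs 𝒳)) (x, t)

/-- The conditional quantile `inf {q : F(q | x, t) ≥ α}`. -/
def condQuantile (P : ProbabilityMeasure (Obs 𝒳)) (α : ℝ) (x : 𝒳) (t : Bool) : ℝ :=
  sInf {q : ℝ | α ≤ (outcomeLaw P x t).real (Set.Iic q)}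

/-- `E[Y 1{Y < q(X, A)} | X = x, A = t]`. -/
def lowerTail (P : ProbabilityMeasure (Obs 𝒳)) (q : 𝒳 → Bool → ℝ) (x : 𝒳) (t : Bool) : ℝ :=
  ∫ y in Set.Iio (q x t), y ∂(outcomeLaw P x t)

/-- `E[Y 1{Y > q(X, A)} | X = x, A = t]`. -/
def upperTail (P : ProbabilityMeasure (Obs 𝒳)) (q : 𝒳 → Bool → ℝ) (x : 𝒳) (t : Bool) : ℝ :=
  ∫ y in Set.Ioi (q x t), y ∂(outcomeLaw P x t)

end Model

/-- A nuisance tuple `(e, q^±, ρ_1^±, ρ_0^±)`. -/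
@[ext] structure Nuisance (𝒳 : Type*) where
  e : 𝒳 → ℝ
  qMinus : 𝒳 → Bool → ℝ
  qPlus : 𝒳 → Bool → ℝ
  rhoOneMinus : 𝒳 → Bool → ℝ
  rhoOnePlus : 𝒳 → Bool → ℝ
  rhoZeroMinus : 𝒳 → Bool → ℝ
  rhoZeroPlus : 𝒳 → Bool → ℝ

/-- The true nuisance tuple under the observed-data law `P`. -/
def trueNuisance {𝒳 : Type*} [MeasurableSpace 𝒳] (Λ : ℝ) (P : ProbabilityMeasure (Obs 𝒳)) :
    Nuisance 𝒳 where
  e := condProbTreated (P : Measure (Obs 𝒳)) Obs.a Obs.x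
  qMinus := condQuantile P (1 / (1 + Λ))
  qPlus := condQuantile P (Λ / (1 + Λ))
  rhoOneMinus := lowerTail P (condQuantile P (1 / (1 + Λ)))
  rhoOnePlus := lowerTail P (condQuantile P (Λ / (1 + Λ)))
  rhoZeroMinus := upperTail P (condQuantile P (1 / (1 + Λ)))
  rhoZeroPlus := upperTail P (condQuantile P (Λ / (1 + Λ)))

/-- The segment `η + r (η' - η)`, component by component. -/
def Nuisance.path {𝒳 : Type*} (η η' : Nuisance 𝒳) (r : ℝ) : Nuisance 𝒳 where
  e x := η.e x + r * (η'.e x - η.e x)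
  qMinus x t := η.qMinus x t + r * (η'.qMinus x t - η.qMinus x t)
  qPlus x t := η.qPlus x t + r * (η'.qPlus x t - η.qPlus x t)
  rhoOneMinus x t := η.rhoOneMinus x t + r * (η'.rhoOneMinus x t - η.rhoOneMinus x t)
  rhoOnePlus x t := η.rhoOnePlus x t + r * (η'.rhoOnePlus x t - η.rhoOnePlus x t)
  rhoZeroMinus x t := η.rhoZeroMinus x t + r * (η'.rhoZeroMinus x t - η.rhoZeroMinus x t)
  rhoZeroPlus x t := η.rhoZeroPlus x t + r * (η'.rhoZeroPlus x t - η.rhoZeroPlus x t)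

/-- The sign with `sgn 0 = 1`. -/
def sgn (s : ℝ) : ℤ := if 0 ≤ s then 1 else -1

/-- The indicator of a proposition, with values in `ℝ`. -/
def ind (p : Prop) [Decidable p] : ℝ := if p then 1 else 0

/-- `e_1 = e` and `e_0 = 1 - e`. -/
def propensity {𝒳 : Type*} (e : 𝒳 → ℝ) (t : Bool) (x : 𝒳) : ℝ := if t then e x else 1 - e x

/-- The score `φ_t^-(z; e, q, ρ_1, ρ_0)`. -/
def phiMinus {𝒳 : Type*} (Λ : ℝ) (e : 𝒳 → ℝ) (q ρ₁ ρ₀ : 𝒳 → Bool → ℝ) (t : Bool) (z : Obs 𝒳) : ℝ :=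
  z.y * ind (z.a = t) * (1 + (1 - propensity e t z.x) / propensity e t z.x
      * Λ ^ (-sgn (z.y - q z.x t)))
    + q z.x t * ind (z.a = t) * ((1 - propensity e t z.x) / propensity e t z.x)
      * (Λ - Λ⁻¹) * (1 / (1 + Λ) - ind (z.y < q z.x t))
    - 1 / propensity e t z.x * (Λ * ρ₁ z.x t + Λ⁻¹ * ρ₀ z.x t)
      * (ind (z.a = t) - propensity e t z.x)

/-- The score `φ_t^+(z; e, q, ρ_1, ρ_0)`. -/
def phiPlus {𝒳 : Type*} (Λ : ℝ) (e : 𝒳 → ℝ) (q ρ₁ ρ₀ : 𝒳 → Bool → ℝ) (t : Bool) (z : Obs 𝒳) : ℝ :=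
  z.y * ind (z.a = t) * (1 + (1 - propensity e t z.x) / propensity e t z.x
      * Λ ^ sgn (z.y - q z.x t))
    - q z.x t * ind (z.a = t) * ((1 - propensity e t z.x) / propensity e t z.x)
      * (Λ - Λ⁻¹) * (Λ / (1 + Λ) - ind (z.y < q z.x t))
    - 1 / propensity e t z.x * (Λ⁻¹ * ρ₁ z.x t + Λ * ρ₀ z.x t)
      * (ind (z.a = t) - propensity e t z.x)

/-- The score `ψ_Δ(z, π; η) = π(x) [φ_1^- - φ_0^+]`. -/
def psiDelta {𝒳 : Type*} (Λ : ℝ) (π : 𝒳 → ℝ) (η : Nuisance 𝒳) (z : Obs 𝒳) : ℝ :=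
  π z.x * (phiMinus Λ η.e η.qMinus η.rhoOneMinus η.rhoZeroMinus true z
    - phiPlus Λ η.e η.qPlus η.rhoOnePlus η.rhoZeroPlus false z)

/-- The perturbed tuples: measurable, with `e` valued in `(0, 1)` and with the components
`q^±(X, t)`, `ρ_1^±(X, t)`, `ρ_0^±(X, t)` integrable for `t ∈ {0, 1}`. -/
structure Nuisance.Admissible {𝒳 : Type*} [MeasurableSpace 𝒳] (P : ProbabilityMeasure (Obs 𝒳))
    (η : Nuisance 𝒳) : Prop where
  measurable_e : Measurable η.e
  e_mem : ∀ x, η.e x ∈ Set.Ioo (0 : ℝ) 1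
  components : ∀ t : Bool, ∀ f ∈ ({η.qMinus, η.qPlus, η.rhoOneMinus, η.rhoOnePlus,
      η.rhoZeroMinus, η.rhoZeroPlus} : Set (𝒳 → Bool → ℝ)),
    Measurable (fun x => f x t) ∧ Integrable (fun z : Obs 𝒳 => f z.x t) (P : Measure (Obs 𝒳))

end RobustPolicy

end

noncomputable section

namespace RobustPolicy

/-! ### Disintegration of the observed law by treatment arm. -/

section Observed
variable {𝒳 : Type*} [MeasurableSpace 𝒳]

/-! Fix an arm `t` and let `e_t = P(A = t | X)`. The observed law determines the law of `(X, Y(t))`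
on `{A = t}` (`armLaw`) but not on `{A ≠ t}` (`counterLaw`). The reference for the latter is
`swapLaw`: covariates as on `{A ≠ t}`, outcomes as in arm `t`. By conditional independence given
`(X, U)`, both are mixtures over `(X, U)` of the same conditional law of `Y(t)`, with weights `P(A ≠
t | X, U)` and `((1 - e_t) / e_t) P(A = t | X, U)`. The odds-ratio condition says that these weights
are within a factor `Λ` of each other. So the two measures dominate each other up to `Λ`
(`counterLaw_le`, `swapLaw_le`), and they share their covariate marginal.

Bound. For any function `q` of `X`, write `Y = q + (Y - q)^+ - (Y - q)^-`. The `q` term has the same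
mean under both laws; each of the other two changes by a factor in `[1/Λ, Λ]`. Hence the
counterfactual mean of `π Y` is at least the `swapLaw` mean of `π` times the tilted outcome with
slope `Λ` below `q` and `1/Λ` above; the upper bound exchanges the slopes (`tilt_bounds`).

Attainment. Equality holds for the density `Λ` below `q` and `1/Λ` above, which has total mass one
if the mass below `q` is `1/(1+Λ)`; for the exchanged slopes the level is `Λ/(1+Λ)`. One binary
confounder serves both arms: it tells whether the outcomes lie in the lower or the upper part of
their laws, and "lower" has probability `1/(1+Λ)` given `A = 1` and `Λ/(1+Λ)` given `A = 0`. By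
Bayes' rule the odds ratio is the likelihood ratio of the part, `1/Λ` or `Λ`. Cutting `Y(1)` and
`Y(0)` at these two levels minimizes the mean of the one and maximizes that of the other at once,
while in its own arm each mixture of parts returns the observed law (`isLeast_improvement`). An atom
at the quantile is shared between the parts; this is harmless, as the tilt fixes that point.

Score. With `T` the tilted outcome and `R` the combination of tail means, algebra turns `φ_t` into
`1{A=t} (Y - T) + R + 1{A=t} (T - R) / e_t`. Inverse probability weighting gives it the mean of `Y`
on the arm plus the mean of `T` under `swapLaw`, whatever `R` is: this is the extremal value.

Orthogonality. The derivative of `T` in `q` is one minus the slope, of conditional mean zero at the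
quantile; the derivative of the score in `R` is `1 - 1{A=t} / e_t`; the one in `e_t` is proportional
to `T - R`, and `R` is the conditional mean of `T` when there is no atom. To differentiate under the
integral, `T` is Lipschitz in `q`, and a propensity segment nonnegative on `[-ε, ε]` stays above
`e_t / 2` on half of it. The Lipschitz bound is then `1{A=t} / e_t` times an integrable function,
plus a function of `X`; inverse weighting makes it integrable without any lower bound on `e_t`. -/

lemma Obs.measurable_x : Measurable (Obs.x : Obs 𝒳 → 𝒳) := measurable_fst
lemma Obs.measurable_y : Measurable (Obs.y : Obs 𝒳 → ℝ) := measurable_fst.comp measurable_snd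
lemma Obs.measurable_a : Measurable (Obs.a : Obs 𝒳 → Bool) := measurable_snd.comp measurable_snd

lemma Obs.measurable_xy : Measurable (fun z : Obs 𝒳 => (z.x, z.y)) :=
  Obs.measurable_x.prodMk Obs.measurable_y

lemma Obs.measurableSet_a (t : Bool) : MeasurableSet {z : Obs 𝒳 | z.a = t} :=
  Obs.measurable_a (measurableSet_singleton t)

/-- The law of the covariates. -/
def covLaw (P : ProbabilityMeasure (Obs 𝒳)) : Measure 𝒳 := (P : Measure (Obs 𝒳)).map Obs.x

instance (P : ProbabilityMeasure (Obs 𝒳)) : IsProbabilityMeasure (covLaw P) :=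
  Measure.isProbabilityMeasure_map Obs.measurable_x.aemeasurable

/-- The conditional law of the outcome in treatment arm `t`, as a kernel. -/
def outcomeKernel (P : ProbabilityMeasure (Obs 𝒳)) (t : Bool) : Kernel 𝒳 ℝ :=
  (condDistrib Obs.y (fun z : Obs 𝒳 => (z.x, z.a)) (P : Measure (Obs 𝒳))).comap
    (fun x => (x, t)) measurable_prodMk_right

instance (P : ProbabilityMeasure (Obs 𝒳)) (t : Bool) : IsMarkovKernel (outcomeKernel P t) := by
  unfold outcomeKernel; infer_instance

lemma outcomeLaw_eq (P : ProbabilityMeasure (Obs 𝒳)) (x : 𝒳) (t : Bool) :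
    outcomeLaw P x t = outcomeKernel P t x := rfl

/-- `P(A = t | X = x)`. -/
def armProb (P : ProbabilityMeasure (Obs 𝒳)) (t : Bool) (x : 𝒳) : ℝ :=
  propensity (condProbTreated (P : Measure (Obs 𝒳)) Obs.a Obs.x) t x

lemma measurable_condProbTreated {Ω 𝒱 : Type*} [MeasurableSpace Ω] [MeasurableSpace 𝒱]
    (μ : Measure Ω) [IsFiniteMeasure μ] (A : Ω → Bool) (V : Ω → 𝒱) :
    Measurable (condProbTreated μ A V) :=
  (Kernel.measurable_coe _ (measurableSet_singleton true)).ennreal_toReal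

lemma condDistrib_singleton {Ω 𝒱 : Type*} [MeasurableSpace Ω] [MeasurableSpace 𝒱]
    (μ : Measure Ω) [IsFiniteMeasure μ] (A : Ω → Bool) (V : Ω → 𝒱) (t : Bool) (v : 𝒱) :
    condDistrib A V μ v {t} = ENNReal.ofReal (propensity (condProbTreated μ A V) t v) := by
  cases t
  · have h : ({false} : Set Bool) = {true}ᶜ := by ext b; cases b <;> simp
    simp only [propensity, Bool.false_eq_true, if_false, condProbTreated]
    rw [h, ← probReal_compl_eq_one_sub (measurableSet_singleton true), ofReal_measureReal]
  · simp [propensity, condProbTreated, ofReal_measureReal]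

lemma propensity_condProbTreated_mem {Ω 𝒱 : Type*} [MeasurableSpace Ω] [MeasurableSpace 𝒱]
    (μ : Measure Ω) [IsFiniteMeasure μ] (A : Ω → Bool) (V : Ω → 𝒱) (t : Bool) (v : 𝒱) :
    propensity (condProbTreated μ A V) t v ∈ Set.Icc (0 : ℝ) 1 := by
  have h0 : 0 ≤ condProbTreated μ A V v := measureReal_nonneg
  have h1 : condProbTreated μ A V v ≤ 1 := measureReal_le_one
  cases t <;> simp [propensity, h0, h1]

lemma measurable_propensity {e : 𝒳 → ℝ} (he : Measurable e) (t : Bool) :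
    Measurable (propensity e t) := by
  unfold propensity; cases t <;> simp <;> fun_prop

lemma measurable_armProb (P : ProbabilityMeasure (Obs 𝒳)) (t : Bool) : Measurable (armProb P t) :=
  measurable_propensity (measurable_condProbTreated _ _ _) t

lemma armProb_mem (P : ProbabilityMeasure (Obs 𝒳)) (t : Bool) (x : 𝒳) :
    armProb P t x ∈ Set.Icc (0 : ℝ) 1 := propensity_condProbTreated_mem _ _ _ t x

lemma propensity_not {𝒳 : Type*} (e : 𝒳 → ℝ) (t : Bool) (x : 𝒳) :
    propensity e (!t) x = 1 - propensity e t x := by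
  cases t <;> simp [propensity]

lemma armProb_not (P : ProbabilityMeasure (Obs 𝒳)) (t : Bool) (x : 𝒳) :
    armProb P (!t) x = 1 - armProb P t x := propensity_not _ t x

/-- The law of `(X, Y)` on `{A = t}`. -/
def armLaw (P : ProbabilityMeasure (Obs 𝒳)) (t : Bool) : Measure (𝒳 × ℝ) :=
  ((P : Measure (Obs 𝒳)).restrict {z | z.a = t}).map (fun z => (z.x, z.y))

/-- The law of `X` on `{A ≠ t}`, extended by the conditional law of `Y` given `X` and `A = t`. -/
def swapLaw (P : ProbabilityMeasure (Obs 𝒳)) (t : Bool) : Measure (𝒳 × ℝ) :=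
  ((covLaw P).withDensity (fun x => ENNReal.ofReal (1 - armProb P t x))) ⊗ₘ outcomeKernel P t

lemma lintegral_obs (P : ProbabilityMeasure (Obs 𝒳)) {f : 𝒳 → Bool → ℝ → ENNReal}
    (hf : Measurable (fun w : (𝒳 × Bool) × ℝ => f w.1.1 w.1.2 w.2)) :
    ∫⁻ z, f z.x z.a z.y ∂(P : Measure (Obs 𝒳)) =
      ∫⁻ x, ∑ t, ENNReal.ofReal (armProb P t x) * ∫⁻ y, f x t y ∂(outcomeKernel P t x)
        ∂(covLaw P) := by
  have hxa : Measurable (fun z : Obs 𝒳 => (z.x, z.a)) :=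
    Obs.measurable_x.prodMk Obs.measurable_a
  have h1 : ∫⁻ z, f z.x z.a z.y ∂(P : Measure (Obs 𝒳)) =
      ∫⁻ w, f w.1.1 w.1.2 w.2 ∂((P : Measure (Obs 𝒳)).map fun z => ((z.x, z.a), z.y)) := by
    rw [lintegral_map hf (hxa.prodMk Obs.measurable_y)]
  rw [h1, ← compProd_map_condDistrib Obs.measurable_y.aemeasurable, Measure.lintegral_compProd hf,
    ← compProd_map_condDistrib Obs.measurable_a.aemeasurable,
    Measure.lintegral_compProd (hf.lintegral_kernel_prod_right')]
  refine lintegral_congr fun x => ?_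
  rw [lintegral_fintype]
  refine Finset.sum_congr rfl fun t _ => ?_
  rw [condDistrib_singleton, mul_comm]
  rfl

lemma lintegral_armLaw (P : ProbabilityMeasure (Obs 𝒳)) (t : Bool) {f : 𝒳 × ℝ → ENNReal}
    (hf : Measurable f) :
    ∫⁻ w, f w ∂(armLaw P t) = ∫⁻ x, ENNReal.ofReal (armProb P t x) *
      ∫⁻ y, f (x, y) ∂(outcomeKernel P t x) ∂(covLaw P) := by
  have hg : Measurable (fun w : (𝒳 × Bool) × ℝ => if w.1.2 = t then f (w.1.1, w.2) else 0) := by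
    refine Measurable.ite ?_ (by fun_prop) measurable_const
    exact (measurable_snd.comp measurable_fst) (measurableSet_singleton t)
  have h := lintegral_obs P (f := fun x s y => if s = t then f (x, y) else 0) hg
  rw [armLaw, lintegral_map hf Obs.measurable_xy, ← lintegral_indicator (Obs.measurableSet_a t)]
  refine (lintegral_congr fun z => ?_).trans (h.trans ?_)
  · simp [Set.indicator_apply]
  refine lintegral_congr fun x => ?_
  rw [Finset.sum_eq_single t]
  · simp
  · intro s _ hs; simp [hs]
  · simp

lemma armLaw_eq (P : ProbabilityMeasure (Obs 𝒳)) (t : Bool) :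
    armLaw P t = ((covLaw P).withDensity (fun x => ENNReal.ofReal (armProb P t x)))
      ⊗ₘ outcomeKernel P t := by
  refine Measure.ext_of_lintegral _ fun f hf => ?_
  rw [lintegral_armLaw P t hf, Measure.lintegral_compProd hf, lintegral_withDensity_eq_lintegral_mul]
  · rfl
  · exact (measurable_armProb P t).ennreal_ofReal
  · exact hf.lintegral_kernel_prod_right'

lemma lintegral_swapLaw (P : ProbabilityMeasure (Obs 𝒳)) (t : Bool) {f : 𝒳 × ℝ → ENNReal}
    (hf : Measurable f) :
    ∫⁻ w, f w ∂(swapLaw P t) = ∫⁻ x, ENNReal.ofReal (1 - armProb P t x) *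
      ∫⁻ y, f (x, y) ∂(outcomeKernel P t x) ∂(covLaw P) := by
  rw [swapLaw, Measure.lintegral_compProd hf, lintegral_withDensity_eq_lintegral_mul]
  · rfl
  · exact (measurable_const.sub (measurable_armProb P t)).ennreal_ofReal
  · exact hf.lintegral_kernel_prod_right'

/-- The swapped law has density `(1 - p) / p` with respect to the law of the arm. -/
lemma swapLaw_eq_withDensity (P : ProbabilityMeasure (Obs 𝒳)) (t : Bool)
    (hpos : ∀ᵐ x ∂(covLaw P), 0 < armProb P t x) :
    swapLaw P t = (armLaw P t).withDensity
      (fun w => ENNReal.ofReal ((1 - armProb P t w.1) / armProb P t w.1)) := by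
  have hm := measurable_armProb P t
  have hd : Measurable (fun w : 𝒳 × ℝ =>
      ENNReal.ofReal ((1 - armProb P t w.1) / armProb P t w.1)) := by fun_prop
  refine Measure.ext_of_lintegral _ fun f hf => ?_
  rw [lintegral_swapLaw P t hf, lintegral_withDensity_eq_lintegral_mul _ hd hf,
    lintegral_armLaw P t (hd.mul hf)]
  refine lintegral_congr_ae ?_
  filter_upwards [hpos] with x hx
  simp only [Pi.mul_apply]
  rw [lintegral_const_mul _ (by fun_prop), ← mul_assoc, ← ENNReal.ofReal_mul hx.le,
    mul_div_cancel₀ _ hx.ne']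

end Observed

/-! ### Laws of the full data, and disintegration along `(X, U)`. -/

section FullData
variable {𝒳 : Type*} [MeasurableSpace 𝒳] {k : ℕ}

namespace Full

lemma measurable_x : Measurable (x : Full 𝒳 k → 𝒳) := measurable_fst
lemma measurable_y1 : Measurable (y1 : Full 𝒳 k → ℝ) :=
  measurable_fst.comp (measurable_fst.comp measurable_snd)
lemma measurable_y0 : Measurable (y0 : Full 𝒳 k → ℝ) :=
  measurable_snd.comp (measurable_fst.comp measurable_snd)
lemma measurable_ys : Measurable (fun o : Full 𝒳 k => (o.y1, o.y0)) :=
  measurable_y1.prodMk measurable_y0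
lemma measurable_a : Measurable (a : Full 𝒳 k → Bool) :=
  measurable_fst.comp (measurable_snd.comp measurable_snd)
lemma measurableSet_a (t : Bool) : MeasurableSet {o : Full 𝒳 k | o.a = t} :=
  measurable_a (measurableSet_singleton t)

end Full

/-- The component of a pair of potential outcomes `(y(1), y(0))` for treatment `t`. -/
def outcome (t : Bool) (y : ℝ × ℝ) : ℝ := if t then y.1 else y.2

lemma measurable_outcome (t : Bool) : Measurable (outcome t) := by
  cases t
  · exact measurable_snd
  · exact measurable_fst

/-- The potential outcome `Y(t)`. -/
def Full.yt (t : Bool) (o : Full 𝒳 k) : ℝ := outcome t (o.y1, o.y0)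

lemma Full.measurable_yt (t : Bool) : Measurable (Full.yt t : Full 𝒳 k → ℝ) :=
  (measurable_outcome t).comp Full.measurable_ys

/-- The law of `(X, Y(t))` on `{A ≠ t}`. -/
def counterLaw (Q : ProbabilityMeasure (Full 𝒳 k)) (t : Bool) : Measure (𝒳 × ℝ) :=
  ((Q : Measure (Full 𝒳 k)).restrict {o | o.a = !t}).map (fun o => (o.x, o.yt t))

lemma lintegral_counterLaw (Q : ProbabilityMeasure (Full 𝒳 k)) (t : Bool) {f : 𝒳 × ℝ → ENNReal}
    (hf : Measurable f) :
    ∫⁻ w, f w ∂(counterLaw Q t) =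
      ∫⁻ o in {o | o.a = !t}, f (o.x, o.yt t) ∂(Q : Measure (Full 𝒳 k)) :=
  lintegral_map hf (Full.measurable_x.prodMk (Full.measurable_yt t))

lemma coe_observedLaw (Q : ProbabilityMeasure (Full 𝒳 k)) :
    (observedLaw Q : Measure (Obs 𝒳)) = (Q : Measure (Full 𝒳 k)).map Full.obs := rfl

/-- On `{A = t}` the outcome `Y(t)` is observed. -/
lemma map_restrict_eq_armLaw (Q : ProbabilityMeasure (Full 𝒳 k)) (t : Bool) :
    ((Q : Measure (Full 𝒳 k)).restrict {o | o.a = t}).map (fun o => (o.x, o.yt t)) =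
      armLaw (observedLaw Q) t := by
  have hs : {o : Full 𝒳 k | o.a = t} = Full.obs ⁻¹' {z | z.a = t} := rfl
  rw [armLaw, coe_observedLaw, Measure.restrict_map Full.measurable_obs (Obs.measurableSet_a t),
    Measure.map_map Obs.measurable_xy Full.measurable_obs, ← hs]
  refine Measure.map_congr ?_
  filter_upwards [ae_restrict_mem (Full.measurableSet_a t)] with o ho
  have ho : o.a = t := ho
  subst ho
  rfl

lemma lintegral_armLaw_observedLaw (Q : ProbabilityMeasure (Full 𝒳 k)) (t : Bool)
    {f : 𝒳 × ℝ → ENNReal} (hf : Measurable f) :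
    ∫⁻ w, f w ∂(armLaw (observedLaw Q) t) =
      ∫⁻ o in {o | o.a = t}, f (o.x, o.yt t) ∂(Q : Measure (Full 𝒳 k)) := by
  rw [← map_restrict_eq_armLaw]
  exact lintegral_map hf (Full.measurable_x.prodMk (Full.measurable_yt t))

lemma covLaw_observedLaw (Q : ProbabilityMeasure (Full 𝒳 k)) :
    covLaw (observedLaw Q) = (Q : Measure (Full 𝒳 k)).map Full.x := by
  rw [covLaw, coe_observedLaw, Measure.map_map Obs.measurable_x Full.measurable_obs]
  rfl

/-- The nominal propensity score depends only on the observed law. -/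
lemma condProbTreated_observedLaw (Q : ProbabilityMeasure (Full 𝒳 k)) :
    ∀ᵐ x ∂(covLaw (observedLaw Q)),
      condProbTreated (observedLaw Q : Measure (Obs 𝒳)) Obs.a Obs.x x =
        condProbTreated (Q : Measure (Full 𝒳 k)) Full.a Full.x x := by
  have h : condDistrib Full.a Full.x (Q : Measure (Full 𝒳 k))
      =ᵐ[(Q : Measure (Full 𝒳 k)).map Full.x]
        condDistrib Obs.a Obs.x (observedLaw Q : Measure (Obs 𝒳)) := by
    rw [condDistrib_ae_eq_iff_measure_eq_compProd _ Full.measurable_a.aemeasurable,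
      ← covLaw_observedLaw, covLaw, compProd_map_condDistrib Obs.measurable_a.aemeasurable,
      coe_observedLaw, Measure.map_map (Obs.measurable_x.prodMk Obs.measurable_a)
        Full.measurable_obs]
    rfl
  rw [covLaw_observedLaw]
  filter_upwards [h] with x hx
  simp only [condProbTreated]
  rw [hx]

variable [StandardBorelSpace 𝒳]

/-- Disintegration along `(X, U)` of a law under which the potential outcomes and the treatment are
conditionally independent given `(X, U)`. -/
lemma lintegral_of_condIndepFun (Q : ProbabilityMeasure (Full 𝒳 k))
    (h : CondIndepFun (MeasurableSpace.comap Full.xu inferInstance) Full.measurable_xu.comap_le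
      (fun o : Full 𝒳 k => (o.y1, o.y0)) Full.a (Q : Measure (Full 𝒳 k)))
    (t : Bool) {f : 𝒳 × ℝ × ℝ → ENNReal} (hf : Measurable f) :
    ∫⁻ o in {o | o.a = t}, f (o.x, o.y1, o.y0) ∂(Q : Measure (Full 𝒳 k)) =
      ∫⁻ v, ENNReal.ofReal
          (propensity (condProbTreated (Q : Measure (Full 𝒳 k)) Full.a Full.xu) t v) *
        ∫⁻ y, f (v.1, y) ∂(condDistrib (fun o : Full 𝒳 k => (o.y1, o.y0)) Full.xu
          (Q : Measure (Full 𝒳 k)) v) ∂((Q : Measure (Full 𝒳 k)).map Full.xu) := by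
  have : Nonempty 𝒳 := (Q.nonempty).map Full.x
  rw [condIndepFun_iff_map_prod_eq_prod_condDistrib_prod_condDistrib Full.measurable_ys
    Full.measurable_a Full.measurable_xu, ← Measure.compProd_eq_comp_prod] at h
  have hg : Measurable (fun w : (𝒳 × EuclideanSpace ℝ (Fin k)) × (ℝ × ℝ) × Bool =>
      if w.2.2 = t then f (w.1.1, w.2.1) else 0) := by
    refine Measurable.ite ?_ (by fun_prop) measurable_const
    exact (measurable_snd.comp measurable_snd) (measurableSet_singleton t)
  rw [← lintegral_indicator (Full.measurableSet_a t)]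
  have h1 : ∫⁻ o, {o : Full 𝒳 k | o.a = t}.indicator (fun o => f (o.x, o.y1, o.y0)) o
        ∂(Q : Measure (Full 𝒳 k)) =
      ∫⁻ w, (if w.2.2 = t then f (w.1.1, w.2.1) else 0) ∂((Q : Measure (Full 𝒳 k)).map
        (fun o => (o.xu, (o.y1, o.y0), o.a))) := by
    rw [lintegral_map hg (Full.measurable_xu.prodMk
      (Full.measurable_ys.prodMk Full.measurable_a))]
    refine lintegral_congr fun o => ?_
    simp [Set.indicator_apply, Full.xu]
  rw [h1, h, Measure.lintegral_compProd hg]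
  refine lintegral_congr fun v => ?_
  have hgv : Measurable (fun b : (ℝ × ℝ) × Bool => if b.2 = t then f (v.1, b.1) else 0) :=
    hg.comp (measurable_prodMk_left (x := v))
  rw [Kernel.prod_apply]
  refine (lintegral_prod_symm _ hgv.aemeasurable).trans ?_
  rw [lintegral_fintype,
    Finset.sum_eq_single t]
  · simp [condDistrib_singleton, mul_comm]
  · intro s _ hs; simp [hs]
  · simp

end FullData

/-! ### The sensitivity model as a two-sided domination of measures. -/

lemma odds_mem_Ioo {p : ℝ} (hp : p ∈ Set.Icc (0 : ℝ) 1) (h : odds p ≠ 0) :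
    p ∈ Set.Ioo (0 : ℝ) 1 := by
  rcases hp with ⟨h0, h1⟩
  refine ⟨lt_of_le_of_ne h0 ?_, lt_of_le_of_ne h1 ?_⟩
  · rintro rfl; simp [odds] at h
  -- At `p = 1` the odds are `1 / 0 = 0`, so this endpoint is excluded like `p = 0`.
  · rintro rfl; simp [odds] at h

/-- Clearing denominators in the odds ratio. The two pairs of inequalities are those needed for the
treated and for the control arm. -/
lemma bounds_of_odds_ratio {Λ p e : ℝ} (hΛ : 1 ≤ Λ) (hp : p ∈ Set.Icc (0 : ℝ) 1)
    (he : e ∈ Set.Icc (0 : ℝ) 1) (h : odds p / odds e ∈ Set.Icc (1 / Λ) Λ) :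
    e ∈ Set.Ioo (0 : ℝ) 1 ∧
      (1 - p ≤ Λ * ((1 - e) / e * p) ∧ (1 - e) / e * p ≤ Λ * (1 - p)) ∧
      (p ≤ Λ * (e / (1 - e) * (1 - p)) ∧ e / (1 - e) * (1 - p) ≤ Λ * p) := by
  have hΛ0 : 0 < Λ := by linarith
  have hne : odds p / odds e ≠ 0 := (lt_of_lt_of_le (by positivity) h.1).ne'
  have hp' := odds_mem_Ioo hp fun h0 => hne (by simp [h0])
  have he' := odds_mem_Ioo he fun h0 => hne (by simp [h0])
  refine ⟨he', ?_⟩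
  obtain ⟨hp0, hp1⟩ := hp'
  obtain ⟨he0, he1⟩ := he'
  have q1 : 0 < 1 - p := by linarith
  have e1 : 0 < 1 - e := by linarith
  have hr : odds p / odds e = (p * (1 - e)) / ((1 - p) * e) := by
    unfold odds; field_simp
  rw [hr, Set.mem_Icc, div_le_div_iff₀ hΛ0 (by positivity), div_le_iff₀ (by positivity)] at h
  obtain ⟨h1, h2⟩ := h
  have a1 : (1 - e) / e * p = (p * (1 - e)) / e := by ring
  have a2 : e / (1 - e) * (1 - p) = ((1 - p) * e) / (1 - e) := by ring
  rw [a1, a2]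
  refine ⟨⟨?_, ?_⟩, ?_, ?_⟩
  · rw [← mul_div_assoc, le_div_iff₀ he0]; linarith
  · rw [div_le_iff₀ he0]; linarith
  · rw [← mul_div_assoc, le_div_iff₀ e1]; linarith
  · rw [div_le_iff₀ e1]; linarith

section Sandwich
variable {𝒳 : Type*} [MeasurableSpace 𝒳] [StandardBorelSpace 𝒳] {k : ℕ} {Λ : ℝ}

/-- Overlap, and the bounds on the confounded propensity score in terms of the nominal one. -/
lemma MarginalSensitivityModel.bounds (hΛ : 1 ≤ Λ) {Q : ProbabilityMeasure (Full 𝒳 k)}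
    (hQ : MarginalSensitivityModel Λ Q) (t : Bool) :
    ∀ᵐ v ∂((Q : Measure (Full 𝒳 k)).map Full.xu),
      armProb (observedLaw Q) t v.1 ∈ Set.Ioo (0 : ℝ) 1 ∧
      propensity (condProbTreated (Q : Measure (Full 𝒳 k)) Full.a Full.xu) (!t) v ≤
        Λ * ((1 - armProb (observedLaw Q) t v.1) / armProb (observedLaw Q) t v.1 *
          propensity (condProbTreated (Q : Measure (Full 𝒳 k)) Full.a Full.xu) t v) ∧
      (1 - armProb (observedLaw Q) t v.1) / armProb (observedLaw Q) t v.1 *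
          propensity (condProbTreated (Q : Measure (Full 𝒳 k)) Full.a Full.xu) t v ≤
        Λ * propensity (condProbTreated (Q : Measure (Full 𝒳 k)) Full.a Full.xu) (!t) v := by
  have hm1 := measurable_armProb (observedLaw Q) t
  have hm2 := measurable_propensity
    (measurable_condProbTreated (Q : Measure (Full 𝒳 k)) Full.a Full.xu) t
  have hm3 := measurable_propensity
    (measurable_condProbTreated (Q : Measure (Full 𝒳 k)) Full.a Full.xu) (!t)
  rw [ae_map_iff Full.measurable_xu.aemeasurable]
  · have hx := condProbTreated_observedLaw Q
    rw [covLaw_observedLaw] at hx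
    filter_upwards [hQ.odds_ratio, ae_of_ae_map Full.measurable_x.aemeasurable hx] with o ho hxo
    have hp := propensity_condProbTreated_mem (Q : Measure (Full 𝒳 k)) Full.a Full.xu true o.xu
    have he := armProb_mem (observedLaw Q) true o.x
    rw [← hxo] at ho
    obtain ⟨h1, ⟨h2, h3⟩, h4, h5⟩ := bounds_of_odds_ratio hΛ hp he ho
    cases t
    · refine ⟨⟨?_, ?_⟩, ?_, ?_⟩
      · have := h1.2; simp [armProb, propensity, Full.xu] at this ⊢; linarith
      · have := h1.1; simp [armProb, propensity, Full.xu] at this ⊢; linarith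
      · simpa [armProb, propensity, Full.xu] using h4
      · simpa [armProb, propensity, Full.xu] using h5
    · exact ⟨h1, by simpa [armProb, propensity, Full.xu] using h2,
        by simpa [armProb, propensity, Full.xu] using h3⟩
  · have hr : Measurable (fun v : 𝒳 × EuclideanSpace ℝ (Fin k) =>
        (1 - armProb (observedLaw Q) t v.1) / armProb (observedLaw Q) t v.1) := by fun_prop
    refine MeasurableSet.inter ?_ (MeasurableSet.inter ?_ ?_)
    · exact (hm1.comp measurable_fst) measurableSet_Ioo
    · exact measurableSet_le hm3 (measurable_const.mul (hr.mul hm2))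
    · exact measurableSet_le (hr.mul hm2) (measurable_const.mul hm3)

/-- A degenerate propensity would make the odds ratio `0`, which is below `1/Λ`; overlap is
therefore part of the model. It concerns the observed law only. -/
lemma MarginalSensitivityModel.overlap (hΛ : 1 ≤ Λ) {Q : ProbabilityMeasure (Full 𝒳 k)}
    (hQ : MarginalSensitivityModel Λ Q) (t : Bool) :
    ∀ᵐ x ∂(covLaw (observedLaw Q)), armProb (observedLaw Q) t x ∈ Set.Ioo (0 : ℝ) 1 := by
  have h := ae_of_ae_map Full.measurable_xu.aemeasurable (hQ.bounds hΛ t)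
  rw [covLaw_observedLaw, ae_map_iff Full.measurable_x.aemeasurable
    ((measurable_armProb _ _) measurableSet_Ioo)]
  filter_upwards [h] with o ho using ho.1

/-- Together with the formula for `swapLaw` that follows, this exhibits two mixtures of one and the
same conditional law of `Y(t)` given `(X, U)`, so that comparing the measures reduces to comparing
two scalar weights. -/
lemma MarginalSensitivityModel.lintegral_counterLaw (Q : ProbabilityMeasure (Full 𝒳 k))
    (hQ : MarginalSensitivityModel Λ Q) (t : Bool) {f : 𝒳 × ℝ → ENNReal} (hf : Measurable f) :
    ∫⁻ w, f w ∂(counterLaw Q t) =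
      ∫⁻ v, ENNReal.ofReal
          (propensity (condProbTreated (Q : Measure (Full 𝒳 k)) Full.a Full.xu) (!t) v) *
        ∫⁻ y, f (v.1, outcome t y) ∂(condDistrib (fun o : Full 𝒳 k => (o.y1, o.y0)) Full.xu
          (Q : Measure (Full 𝒳 k)) v) ∂((Q : Measure (Full 𝒳 k)).map Full.xu) := by
  rw [RobustPolicy.lintegral_counterLaw Q t hf]
  exact lintegral_of_condIndepFun Q hQ.condIndep (!t) (f := fun w => f (w.1, outcome t w.2))
    (hf.comp (measurable_fst.prodMk ((measurable_outcome t).comp measurable_snd)))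

lemma MarginalSensitivityModel.lintegral_swapLaw (hΛ : 1 ≤ Λ) (Q : ProbabilityMeasure (Full 𝒳 k))
    (hQ : MarginalSensitivityModel Λ Q) (t : Bool) {f : 𝒳 × ℝ → ENNReal} (hf : Measurable f) :
    ∫⁻ w, f w ∂(swapLaw (observedLaw Q) t) =
      ∫⁻ v, ENNReal.ofReal
          ((1 - armProb (observedLaw Q) t v.1) / armProb (observedLaw Q) t v.1 *
          propensity (condProbTreated (Q : Measure (Full 𝒳 k)) Full.a Full.xu) t v) *
        ∫⁻ y, f (v.1, outcome t y) ∂(condDistrib (fun o : Full 𝒳 k => (o.y1, o.y0)) Full.xu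
          (Q : Measure (Full 𝒳 k)) v) ∂((Q : Measure (Full 𝒳 k)).map Full.xu) := by
  have hm := measurable_armProb (observedLaw Q) t
  have ho := measurable_outcome t
  have hd : Measurable (fun w : 𝒳 × ℝ => ENNReal.ofReal
      ((1 - armProb (observedLaw Q) t w.1) / armProb (observedLaw Q) t w.1)) := by fun_prop
  rw [swapLaw_eq_withDensity _ _ ((hQ.overlap hΛ t).mono fun x hx => hx.1),
    lintegral_withDensity_eq_lintegral_mul _ hd hf, lintegral_armLaw_observedLaw Q t (hd.mul hf)]
  refine (lintegral_of_condIndepFun Q hQ.condIndep t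
    (f := fun w => (ENNReal.ofReal ((1 - armProb (observedLaw Q) t w.1) /
      armProb (observedLaw Q) t w.1)) * f (w.1, outcome t w.2)) (by fun_prop)).trans ?_
  refine lintegral_congr fun v => ?_
  have hr := armProb_mem (observedLaw Q) t v.1
  simp only
  rw [lintegral_const_mul _ (by fun_prop), ← mul_assoc,
    ENNReal.ofReal_mul (div_nonneg (by linarith [hr.2]) hr.1), mul_comm (ENNReal.ofReal _)]

/-- The counterfactual outcome law is within a factor `Λ` of the swapped law. -/
lemma MarginalSensitivityModel.counterLaw_le (hΛ : 1 ≤ Λ) {Q : ProbabilityMeasure (Full 𝒳 k)}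
    (hQ : MarginalSensitivityModel Λ Q) (t : Bool) :
    counterLaw Q t ≤ ENNReal.ofReal Λ • swapLaw (observedLaw Q) t := by
  refine Measure.le_iff.2 fun s hs => ?_
  have hf : Measurable (s.indicator (1 : 𝒳 × ℝ → ENNReal)) := measurable_one.indicator hs
  rw [Measure.smul_apply, ← lintegral_indicator_one hs, ← lintegral_indicator_one hs,
    hQ.lintegral_counterLaw Q t hf, hQ.lintegral_swapLaw hΛ Q t hf, smul_eq_mul,
    ← lintegral_const_mul' _ _ ENNReal.ofReal_ne_top]
  refine lintegral_mono_ae ?_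
  filter_upwards [hQ.bounds hΛ t] with v hv
  rw [← mul_assoc, ← ENNReal.ofReal_mul (by linarith)]
  refine mul_le_mul_left (ENNReal.ofReal_le_ofReal ?_) _
  exact hv.2.1

/-- The other half of the odds-ratio bound. It keeps the positive and negative parts of `Y(t) - q`
from shrinking by more than `Λ`, and it carries integrability from a full-data law to the observed
law. -/
lemma MarginalSensitivityModel.swapLaw_le (hΛ : 1 ≤ Λ) {Q : ProbabilityMeasure (Full 𝒳 k)}
    (hQ : MarginalSensitivityModel Λ Q) (t : Bool) :
    swapLaw (observedLaw Q) t ≤ ENNReal.ofReal Λ • counterLaw Q t := by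
  refine Measure.le_iff.2 fun s hs => ?_
  have hf : Measurable (s.indicator (1 : 𝒳 × ℝ → ENNReal)) := measurable_one.indicator hs
  rw [Measure.smul_apply, ← lintegral_indicator_one hs, ← lintegral_indicator_one hs,
    hQ.lintegral_counterLaw Q t hf, hQ.lintegral_swapLaw hΛ Q t hf, smul_eq_mul,
    ← lintegral_const_mul' _ _ ENNReal.ofReal_ne_top]
  refine lintegral_mono_ae ?_
  filter_upwards [hQ.bounds hΛ t] with v hv
  rw [← mul_assoc, ← ENNReal.ofReal_mul (by linarith)]
  refine mul_le_mul_left (ENNReal.ofReal_le_ofReal ?_) _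
  exact hv.2.2

end Sandwich

/-! ### Quantiles of a probability measure on the line. -/

section Quantile
variable (μ : Measure ℝ) [IsProbabilityMeasure μ]

/-- The `α`-quantile `inf {q : F(q) ≥ α}`. -/
def quantile (μ : Measure ℝ) (α : ℝ) : ℝ := sInf {q : ℝ | α ≤ μ.real (Set.Iic q)}

variable {α : ℝ}

lemma bddBelow_quantile_set (h0 : 0 < α) : BddBelow {q : ℝ | α ≤ μ.real (Set.Iic q)} := by
  have h := (tendsto_cdf_atBot μ).eventually (gt_mem_nhds h0)
  obtain ⟨b, hb⟩ := h.exists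
  refine ⟨b, fun q hq => ?_⟩
  by_contra! hlt
  have h1 := monotone_cdf μ hlt.le
  rw [cdf_eq_real μ q] at h1
  have hq : α ≤ μ.real (Set.Iic q) := hq
  linarith

/-- Right continuity of the distribution function: the infimum is attained. -/
lemma le_measureReal_Iic_quantile (h1 : α < 1) :
    α ≤ μ.real (Set.Iic (quantile μ α)) := by
  have hne : {q : ℝ | α ≤ μ.real (Set.Iic q)}.Nonempty := by
    obtain ⟨b, hb⟩ := ((tendsto_cdf_atTop μ).eventually (lt_mem_nhds h1)).exists
    rw [cdf_eq_real] at hb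
    exact ⟨b, hb.le⟩
  rw [← cdf_eq_real]
  have ht : Filter.Tendsto (cdf μ) (nhdsWithin (quantile μ α) (Set.Ioi (quantile μ α)))
      (nhds (cdf μ (quantile μ α))) :=
    ((cdf μ).right_continuous _).tendsto.mono_left (nhdsWithin_mono _ Set.Ioi_subset_Ici_self)
  refine ge_of_tendsto ht ?_
  filter_upwards [self_mem_nhdsWithin] with y hy
  obtain ⟨z, hz, hzy⟩ := exists_lt_of_csInf_lt hne (show sInf _ < y from hy)
  have h2 := monotone_cdf μ hzy.le
  rw [cdf_eq_real μ z] at h2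
  exact le_trans hz h2

/-- Translates sublevel sets of the quantile into conditions on the distribution function, which is
what makes conditional quantiles measurable in `x`. -/
lemma quantile_le_iff (h0 : 0 < α) (h1 : α < 1) (c : ℝ) :
    quantile μ α ≤ c ↔ α ≤ μ.real (Set.Iic c) := by
  refine ⟨fun h => (le_measureReal_Iic_quantile μ h1).trans
    (measureReal_mono (Set.Iic_subset_Iic.2 h)), fun h => csInf_le (bddBelow_quantile_set μ h0) h⟩

/-- Left of the quantile the distribution function stays below `α`, and the mass of the open
half-line is its left limit. -/
lemma measureReal_Iio_quantile_le (h0 : 0 < α) (h1 : α < 1) :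
    μ.real (Set.Iio (quantile μ α)) ≤ α := by
  have h : μ (Set.Iio (quantile μ α)) ≤ ENNReal.ofReal α := by
    rw [← measure_cdf μ, StieltjesFunction.measure_Iio _ (tendsto_cdf_atBot μ), sub_zero,
      measure_cdf]
    refine ENNReal.ofReal_le_ofReal ?_
    refine le_of_tendsto ((monotone_cdf μ).tendsto_leftLim _) ?_
    filter_upwards [self_mem_nhdsWithin] with y hy
    rw [cdf_eq_real]
    by_contra! hlt
    exact absurd ((quantile_le_iff μ h0 h1 y).2 hlt.le) (not_le.2 hy)
  exact ENNReal.toReal_le_of_le_ofReal h0.le h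

lemma measureReal_Iio_quantile_of_no_atom (h0 : 0 < α) (h1 : α < 1)
    (hq : μ {quantile μ α} = 0) : μ.real (Set.Iio (quantile μ α)) = α := by
  refine le_antisymm (measureReal_Iio_quantile_le μ h0 h1) ?_
  refine (le_measureReal_Iic_quantile μ h1).trans (le_of_eq ?_)
  rw [← Set.Iio_union_right, measureReal_union (by simp) (measurableSet_singleton _),
    measureReal_def μ {_}, hq]
  simp

/-- Markov's inequality: `{|Y| ≥ |q|}` contains `{Y ≤ q}`, of mass at least `α`, when `q ≤ 0`, and
`{Y ≥ q}`, of mass at least `1 - α`, when `q ≥ 0`. The constant depends on `α` only, so conditional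
quantiles inherit integrability from `Y`. -/
lemma abs_quantile_le (h0 : 0 < α) (h1 : α < 1) (hi : Integrable (fun y => y) μ) :
    |quantile μ α| ≤ (1 / α + 1 / (1 - α)) * ∫ y, |y| ∂μ := by
  set q := quantile μ α with hqdef
  have hb : 0 < 1 - α := by linarith
  have hI : 0 ≤ ∫ y, |y| ∂μ := integral_nonneg fun y => abs_nonneg y
  have hM : |q| * μ.real {y | |q| ≤ |y|} ≤ ∫ y, |y| ∂μ :=
    mul_meas_ge_le_integral_of_nonneg (Filter.Eventually.of_forall fun y => abs_nonneg y) hi.abs _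
  rw [add_mul]
  rcases le_total q 0 with hq | hq
  · have : α ≤ μ.real {y | |q| ≤ |y|} := by
      refine (le_measureReal_Iic_quantile μ h1).trans (measureReal_mono fun y hy => ?_)
      have hy : y ≤ q := hy
      simp only [Set.mem_ofPred_eq]
      rw [abs_of_nonpos hq, abs_of_nonpos (hy.trans hq)]; linarith
    have h2 : |q| * α ≤ ∫ y, |y| ∂μ :=
      (mul_le_mul_of_nonneg_left this (abs_nonneg q)).trans hM
    have h3 : |q| ≤ 1 / α * ∫ y, |y| ∂μ := by
      rw [one_div, inv_mul_eq_div, le_div_iff₀ h0]; exact h2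
    have : 0 ≤ 1 / (1 - α) * ∫ y, |y| ∂μ := by positivity
    linarith
  · have : 1 - α ≤ μ.real {y | |q| ≤ |y|} := by
      have h2 : 1 - α ≤ μ.real (Set.Iio q)ᶜ := by
        rw [probReal_compl_eq_one_sub measurableSet_Iio]
        linarith [measureReal_Iio_quantile_le μ h0 h1]
      refine h2.trans (measureReal_mono fun y hy => ?_)
      have hy : q ≤ y := by simpa using hy
      simp only [Set.mem_ofPred_eq]
      rw [abs_of_nonneg hq, abs_of_nonneg (hq.trans hy)]; exact hy
    have h2 : |q| * (1 - α) ≤ ∫ y, |y| ∂μ :=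
      (mul_le_mul_of_nonneg_left this (abs_nonneg q)).trans hM
    have h3 : |q| ≤ 1 / (1 - α) * ∫ y, |y| ∂μ := by
      rw [one_div, inv_mul_eq_div, le_div_iff₀ hb]; exact h2
    have : 0 ≤ 1 / α * ∫ y, |y| ∂μ := by positivity
    linarith

end Quantile

/-! ### The tilted outcome. -/

section Tilt

/-- The slope `d` below `q` and `c` from `q` on. -/
def slope (c d q y : ℝ) : ℝ := if q ≤ y then c else d

/-- The piecewise linear function through `(q, q)` with slope `d` below and `c` above `q`. -/
def tilt (c d q y : ℝ) : ℝ := q + slope c d q y * (y - q)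

/-- In this form there is no case distinction: continuity in `q` across the kink is visible, and
comparisons can be made on the two parts separately. -/
lemma tilt_eq_max_min (c d q y : ℝ) :
    tilt c d q y = q + (c * max (y - q) 0 + d * min (y - q) 0) := by
  unfold tilt slope
  split_ifs with h
  · rw [max_eq_left (by linarith), min_eq_right (by linarith)]; ring
  · rw [max_eq_right (by linarith), min_eq_left (by linarith)]; ring

lemma slope_mem (c d q y : ℝ) : slope c d q y = c ∨ slope c d q y = d := by
  unfold slope; split_ifs <;> simp

lemma abs_slope_le (c d q y : ℝ) : |slope c d q y| ≤ |c| + |d| := by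
  rcases slope_mem c d q y with h | h <;> rw [h]
  · linarith [abs_nonneg d]
  · linarith [abs_nonneg c]

lemma measurable_slope {Ω : Type*} [MeasurableSpace Ω] (c d : ℝ) {q y : Ω → ℝ} (hq : Measurable q)
    (hy : Measurable y) : Measurable (fun w => slope c d (q w) (y w)) :=
  Measurable.ite (measurableSet_le hq hy) measurable_const measurable_const

lemma measurable_tilt {Ω : Type*} [MeasurableSpace Ω] (c d : ℝ) {q y : Ω → ℝ} (hq : Measurable q)
    (hy : Measurable y) : Measurable (fun w => tilt c d (q w) (y w)) :=
  hq.add ((measurable_slope c d hq hy).mul (hy.sub hq))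

lemma abs_tilt_le (c d q y : ℝ) : |tilt c d q y| ≤ (1 + |c| + |d|) * (|y| + |q|) := by
  have h1 := abs_slope_le c d q y
  have h2 : |y - q| ≤ |y| + |q| := abs_sub y q
  have h3 : |tilt c d q y| ≤ |q| + |slope c d q y| * |y - q| := by
    unfold tilt; rw [← abs_mul]; exact abs_add_le _ _
  have h4 : |slope c d q y| * |y - q| ≤ (|c| + |d|) * (|y| + |q|) := by gcongr
  nlinarith [abs_nonneg y, abs_nonneg q]

variable (μ : Measure ℝ) [IsProbabilityMeasure μ] {α c d : ℝ}

lemma integrable_slope (q : ℝ) : Integrable (fun y => slope c d q y) μ :=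
  Integrable.of_bound (measurable_slope c d measurable_const measurable_id).aestronglyMeasurable
    (|c| + |d|) (Filter.Eventually.of_forall fun y => abs_slope_le c d q y)

lemma slope_eq_indicator (q : ℝ) : (fun y => slope c d q y) =
    fun y => c + (d - c) * (Set.Iio q).indicator 1 y := by
  ext y
  unfold slope
  by_cases h : q ≤ y
  · simp [h]
  · simp [h, not_le.1 h]

/-- Mass `α` carries slope `d` and mass `1 - α` carries slope `c`, so the relation between `c`, `d`
and `α` makes the slope a probability density. Equivalently, the mean of the tilt is stationary in
`q`. -/
lemma integral_slope_quantile (h0 : 0 < α) (h1 : α < 1) (hcd : d * α + c * (1 - α) = 1)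
    (hq : μ {quantile μ α} = 0) : ∫ y, slope c d (quantile μ α) y ∂μ = 1 := by
  rw [slope_eq_indicator, integral_add (integrable_const _), integral_const_mul,
    integral_indicator_one measurableSet_Iio, measureReal_Iio_quantile_of_no_atom μ h0 h1 hq]
  · simp only [integral_const, probReal_univ, one_smul]; linarith
  · exact ((integrable_const (1 : ℝ)).indicator measurableSet_Iio).const_mul _

/-- As the slope has mean one, `q` and `q` times the slope cancel and the slope-weighted outcome
remains. This identifies the tail combination in the score as the conditional mean of the tilted
outcome. Absence of an atom is used twice: for the mean of the slope, and to pass from `[q, ∞)` to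
`(q, ∞)`. -/
lemma integral_tilt_quantile (h0 : 0 < α) (h1 : α < 1) (hcd : d * α + c * (1 - α) = 1)
    (hq : μ {quantile μ α} = 0) (hi : Integrable (fun y => y) μ) :
    ∫ y, tilt c d (quantile μ α) y ∂μ =
      d * ∫ y in Set.Iio (quantile μ α), y ∂μ + c * ∫ y in Set.Ioi (quantile μ α), y ∂μ := by
  set q := quantile μ α with hqd
  have hs := integrable_slope (c := c) (d := d) μ q
  have e1 : (fun y => tilt c d q y) = fun y => q - q * slope c d q y +
      (d * (Set.Iio q).indicator (fun y => y) y + c * (Set.Ici q).indicator (fun y => y) y) := by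
    ext y
    unfold tilt slope
    by_cases h : q ≤ y
    · simp [h, not_lt.2 h]; ring
    · simp [h, not_le.1 h]; ring
  have i1 : Integrable (fun y => (Set.Iio q).indicator (fun y => y) y) μ :=
    hi.indicator measurableSet_Iio
  have i2 : Integrable (fun y => (Set.Ici q).indicator (fun y => y) y) μ :=
    hi.indicator measurableSet_Ici
  have hres : (∫ y in Set.Ici q, y ∂μ) = ∫ y in Set.Ioi q, y ∂μ := by
    refine setIntegral_congr_set ?_
    rw [← Set.Ioi_union_left]
    exact union_ae_eq_left_of_ae_eq_empty (ae_eq_empty.2 hq)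
  have i3 : Integrable (fun y => q - q * slope c d q y) μ :=
    (integrable_const q).sub (hs.const_mul q)
  have i4 : Integrable (fun y => d * (Set.Iio q).indicator (fun y => y) y +
      c * (Set.Ici q).indicator (fun y => y) y) μ := (i1.const_mul d).add (i2.const_mul c)
  rw [e1, integral_add i3 i4, integral_sub (integrable_const q) (hs.const_mul q),
    integral_add (i1.const_mul d) (i2.const_mul c), integral_const_mul, integral_const_mul,
    integral_const_mul, integral_indicator measurableSet_Iio, integral_indicator measurableSet_Ici,
    integral_slope_quantile μ h0 h1 hcd hq, hres]
  simp

end Tilt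

/-! ### Cutting a law at a quantile that may be an atom. -/

section LowerWeight
variable (μ : Measure ℝ) [IsProbabilityMeasure μ] {α : ℝ}

/-- The mass of `{q}` that is counted as lower, as a fraction. -/
def atomWeight (μ : Measure ℝ) (α q : ℝ) : ℝ := (α - μ.real (Set.Iio q)) / μ.real {q}

/-- The weight of the lower part, of mass `α`, of a law with quantile `q`. -/
def lowerWeight (θ q y : ℝ) : ℝ := if y < q then 1 else if y = q then θ else 0

/-- The level `α` lies between the masses of the open and the closed half-line. Without an atom the
quotient is `x / 0 = 0`, still in range. -/
lemma atomWeight_mem (h0 : 0 < α) (h1 : α < 1) :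
    atomWeight μ α (quantile μ α) ∈ Set.Icc (0 : ℝ) 1 := by
  have ha := measureReal_Iio_quantile_le μ h0 h1
  have hb := le_measureReal_Iic_quantile μ h1
  rw [← Set.Iio_union_right, measureReal_union (by simp) (measurableSet_singleton _)] at hb
  refine ⟨div_nonneg (by linarith) measureReal_nonneg, div_le_one_of_le₀ (by linarith)
    measureReal_nonneg⟩

lemma lowerWeight_mem {θ : ℝ} (hθ : θ ∈ Set.Icc (0 : ℝ) 1) (q y : ℝ) :
    lowerWeight θ q y ∈ Set.Icc (0 : ℝ) 1 := by
  unfold lowerWeight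
  split_ifs
  · simp
  · exact hθ
  · simp

lemma measurable_lowerWeight {Ω : Type*} [MeasurableSpace Ω] {θ q y : Ω → ℝ} (hθ : Measurable θ)
    (hq : Measurable q) (hy : Measurable y) :
    Measurable (fun w => lowerWeight (θ w) (q w) (y w)) :=
  Measurable.ite (measurableSet_lt hy hq) measurable_const
    (Measurable.ite (measurableSet_eq_fun hy hq) hθ measurable_const)

lemma integrable_lowerWeight {θ : ℝ} (hθ : θ ∈ Set.Icc (0 : ℝ) 1) (q : ℝ) :
    Integrable (fun y => lowerWeight θ q y) μ :=
  Integrable.of_bound (measurable_lowerWeight measurable_const measurable_const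
    measurable_id).aestronglyMeasurable 1 (Filter.Eventually.of_forall fun y => by
      have h := lowerWeight_mem hθ q y
      rw [Real.norm_eq_abs, abs_of_nonneg h.1]; exact h.2)

/-- The share of the atom fills the open half-line up to mass `α`; without an atom that mass is
already `α`. -/
lemma integral_lowerWeight (h0 : 0 < α) (h1 : α < 1) :
    ∫ y, lowerWeight (atomWeight μ α (quantile μ α)) (quantile μ α) y ∂μ = α := by
  set q := quantile μ α with hq
  have e1 : (fun y => lowerWeight (atomWeight μ α q) q y) =
      fun y => (Set.Iio q).indicator 1 y + atomWeight μ α q * ({q} : Set ℝ).indicator 1 y := by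
    ext y
    unfold lowerWeight
    by_cases h : y < q
    · simp [h, h.ne]
    · by_cases h' : y = q
      · simp [h']
      · simp [h, h']
  rw [e1, integral_add, integral_const_mul, integral_indicator_one measurableSet_Iio,
    integral_indicator_one (measurableSet_singleton q)]
  · by_cases hz : μ.real {q} = 0
    · have hz' : μ {q} = 0 := (measureReal_eq_zero_iff).1 hz
      rw [hz, mul_zero, add_zero]
      exact measureReal_Iio_quantile_of_no_atom μ h0 h1 hz'
    · rw [atomWeight, div_mul_cancel₀ _ hz]; ring
  · exact (integrable_const (1 : ℝ)).indicator measurableSet_Iio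
  · exact ((integrable_const (1 : ℝ)).indicator (measurableSet_singleton q)).const_mul _

end LowerWeight

/-! ### Inverse probability weighting and the mean of the score. -/

section BaseLaw
variable {𝒳 : Type*} [MeasurableSpace 𝒳]

/-- The law of the covariates, extended by the conditional law of `Y` given `X` and `A = t`. -/
def baseLaw (P : ProbabilityMeasure (Obs 𝒳)) (t : Bool) : Measure (𝒳 × ℝ) :=
  covLaw P ⊗ₘ outcomeKernel P t

/-- The covariate densities `e_t` and `1 - e_t` add up to one. This is how a population mean, minus
its part on the arm, becomes a mean under the swapped law. -/
lemma baseLaw_eq_add (P : ProbabilityMeasure (Obs 𝒳)) (t : Bool) :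
    baseLaw P t = armLaw P t + swapLaw P t := by
  have hm := measurable_armProb P t
  refine Measure.ext_of_lintegral _ fun f hf => ?_
  rw [lintegral_add_measure, lintegral_armLaw P t hf, lintegral_swapLaw P t hf, baseLaw,
    Measure.lintegral_compProd hf, ← lintegral_add_left]
  · refine lintegral_congr fun x => ?_
    have hp := armProb_mem P t x
    rw [← add_mul, ← ENNReal.ofReal_add hp.1 (by linarith [hp.2])]
    simp
  · exact hm.ennreal_ofReal.mul hf.lintegral_kernel_prod_right'

lemma armLaw_le_baseLaw (P : ProbabilityMeasure (Obs 𝒳)) (t : Bool) :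
    armLaw P t ≤ baseLaw P t := by
  rw [baseLaw_eq_add]; exact Measure.le_add_right le_rfl

lemma swapLaw_le_baseLaw (P : ProbabilityMeasure (Obs 𝒳)) (t : Bool) :
    swapLaw P t ≤ baseLaw P t := by
  rw [baseLaw_eq_add]; exact Measure.le_add_left le_rfl

lemma baseLaw_eq_withDensity (P : ProbabilityMeasure (Obs 𝒳)) (t : Bool)
    (hpos : ∀ᵐ x ∂(covLaw P), 0 < armProb P t x) :
    baseLaw P t = (armLaw P t).withDensity (fun w => ENNReal.ofReal (1 / armProb P t w.1)) := by
  have hm := measurable_armProb P t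
  have hd : Measurable (fun w : 𝒳 × ℝ => ENNReal.ofReal (1 / armProb P t w.1)) := by fun_prop
  refine Measure.ext_of_lintegral _ fun f hf => ?_
  rw [baseLaw, Measure.lintegral_compProd hf, lintegral_withDensity_eq_lintegral_mul _ hd hf,
    lintegral_armLaw P t (hd.mul hf)]
  refine lintegral_congr_ae ?_
  filter_upwards [hpos] with x hx
  simp only [Pi.mul_apply]
  rw [lintegral_const_mul _ (by fun_prop), ← mul_assoc, ← ENNReal.ofReal_mul hx.le,
    mul_div_cancel₀ _ hx.ne']
  simp

lemma fst_baseLaw (P : ProbabilityMeasure (Obs 𝒳)) (t : Bool) :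
    (baseLaw P t).map Prod.fst = covLaw P := Measure.fst_compProd _ _

lemma integrable_comp_fst {P : ProbabilityMeasure (Obs 𝒳)} (t : Bool) {g : 𝒳 → ℝ}
    (hg : Integrable g (covLaw P)) : Integrable (fun w : 𝒳 × ℝ => g w.1) (baseLaw P t) := by
  rw [← fst_baseLaw P t] at hg
  exact hg.comp_measurable measurable_fst

lemma ae_comp_fst {P : ProbabilityMeasure (Obs 𝒳)} (t : Bool) {p : 𝒳 → Prop}
    (hp : ∀ᵐ x ∂(covLaw P), p x) : ∀ᵐ w ∂(baseLaw P t), p w.1 := by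
  rw [← fst_baseLaw P t] at hp
  exact ae_of_ae_map measurable_fst.aemeasurable hp

lemma integrable_covLaw_iff {P : ProbabilityMeasure (Obs 𝒳)} {g : 𝒳 → ℝ} (hg : Measurable g) :
    Integrable g (covLaw P) ↔ Integrable (fun z : Obs 𝒳 => g z.x) (P : Measure (Obs 𝒳)) :=
  integrable_map_measure hg.aestronglyMeasurable Obs.measurable_x.aemeasurable

lemma integral_covLaw (P : ProbabilityMeasure (Obs 𝒳)) {g : 𝒳 → ℝ} (hg : Measurable g) :
    ∫ x, g x ∂(covLaw P) = ∫ z : Obs 𝒳, g z.x ∂(P : Measure (Obs 𝒳)) :=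
  integral_map Obs.measurable_x.aemeasurable hg.aestronglyMeasurable

/-- `∫ 1{A = t} f(X, Y) dP` is the integral of `f` against the law of the arm. -/
lemma integral_ind_mul (P : ProbabilityMeasure (Obs 𝒳)) (t : Bool) {f : 𝒳 × ℝ → ℝ}
    (hf : Measurable f) (hi : Integrable f (armLaw P t)) :
    Integrable (fun z : Obs 𝒳 => ind (z.a = t) * f (z.x, z.y)) (P : Measure (Obs 𝒳)) ∧
      ∫ z : Obs 𝒳, ind (z.a = t) * f (z.x, z.y) ∂(P : Measure (Obs 𝒳)) =
        ∫ w, f w ∂(armLaw P t) := by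
  have e : (fun z : Obs 𝒳 => ind (z.a = t) * f (z.x, z.y)) =
      {z : Obs 𝒳 | z.a = t}.indicator fun z => f (z.x, z.y) := by
    ext z; by_cases h : z.a = t <;> simp [ind, h]
  rw [e, integrable_indicator_iff (Obs.measurableSet_a t),
    integral_indicator (Obs.measurableSet_a t), armLaw,
    integral_map Obs.measurable_xy.aemeasurable hf.aestronglyMeasurable]
  exact ⟨(integrable_map_measure hf.aestronglyMeasurable Obs.measurable_xy.aemeasurable).1 hi, rfl⟩

/-- Inverse probability weighting. -/
lemma integral_ipw (P : ProbabilityMeasure (Obs 𝒳)) (t : Bool)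
    (hpos : ∀ᵐ x ∂(covLaw P), 0 < armProb P t x) {f : 𝒳 × ℝ → ℝ} (hf : Measurable f)
    (hi : Integrable f (baseLaw P t)) :
    Integrable (fun z : Obs 𝒳 => ind (z.a = t) * (1 / armProb P t z.x * f (z.x, z.y)))
      (P : Measure (Obs 𝒳)) ∧
      ∫ z : Obs 𝒳, ind (z.a = t) * (1 / armProb P t z.x * f (z.x, z.y)) ∂(P : Measure (Obs 𝒳)) =
        ∫ w, f w ∂(baseLaw P t) := by
  have hm := measurable_armProb P t
  have hd : Measurable (fun w : 𝒳 × ℝ => ENNReal.ofReal (1 / armProb P t w.1)) := by fun_prop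
  have e : ∀ w : 𝒳 × ℝ, (ENNReal.ofReal (1 / armProb P t w.1)).toReal • f w =
      1 / armProb P t w.1 * f w := fun w => by
    rw [ENNReal.toReal_ofReal (one_div_nonneg.2 (armProb_mem P t w.1).1), smul_eq_mul]
  have h := integral_ind_mul P t (f := fun w => 1 / armProb P t w.1 * f w) (by fun_prop)
  -- Through the density `1 / e_t`, integrability under `baseLaw` is the same as integrability of
  -- the weighted function on the arm; no bound on `1 / e_t` is needed.
  rw [baseLaw_eq_withDensity P t hpos] at hi ⊢
  rw [integrable_withDensity_iff_integrable_smul' hd (by simp)] at hi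
  rw [integral_withDensity_eq_integral_toReal_smul hd (by simp)]
  simp only [e] at hi ⊢
  exact h hi

lemma ind_mem (p : Prop) [Decidable p] : ind p = 0 ∨ ind p = 1 := by
  unfold ind; split_ifs <;> simp

/-- The score of one arm, in terms of the tilted outcome. -/
def armScore (c d : ℝ) (p q R : 𝒳 → ℝ) (t : Bool) (z : Obs 𝒳) : ℝ :=
  ind (z.a = t) * (z.y - tilt c d (q z.x) z.y) + R z.x +
    ind (z.a = t) * (1 / p z.x * (tilt c d (q z.x) z.y - R z.x))

/-- The power `Λ^(-sgn)` is the slope, and `(Λ - Λ⁻¹) (1/(1+Λ) - 1{y < q})` equals one minus the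
slope in both cases. Hence the first two terms of the score combine to `y` plus `(1 - p) / p` times
the tilt on the arm. -/
lemma phiMinus_eq {𝒳 : Type*} {Λ : ℝ} (hΛ : 1 ≤ Λ) (e : 𝒳 → ℝ) (q ρ₁ ρ₀ : 𝒳 → Bool → ℝ) (t : Bool)
    (z : Obs 𝒳) (hp : propensity e t z.x ≠ 0) :
    phiMinus Λ e q ρ₁ ρ₀ t z = armScore Λ⁻¹ Λ (propensity e t) (fun x => q x t)
      (fun x => Λ * ρ₁ x t + Λ⁻¹ * ρ₀ x t) t z := by
  have h0 : Λ ≠ 0 := by linarith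
  have h1 : 1 + Λ ≠ 0 := by linarith
  simp only [phiMinus, armScore, tilt, slope, sgn]
  by_cases h : q z.x t ≤ z.y
  · have h2 : ¬ z.y < q z.x t := not_lt.2 h
    simp only [sub_nonneg, h, h2, ind, if_true, if_false, zpow_neg_one]
    field_simp
    split_ifs <;> ring
  · have h2 : z.y < q z.x t := not_le.1 h
    simp only [sub_nonneg, h, h2, ind, if_true, if_false, neg_neg, zpow_one]
    field_simp
    split_ifs <;> ring

lemma phiPlus_eq {𝒳 : Type*} {Λ : ℝ} (hΛ : 1 ≤ Λ) (e : 𝒳 → ℝ) (q ρ₁ ρ₀ : 𝒳 → Bool → ℝ) (t : Bool)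
    (z : Obs 𝒳) (hp : propensity e t z.x ≠ 0) :
    phiPlus Λ e q ρ₁ ρ₀ t z = armScore Λ Λ⁻¹ (propensity e t) (fun x => q x t)
      (fun x => Λ⁻¹ * ρ₁ x t + Λ * ρ₀ x t) t z := by
  have h0 : Λ ≠ 0 := by linarith
  have h1 : 1 + Λ ≠ 0 := by linarith
  simp only [phiPlus, armScore, tilt, slope, sgn]
  by_cases h : q z.x t ≤ z.y
  · have h2 : ¬ z.y < q z.x t := not_lt.2 h
    simp only [sub_nonneg, h, h2, ind, if_true, if_false, zpow_one]
    field_simp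
    split_ifs <;> ring
  · have h2 : z.y < q z.x t := not_le.1 h
    simp only [sub_nonneg, h, h2, ind, if_true, if_false, zpow_neg_one]
    field_simp
    split_ifs <;> ring

/-- The mean of the score of one arm. -/
lemma integral_armScore (P : ProbabilityMeasure (Obs 𝒳)) (t : Bool)
    (hpos : ∀ᵐ x ∂(covLaw P), 0 < armProb P t x)
    (hy : Integrable (fun w : 𝒳 × ℝ => w.2) (baseLaw P t)) (c d : ℝ) {π q R : 𝒳 → ℝ}
    (hπ : Measurable π) (hπ01 : ∀ x, π x ∈ Set.Icc (0 : ℝ) 1)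
    (hq : Measurable q) (hR : Measurable R)
    (hqi : Integrable q (covLaw P)) (hRi : Integrable R (covLaw P)) :
    Integrable (fun z => π z.x * armScore c d (armProb P t) q R t z) (P : Measure (Obs 𝒳)) ∧
      ∫ z, π z.x * armScore c d (armProb P t) q R t z ∂(P : Measure (Obs 𝒳)) =
        ∫ w, π w.1 * w.2 ∂(armLaw P t) + ∫ w, π w.1 * tilt c d (q w.1) w.2 ∂(swapLaw P t) := by
  have hT : Measurable (fun w : 𝒳 × ℝ => tilt c d (q w.1) w.2) :=
    measurable_tilt c d (hq.comp measurable_fst) measurable_snd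
  have hTi : Integrable (fun w : 𝒳 × ℝ => tilt c d (q w.1) w.2) (baseLaw P t) := by
    refine ((hy.abs.add (integrable_comp_fst t hqi).abs).const_mul (1 + |c| + |d|)).mono'
      hT.aestronglyMeasurable (Filter.Eventually.of_forall fun w => ?_)
    exact abs_tilt_le c d _ _
  have hb : ∀ {μ : Measure (𝒳 × ℝ)} {f : 𝒳 × ℝ → ℝ}, Integrable f μ →
      Integrable (fun w => π w.1 * f w) μ := fun hf =>
    hf.bdd_mul (c := 1) (hπ.comp measurable_fst).aestronglyMeasurable
      (Filter.Eventually.of_forall fun w => by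
        rw [Real.norm_eq_abs, abs_of_nonneg (hπ01 _).1]; exact (hπ01 _).2)
  have hRb : Integrable (fun x => π x * R x) (covLaw P) :=
    hRi.bdd_mul (c := 1) hπ.aestronglyMeasurable
      (Filter.Eventually.of_forall fun w => by
        rw [Real.norm_eq_abs, abs_of_nonneg (hπ01 _).1]; exact (hπ01 _).2)
  have hRm : Measurable (fun x => π x * R x) := hπ.mul hR
  have hle := armLaw_le_baseLaw P t
  have i1 := hb (hy.mono_measure hle)
  have i2 := hb (hTi.mono_measure hle)
  have i2' := hb (hTi.mono_measure (swapLaw_le_baseLaw P t))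
  have i3 := hb hTi
  have i4 := integrable_comp_fst t hRb
  obtain ⟨a1, b1⟩ := integral_ind_mul P t
    (f := fun w => π w.1 * w.2 - π w.1 * tilt c d (q w.1) w.2) (by fun_prop) (i1.sub i2)
  obtain ⟨a2, b2⟩ := integral_ipw P t hpos
    (f := fun w => π w.1 * tilt c d (q w.1) w.2 - π w.1 * R w.1) (by fun_prop) (i3.sub i4)
  have a3 := (integrable_covLaw_iff hRm).1 hRb
  have e : (fun z : Obs 𝒳 => π z.x * armScore c d (armProb P t) q R t z) = fun z =>
      (ind (z.a = t) * (π z.x * z.y - π z.x * tilt c d (q z.x) z.y) + π z.x * R z.x) +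
      ind (z.a = t) * (1 / armProb P t z.x *
        (π z.x * tilt c d (q z.x) z.y - π z.x * R z.x)) := by
    ext z; unfold armScore; ring
  rw [e]
  refine ⟨(a1.add a3).add a2, ?_⟩
  have hRint : ∫ w, π w.1 * R w.1 ∂(baseLaw P t) = ∫ x, π x * R x ∂(covLaw P) := by
    rw [← fst_baseLaw P t]
    exact (integral_map measurable_fst.aemeasurable hRm.aestronglyMeasurable).symm
  simp only at a1 a2 b1 b2
  have a13 : Integrable (fun z : Obs 𝒳 => ind (z.a = t) * (π z.x * z.y -
      π z.x * tilt c d (q z.x) z.y) + π z.x * R z.x) (P : Measure (Obs 𝒳)) := a1.add a3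
  -- The two means of `π R` cancel, and the mean of the tilt over `baseLaw` minus that over the arm
  -- is the one over `swapLaw`. Only integrability of `q` and `R` matters here, so atoms are
  -- allowed.
  rw [integral_add a13 a2, integral_add a1 a3, b1, b2, integral_sub i1 i2,
    integral_sub i3 i4, ← integral_covLaw P hRm, hRint, baseLaw_eq_add,
    integral_add_measure i2 i2']
  ring

end BaseLaw

/-! ### Measurability and integrability of the true nuisances. -/

section Nuisances
variable {𝒳 : Type*} [MeasurableSpace 𝒳]

lemma measurable_condQuantile (P : ProbabilityMeasure (Obs 𝒳)) {α : ℝ} (h0 : 0 < α) (h1 : α < 1)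
    (t : Bool) : Measurable (fun x => condQuantile P α x t) := by
  refine measurable_of_Iic fun c => ?_
  have e : (fun x => condQuantile P α x t) ⁻¹' Set.Iic c =
      {x | α ≤ (outcomeKernel P t x).real (Set.Iic c)} := by
    ext x; exact quantile_le_iff (outcomeKernel P t x) h0 h1 c
  rw [e]
  exact measurableSet_le measurable_const
    ((outcomeKernel P t).measurable_coe measurableSet_Iic).ennreal_toReal

lemma measurable_tails (P : ProbabilityMeasure (Obs 𝒳)) {q : 𝒳 → Bool → ℝ} (t : Bool)
    (hq : Measurable (fun x => q x t)) :
    Measurable (fun x => lowerTail P q x t) ∧ Measurable (fun x => upperTail P q x t) := by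
  have h1 : MeasurableSet {w : 𝒳 × ℝ | w.2 < q w.1 t} :=
    measurableSet_lt measurable_snd (hq.comp measurable_fst)
  have h2 : MeasurableSet {w : 𝒳 × ℝ | q w.1 t < w.2} :=
    measurableSet_lt (hq.comp measurable_fst) measurable_snd
  have m1 := ((measurable_snd.indicator h1).stronglyMeasurable.integral_kernel_prod_right'
    (κ := outcomeKernel P t)).measurable
  have m2 := ((measurable_snd.indicator h2).stronglyMeasurable.integral_kernel_prod_right'
    (κ := outcomeKernel P t)).measurable
  constructor
  · convert m1 using 2 with x
    rw [lowerTail, outcomeLaw_eq, ← integral_indicator measurableSet_Iio]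
    rfl
  · convert m2 using 2 with x
    rw [upperTail, outcomeLaw_eq, ← integral_indicator measurableSet_Ioi]
    rfl

lemma abs_tails_le (P : ProbabilityMeasure (Obs 𝒳)) (q : 𝒳 → Bool → ℝ) (t : Bool) (x : 𝒳)
    (hi : Integrable (fun y => y) (outcomeKernel P t x)) :
    |lowerTail P q x t| ≤ ∫ y, |y| ∂(outcomeKernel P t x) ∧
      |upperTail P q x t| ≤ ∫ y, |y| ∂(outcomeKernel P t x) := by
  have h : ∀ s : Set ℝ, |∫ y in s, y ∂(outcomeKernel P t x)| ≤ ∫ y, |y| ∂(outcomeKernel P t x) :=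
    fun s => (abs_integral_le_integral_abs).trans (setIntegral_le_integral hi.abs
      (Filter.Eventually.of_forall fun y => abs_nonneg y))
  exact ⟨h _, h _⟩

lemma integrable_outcomeKernel {P : ProbabilityMeasure (Obs 𝒳)} {t : Bool}
    (hy : Integrable (fun w : 𝒳 × ℝ => w.2) (baseLaw P t)) :
    (∀ᵐ x ∂(covLaw P), Integrable (fun y => y) (outcomeKernel P t x)) ∧
      Integrable (fun x => ∫ y, |y| ∂(outcomeKernel P t x)) (covLaw P) :=
  (Measure.integrable_compProd_iff hy.aestronglyMeasurable).1 hy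

lemma integrable_condQuantile {P : ProbabilityMeasure (Obs 𝒳)} {t : Bool}
    (hy : Integrable (fun w : 𝒳 × ℝ => w.2) (baseLaw P t)) {α : ℝ} (h0 : 0 < α) (h1 : α < 1) :
    Integrable (fun x => condQuantile P α x t) (covLaw P) := by
  obtain ⟨ha, hb⟩ := integrable_outcomeKernel hy
  refine (hb.const_mul (1 / α + 1 / (1 - α))).mono'
    (measurable_condQuantile P h0 h1 t).aestronglyMeasurable ?_
  filter_upwards [ha] with x hx
  exact abs_quantile_le (outcomeKernel P t x) h0 h1 hx

lemma integrable_tails {P : ProbabilityMeasure (Obs 𝒳)} {t : Bool}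
    (hy : Integrable (fun w : 𝒳 × ℝ => w.2) (baseLaw P t)) {q : 𝒳 → Bool → ℝ}
    (hq : Measurable (fun x => q x t)) :
    Integrable (fun x => lowerTail P q x t) (covLaw P) ∧
      Integrable (fun x => upperTail P q x t) (covLaw P) := by
  obtain ⟨ha, hb⟩ := integrable_outcomeKernel hy
  obtain ⟨m1, m2⟩ := measurable_tails P t hq
  refine ⟨hb.mono' m1.aestronglyMeasurable ?_, hb.mono' m2.aestronglyMeasurable ?_⟩
  · filter_upwards [ha] with x hx using (abs_tails_le P q t x hx).1
  · filter_upwards [ha] with x hx using (abs_tails_le P q t x hx).2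

end Nuisances

/-! ### Sharp bounds on means under a two-sided domination. -/

section TiltBounds
variable {𝒳 : Type*} [MeasurableSpace 𝒳] {N W : Measure (𝒳 × ℝ)}

lemma integral_comp_fst_eq (hfst : N.map Prod.fst = W.map Prod.fst) {g : 𝒳 → ℝ}
    (hg : Measurable g) : ∫ w, g w.1 ∂N = ∫ w, g w.1 ∂W := by
  rw [← integral_map (φ := Prod.fst) measurable_fst.aemeasurable hg.aestronglyMeasurable,
    ← integral_map (φ := Prod.fst) measurable_fst.aemeasurable hg.aestronglyMeasurable, hfst]

lemma integrable_comp_fst_iff (hfst : N.map Prod.fst = W.map Prod.fst) {g : 𝒳 → ℝ}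
    (hg : Measurable g) :
    Integrable (fun w => g w.1) N ↔ Integrable (fun w => g w.1) W := by
  have h1 := integrable_map_measure (μ := N) (f := Prod.fst) (g := g) hg.aestronglyMeasurable
    measurable_fst.aemeasurable
  have h2 := integrable_map_measure (μ := W) (f := Prod.fst) (g := g) hg.aestronglyMeasurable
    measurable_fst.aemeasurable
  exact h1.symm.trans ((by rw [hfst] : _ ↔ _).trans h2)

lemma integrable_of_le_smul {Ω : Type*} [MeasurableSpace Ω] {μ ν : Measure Ω} {Λ : ℝ}
    (h : μ ≤ ENNReal.ofReal Λ • ν) {f : Ω → ℝ} (hf : Integrable f ν) : Integrable f μ :=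
  (hf.smul_measure ENNReal.ofReal_ne_top).mono_measure h

lemma integral_le_of_le_smul {Ω : Type*} [MeasurableSpace Ω] {μ ν : Measure Ω} {Λ : ℝ} (hΛ : 0 ≤ Λ)
    (h : μ ≤ ENNReal.ofReal Λ • ν) {f : Ω → ℝ} (hf : Integrable f ν) (h0 : ∀ w, 0 ≤ f w) :
    ∫ w, f w ∂μ ≤ Λ * ∫ w, f w ∂ν := by
  have := integral_mono_measure h (Filter.Eventually.of_forall h0)
    (hf.smul_measure ENNReal.ofReal_ne_top)
  rwa [integral_smul_measure, ENNReal.toReal_ofReal hΛ, smul_eq_mul] at this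

variable {Λ : ℝ} {π q : 𝒳 → ℝ}

lemma integrable_policy_mul {μ : Measure (𝒳 × ℝ)} (hπ : Measurable π)
    (hπ01 : ∀ x, π x ∈ Set.Icc (0 : ℝ) 1) {f : 𝒳 × ℝ → ℝ} (hf : Integrable f μ) :
    Integrable (fun w => π w.1 * f w) μ :=
  hf.bdd_mul (c := 1) (hπ.comp measurable_fst).aestronglyMeasurable
    (Filter.Eventually.of_forall fun w => by
      rw [Real.norm_eq_abs, abs_of_nonneg (hπ01 _).1]; exact (hπ01 _).2)

/-- Two laws with the same covariate law that are within a factor `Λ` of each other: the mean of the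
outcome under one is bounded by tilted means under the other. -/
lemma tilt_bounds (hΛ : 1 ≤ Λ) (hNW : N ≤ ENNReal.ofReal Λ • W) (hWN : W ≤ ENNReal.ofReal Λ • N)
    (hfst : N.map Prod.fst = W.map Prod.fst) (hπ : Measurable π)
    (hπ01 : ∀ x, π x ∈ Set.Icc (0 : ℝ) 1) (hq : Measurable q)
    (hy : Integrable (fun w : 𝒳 × ℝ => w.2) W) (hqi : Integrable (fun w : 𝒳 × ℝ => q w.1) W) :
    ∫ w, π w.1 * tilt Λ⁻¹ Λ (q w.1) w.2 ∂W ≤ ∫ w, π w.1 * w.2 ∂N ∧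
      ∫ w, π w.1 * w.2 ∂N ≤ ∫ w, π w.1 * tilt Λ Λ⁻¹ (q w.1) w.2 ∂W := by
  have hΛ0 : 0 < Λ := by linarith
  have hyN := integrable_of_le_smul hNW hy
  have hqN := integrable_of_le_smul hNW hqi
  have kq := integrable_policy_mul hπ hπ01 hqi
  have kqN := integrable_policy_mul hπ hπ01 hqN
  have kp := integrable_policy_mul hπ hπ01 (hy.sub hqi).pos_part
  have kpN := integrable_policy_mul hπ hπ01 (hyN.sub hqN).pos_part
  have kn := integrable_policy_mul hπ hπ01 (hy.sub hqi).neg_part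
  have knN := integrable_policy_mul hπ hπ01 (hyN.sub hqN).neg_part
  simp only [Pi.sub_apply] at kp kpN kn knN
  have p0 : ∀ w : 𝒳 × ℝ, 0 ≤ π w.1 * max (w.2 - q w.1) 0 := fun w =>
    mul_nonneg (hπ01 _).1 (le_max_right _ _)
  have n0 : ∀ w : 𝒳 × ℝ, 0 ≤ π w.1 * max (-(w.2 - q w.1)) 0 := fun w =>
    mul_nonneg (hπ01 _).1 (le_max_right _ _)
  -- The lower bound uses `b2` and `b3` (positive part at least divided by `Λ`, negative part at
  -- most multiplied by `Λ`), the upper bound `b1` and `b4`.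
  have b1 := integral_le_of_le_smul hΛ0.le hNW kp p0
  have b2 := integral_le_of_le_smul hΛ0.le hWN kpN p0
  have b3 := integral_le_of_le_smul hΛ0.le hNW kn n0
  have b4 := integral_le_of_le_smul hΛ0.le hWN knN n0
  have hqq : ∫ w, π w.1 * q w.1 ∂N = ∫ w, π w.1 * q w.1 ∂W :=
    integral_comp_fst_eq hfst (hπ.mul hq)
  have hmm : ∀ s : ℝ, s = max s 0 - max (-s) 0 := fun s => by
    rcases le_total s 0 with h | h
    · rw [max_eq_right h, max_eq_left (by linarith)]; ring
    · rw [max_eq_left h, max_eq_right (by linarith)]; ring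
  have eN : ∫ w, π w.1 * w.2 ∂N = ∫ w, π w.1 * q w.1 ∂N +
      (∫ w, π w.1 * max (w.2 - q w.1) 0 ∂N - ∫ w, π w.1 * max (-(w.2 - q w.1)) 0 ∂N) := by
    have kd : Integrable (fun w => π w.1 * max (w.2 - q w.1) 0 -
        π w.1 * max (-(w.2 - q w.1)) 0) N := kpN.sub knN
    rw [← integral_sub kpN knN, ← integral_add kqN kd]
    refine integral_congr_ae (Filter.Eventually.of_forall fun w => ?_)
    have := hmm (w.2 - q w.1)
    simp only
    rw [← mul_sub, ← this]; ring
  have eW : ∀ c d : ℝ, ∫ w, π w.1 * tilt c d (q w.1) w.2 ∂W = ∫ w, π w.1 * q w.1 ∂W +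
      (c * ∫ w, π w.1 * max (w.2 - q w.1) 0 ∂W - d * ∫ w, π w.1 * max (-(w.2 - q w.1)) 0 ∂W) := by
    intro c d
    have kd : Integrable (fun w => c * (π w.1 * max (w.2 - q w.1) 0) -
        d * (π w.1 * max (-(w.2 - q w.1)) 0)) W := (kp.const_mul c).sub (kn.const_mul d)
    rw [← integral_const_mul, ← integral_const_mul, ← integral_sub (kp.const_mul c)
      (kn.const_mul d), ← integral_add kq kd]
    refine integral_congr_ae (Filter.Eventually.of_forall fun w => ?_)
    simp only [tilt_eq_max_min]
    have h : max (-(w.2 - q w.1)) 0 = - min (w.2 - q w.1) 0 := by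
      rw [← neg_zero, max_neg_neg, neg_zero]
    rw [h]; ring
  rw [eN, eW, eW, hqq]
  have b2' : Λ⁻¹ * ∫ w, π w.1 * max (w.2 - q w.1) 0 ∂W ≤ ∫ w, π w.1 * max (w.2 - q w.1) 0 ∂N := by
    rw [inv_mul_le_iff₀ hΛ0]; exact b2
  have b4' : Λ⁻¹ * ∫ w, π w.1 * max (-(w.2 - q w.1)) 0 ∂W ≤
      ∫ w, π w.1 * max (-(w.2 - q w.1)) 0 ∂N := by
    rw [inv_mul_le_iff₀ hΛ0]; exact b4
  constructor <;> linarith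

/-- The tilted mean is the mean of the outcome under the tilted law. -/
lemma integral_tilt_eq {c d C : ℝ} {s : 𝒳 × ℝ → ℝ} (hs : Measurable s) (hs0 : ∀ w, 0 ≤ s w)
    (hsC : ∀ w, s w ≤ C) (hN : N = W.withDensity fun w => ENNReal.ofReal (s w))
    (hsq : ∀ w : 𝒳 × ℝ, w.2 ≠ q w.1 → s w = slope c d (q w.1) w.2)
    (hfst : N.map Prod.fst = W.map Prod.fst) (hπ : Measurable π)
    (hπ01 : ∀ x, π x ∈ Set.Icc (0 : ℝ) 1) (hq : Measurable q)
    (hy : Integrable (fun w : 𝒳 × ℝ => w.2) W) (hqi : Integrable (fun w : 𝒳 × ℝ => q w.1) W) :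
    ∫ w, π w.1 * w.2 ∂N = ∫ w, π w.1 * tilt c d (q w.1) w.2 ∂W := by
  have kq := integrable_policy_mul hπ hπ01 hqi
  have kd := integrable_policy_mul hπ hπ01 (hy.sub hqi)
  have kqN : Integrable (fun w => π w.1 * q w.1) N :=
    (integrable_comp_fst_iff hfst (hπ.mul hq)).2 kq
  have hqq : ∫ w, π w.1 * q w.1 ∂N = ∫ w, π w.1 * q w.1 ∂W :=
    integral_comp_fst_eq hfst (hπ.mul hq)
  simp only [Pi.sub_apply] at kd
  have ksd : Integrable (fun w => s w * (π w.1 * (w.2 - q w.1))) W :=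
    kd.bdd_mul (c := C) hs.aestronglyMeasurable (Filter.Eventually.of_forall fun w => by
      rw [Real.norm_eq_abs, abs_of_nonneg (hs0 _)]; exact hsC _)
  have e : ∀ w : 𝒳 × ℝ, (ENNReal.ofReal (s w)).toReal • (π w.1 * (w.2 - q w.1)) =
      s w * (π w.1 * (w.2 - q w.1)) := fun w => by
    rw [ENNReal.toReal_ofReal (hs0 w), smul_eq_mul]
  have kdN : Integrable (fun w => π w.1 * (w.2 - q w.1)) N := by
    rw [hN, integrable_withDensity_iff_integrable_smul' hs.ennreal_ofReal (by simp)]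
    simpa only [e] using ksd
  have hd : ∫ w, π w.1 * (w.2 - q w.1) ∂N = ∫ w, s w * (π w.1 * (w.2 - q w.1)) ∂W := by
    rw [hN, integral_withDensity_eq_integral_toReal_smul hs.ennreal_ofReal (by simp)]
    simp only [e]
  calc ∫ w, π w.1 * w.2 ∂N = ∫ w, (π w.1 * q w.1 + π w.1 * (w.2 - q w.1)) ∂N := by
        refine integral_congr_ae (Filter.Eventually.of_forall fun w => ?_)
        simp only; ring
    _ = ∫ w, (π w.1 * q w.1 + s w * (π w.1 * (w.2 - q w.1))) ∂W := by
        rw [integral_add kqN kdN, integral_add kq ksd, hqq, hd]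
    _ = _ := by
        refine integral_congr_ae (Filter.Eventually.of_forall fun w => ?_)
        simp only [tilt]
        -- At the kink the factor `y - q` vanishes, so the value of the density there is immaterial.
        by_cases h : w.2 = q w.1
        · rw [h]; ring
        · rw [hsq w h]; ring

end TiltBounds

/-! ### The policy improvement in terms of factual and counterfactual laws. -/

section Improvement
variable {𝒳 : Type*} [MeasurableSpace 𝒳] {k : ℕ}

lemma fst_armLaw (P : ProbabilityMeasure (Obs 𝒳)) (t : Bool) :
    (armLaw P t).map Prod.fst =
      (covLaw P).withDensity (fun x => ENNReal.ofReal (armProb P t x)) := by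
  rw [armLaw_eq]; exact Measure.fst_compProd _ _

lemma fst_swapLaw (P : ProbabilityMeasure (Obs 𝒳)) (t : Bool) :
    (swapLaw P t).map Prod.fst =
      (covLaw P).withDensity (fun x => ENNReal.ofReal (1 - armProb P t x)) :=
  Measure.fst_compProd _ _

/-- Covariates are observed in either arm, so both marginals are the law of `X` on `{A ≠ t}`. This
equality is what makes the `q` term drop out of the comparison. -/
lemma fst_counterLaw (Q : ProbabilityMeasure (Full 𝒳 k)) (t : Bool) :
    (counterLaw Q t).map Prod.fst = (swapLaw (observedLaw Q) t).map Prod.fst := by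
  have h : (counterLaw Q t).map Prod.fst = (armLaw (observedLaw Q) (!t)).map Prod.fst := by
    rw [← map_restrict_eq_armLaw, counterLaw, Measure.map_map measurable_fst
      (Full.measurable_x.prodMk (Full.measurable_yt _)), Measure.map_map measurable_fst
      (Full.measurable_x.prodMk (Full.measurable_yt _))]
    rfl
  rw [h, fst_armLaw, fst_swapLaw]
  simp only [armProb_not]

/-- The mean of a potential outcome, split by treatment. -/
lemma integral_outcome (Q : ProbabilityMeasure (Full 𝒳 k)) (t : Bool) {f : 𝒳 × ℝ → ℝ}
    (hf : Measurable f) (h1 : Integrable f (armLaw (observedLaw Q) t))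
    (h2 : Integrable f (counterLaw Q t)) :
    Integrable (fun o : Full 𝒳 k => f (o.x, o.yt t)) (Q : Measure (Full 𝒳 k)) ∧
      ∫ o : Full 𝒳 k, f (o.x, o.yt t) ∂(Q : Measure (Full 𝒳 k)) =
        ∫ w, f w ∂(armLaw (observedLaw Q) t) + ∫ w, f w ∂(counterLaw Q t) := by
  have hm : Measurable (fun o : Full 𝒳 k => (o.x, o.yt t)) :=
    Full.measurable_x.prodMk (Full.measurable_yt t)
  have hc : {o : Full 𝒳 k | o.a = !t} = {o | o.a = t}ᶜ := by
    ext o; cases h : o.a <;> cases t <;> simp [h]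
  rw [← map_restrict_eq_armLaw] at h1 ⊢
  rw [counterLaw, hc] at h2 ⊢
  have i1 := (integrable_map_measure hf.aestronglyMeasurable hm.aemeasurable).1 h1
  have i2 := (integrable_map_measure hf.aestronglyMeasurable hm.aemeasurable).1 h2
  rw [integral_map hm.aemeasurable hf.aestronglyMeasurable,
    integral_map hm.aemeasurable hf.aestronglyMeasurable]
  have hi : Integrable (fun o : Full 𝒳 k => f (o.x, o.yt t)) (Q : Measure (Full 𝒳 k)) := by
    have := IntegrableOn.union i1 i2
    rwa [Set.union_compl_self, integrableOn_univ] at this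
  exact ⟨hi, (integral_add_compl (Full.measurableSet_a t) hi).symm⟩

variable [StandardBorelSpace 𝒳] {Λ : ℝ}

/-- Integrability of the outcome, transferred from a law satisfying the sensitivity model. -/
lemma integrable_baseLaw (hΛ : 1 ≤ Λ) {Q : ProbabilityMeasure (Full 𝒳 k)}
    (hQ : MarginalSensitivityModel Λ Q) (t : Bool)
    (hY : Integrable (Full.yt t) (Q : Measure (Full 𝒳 k))) :
    Integrable (fun w : 𝒳 × ℝ => w.2) (baseLaw (observedLaw Q) t) := by
  have hm : Measurable (fun o : Full 𝒳 k => (o.x, o.yt t)) :=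
    Full.measurable_x.prodMk (Full.measurable_yt t)
  rw [baseLaw_eq_add]
  refine Integrable.add_measure ?_ (integrable_of_le_smul (hQ.swapLaw_le hΛ t) ?_)
  · rw [← map_restrict_eq_armLaw]
    exact (integrable_map_measure measurable_snd.aestronglyMeasurable hm.aemeasurable).2
      hY.integrableOn
  · exact (integrable_map_measure measurable_snd.aestronglyMeasurable hm.aemeasurable).2
      hY.integrableOn

lemma integrable_counterLaw (hΛ : 1 ≤ Λ) {Q : ProbabilityMeasure (Full 𝒳 k)}
    (hQ : MarginalSensitivityModel Λ Q) (t : Bool)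
    (hy : Integrable (fun w : 𝒳 × ℝ => w.2) (baseLaw (observedLaw Q) t)) :
    Integrable (fun w : 𝒳 × ℝ => w.2) (counterLaw Q t) :=
  integrable_of_le_smul (hQ.counterLaw_le hΛ t) (hy.mono_measure (swapLaw_le_baseLaw _ t))

/-- The policy improvement, split by arm and treatment. -/
lemma improvement_eq (hΛ : 1 ≤ Λ) {Q : ProbabilityMeasure (Full 𝒳 k)}
    (hQ : MarginalSensitivityModel Λ Q)
    (hy : ∀ t, Integrable (fun w : 𝒳 × ℝ => w.2) (baseLaw (observedLaw Q) t))
    {π : 𝒳 → ℝ} (hπ : Measurable π) (hπ01 : ∀ x, π x ∈ Set.Icc (0 : ℝ) 1) :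
    Integrable (fun o : Full 𝒳 k => π o.x * (o.y1 - o.y0)) (Q : Measure (Full 𝒳 k)) ∧
      improvement π Q =
        (∫ w, π w.1 * w.2 ∂(armLaw (observedLaw Q) true) +
          ∫ w, π w.1 * w.2 ∂(counterLaw Q true)) -
        (∫ w, π w.1 * w.2 ∂(armLaw (observedLaw Q) false) +
          ∫ w, π w.1 * w.2 ∂(counterLaw Q false)) := by
  have h : ∀ t, _ := fun t => integral_outcome Q t (f := fun w => π w.1 * w.2) (by fun_prop)
    (integrable_policy_mul hπ hπ01 ((hy t).mono_measure (armLaw_le_baseLaw _ t)))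
    (integrable_policy_mul hπ hπ01 (integrable_counterLaw hΛ hQ t (hy t)))
  have e : (fun o : Full 𝒳 k => π o.x * (o.y1 - o.y0)) =
      fun o => π o.x * o.yt true - π o.x * o.yt false := by
    ext o; simp [Full.yt, outcome, mul_sub]
  rw [improvement, e, ← (h true).2, ← (h false).2]
  exact ⟨(h true).1.sub (h false).1, integral_sub (h true).1 (h false).1⟩

end Improvement

/-! ### A criterion for conditional independence given `(X, U)`. -/

section LatentModel
variable {𝒳 : Type*} [MeasurableSpace 𝒳] [StandardBorelSpace 𝒳] {k : ℕ}

/-- If the potential outcomes and the treatment are drawn independently given `(X, U)`, they are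
conditionally independent, and the second kernel is the law of the treatment given `(X, U)`. -/
lemma condIndepFun_of_map_eq (Q : ProbabilityMeasure (Full 𝒳 k))
    {μ : Measure (𝒳 × EuclideanSpace ℝ (Fin k))} [SFinite μ]
    (κY : Kernel (𝒳 × EuclideanSpace ℝ (Fin k)) (ℝ × ℝ)) [IsMarkovKernel κY]
    (κA : Kernel (𝒳 × EuclideanSpace ℝ (Fin k)) Bool) [IsMarkovKernel κA]
    (h : (Q : Measure (Full 𝒳 k)).map (fun o => (o.xu, (o.y1, o.y0), o.a)) = μ ⊗ₘ (κY ×ₖ κA)) :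
    CondIndepFun (MeasurableSpace.comap Full.xu inferInstance) Full.measurable_xu.comap_le
      (fun o : Full 𝒳 k => (o.y1, o.y0)) Full.a (Q : Measure (Full 𝒳 k)) ∧
    condDistrib Full.a Full.xu (Q : Measure (Full 𝒳 k))
      =ᵐ[(Q : Measure (Full 𝒳 k)).map Full.xu] κA := by
  have : Nonempty 𝒳 := (Q.nonempty).map Full.x
  have hall : Measurable (fun o : Full 𝒳 k => (o.xu, (o.y1, o.y0), o.a)) :=
    Full.measurable_xu.prodMk (Full.measurable_ys.prodMk Full.measurable_a)
  have h0 : (Q : Measure (Full 𝒳 k)).map Full.xu = μ := by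
    have := congrArg (Measure.map Prod.fst) h
    rw [Measure.map_map measurable_fst hall] at this
    exact this.trans (Measure.fst_compProd _ _)
  have h1 : (Q : Measure (Full 𝒳 k)).map (fun o => (o.xu, (o.y1, o.y0))) =
      (Q : Measure (Full 𝒳 k)).map Full.xu ⊗ₘ κY := by
    have := congrArg (Measure.map (Prod.map id Prod.fst)) h
    rw [Measure.map_map (measurable_id.prodMap measurable_fst) hall,
      ← Measure.compProd_map measurable_fst, ← Kernel.fst_eq, Kernel.fst_prod] at this
    rw [h0]; exact this
  have h2 : (Q : Measure (Full 𝒳 k)).map (fun o => (o.xu, o.a)) =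
      (Q : Measure (Full 𝒳 k)).map Full.xu ⊗ₘ κA := by
    have := congrArg (Measure.map (Prod.map id Prod.snd)) h
    rw [Measure.map_map (measurable_id.prodMap measurable_snd) hall,
      ← Measure.compProd_map measurable_snd, ← Kernel.snd_eq, Kernel.snd_prod] at this
    rw [h0]; exact this
  have c1 := condDistrib_ae_eq_of_measure_eq_compProd Full.xu
    Full.measurable_ys.aemeasurable h1
  have c2 := condDistrib_ae_eq_of_measure_eq_compProd Full.xu
    Full.measurable_a.aemeasurable h2
  refine ⟨?_, c2⟩
  rw [condIndepFun_iff_map_prod_eq_prod_condDistrib_prod_condDistrib Full.measurable_ys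
    Full.measurable_a Full.measurable_xu, ← Measure.compProd_eq_comp_prod, h, ← h0]
  refine Measure.compProd_congr ?_
  filter_upwards [c1, c2] with v hv1 hv2
  rw [Kernel.prod_apply, Kernel.prod_apply, hv1, hv2]

end LatentModel

/-! ### The parts of the outcome laws, and the law of the treatment given the part. -/

section Splitting
variable {𝒳 : Type*} [MeasurableSpace 𝒳] {Λ : ℝ}

/-- The mass of the lower (`b = true`) or upper (`b = false`) part in arm `t`. -/
def splitProb (Λ : ℝ) (t b : Bool) : ℝ := (if t = b then 1 else Λ) / (1 + Λ)

lemma splitProb_pos (hΛ : 1 ≤ Λ) (t b : Bool) : 0 < splitProb Λ t b := by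
  unfold splitProb; split_ifs <;> positivity

lemma splitProb_add (hΛ : 1 ≤ Λ) (t : Bool) : splitProb Λ t true + splitProb Λ t false = 1 := by
  have : 1 + Λ ≠ 0 := by linarith
  cases t <;> simp [splitProb] <;> field_simp
  ring

lemma splitProb_lt_one (hΛ : 1 ≤ Λ) (t b : Bool) : splitProb Λ t b < 1 := by
  have h := splitProb_add hΛ t
  have h1 := splitProb_pos hΛ t true
  have h2 := splitProb_pos hΛ t false
  cases b <;> linarith

/-- The quantile at which arm `t` is split. -/
def splitQuantile (P : ProbabilityMeasure (Obs 𝒳)) (Λ : ℝ) (t : Bool) (x : 𝒳) : ℝ :=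
  condQuantile P (splitProb Λ t true) x t

lemma measurable_splitQuantile (P : ProbabilityMeasure (Obs 𝒳)) (hΛ : 1 ≤ Λ) (t : Bool) :
    Measurable (splitQuantile P Λ t) :=
  measurable_condQuantile P (splitProb_pos hΛ t true) (splitProb_lt_one hΛ t true) t

/-- The density of the lower or upper part of the outcome in arm `t`. -/
def splitWeight (P : ProbabilityMeasure (Obs 𝒳)) (Λ : ℝ) (t b : Bool) (w : 𝒳 × ℝ) : ℝ :=
  let l := lowerWeight (atomWeight (outcomeKernel P t w.1) (splitProb Λ t true)
    (splitQuantile P Λ t w.1)) (splitQuantile P Λ t w.1) w.2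
  if b then l else 1 - l

lemma splitWeight_add (P : ProbabilityMeasure (Obs 𝒳)) (Λ : ℝ) (t : Bool) (w : 𝒳 × ℝ) :
    splitWeight P Λ t true w + splitWeight P Λ t false w = 1 := by
  simp [splitWeight]

lemma splitWeight_mem (P : ProbabilityMeasure (Obs 𝒳)) (hΛ : 1 ≤ Λ) (t b : Bool) (w : 𝒳 × ℝ) :
    splitWeight P Λ t b w ∈ Set.Icc (0 : ℝ) 1 := by
  have h := lowerWeight_mem (atomWeight_mem (outcomeKernel P t w.1) (splitProb_pos hΛ t true)
    (splitProb_lt_one hΛ t true)) (splitQuantile P Λ t w.1) w.2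
  cases b
  · exact ⟨sub_nonneg.2 h.2, sub_le_self _ h.1⟩
  · exact h

lemma measurable_splitWeight (P : ProbabilityMeasure (Obs 𝒳)) (hΛ : 1 ≤ Λ) (t b : Bool) :
    Measurable (splitWeight P Λ t b) := by
  have hq := measurable_splitQuantile P hΛ t
  have hq1 : Measurable (fun w : 𝒳 × ℝ => splitQuantile P Λ t w.1) := hq.comp measurable_fst
  have m1 : Measurable (fun x => (outcomeKernel P t x).real (Set.Iio (splitQuantile P Λ t x))) :=
    (Kernel.measurable_kernel_prodMk_left (κ := outcomeKernel P t)
      (measurableSet_lt measurable_snd hq1)).ennreal_toReal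
  have m2 : Measurable (fun x => (outcomeKernel P t x).real {splitQuantile P Λ t x}) :=
    (Kernel.measurable_kernel_prodMk_left (κ := outcomeKernel P t)
      (measurableSet_eq_fun measurable_snd hq1)).ennreal_toReal
  have mθ : Measurable (fun x => atomWeight (outcomeKernel P t x) (splitProb Λ t true)
      (splitQuantile P Λ t x)) := (measurable_const.sub m1).div m2
  have ml := measurable_lowerWeight (mθ.comp (measurable_fst (β := ℝ))) hq1 measurable_snd
  cases b
  · exact measurable_const.sub ml
  · exact ml

lemma integral_splitWeight (P : ProbabilityMeasure (Obs 𝒳)) (hΛ : 1 ≤ Λ) (t b : Bool) (x : 𝒳) :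
    ∫ y, splitWeight P Λ t b (x, y) ∂(outcomeKernel P t x) = splitProb Λ t b := by
  have h := integral_lowerWeight (outcomeKernel P t x) (splitProb_pos hΛ t true)
    (splitProb_lt_one hΛ t true)
  have hi := integrable_lowerWeight (outcomeKernel P t x)
    (atomWeight_mem (outcomeKernel P t x) (splitProb_pos hΛ t true) (splitProb_lt_one hΛ t true))
    (quantile (outcomeKernel P t x) (splitProb Λ t true))
  have hadd := splitProb_add hΛ t
  cases b
  · have : ∫ y, (1 - lowerWeight (atomWeight (outcomeKernel P t x) (splitProb Λ t true)
        (quantile (outcomeKernel P t x) (splitProb Λ t true)))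
        (quantile (outcomeKernel P t x) (splitProb Λ t true)) y) ∂(outcomeKernel P t x) =
        1 - splitProb Λ t true := by
      rw [integral_sub (integrable_const _) hi, h]; simp
    rw [← eq_sub_iff_add_eq'.2 hadd] at this
    exact this
  · exact h

lemma lintegral_splitWeight (P : ProbabilityMeasure (Obs 𝒳)) (hΛ : 1 ≤ Λ) (t b : Bool) (x : 𝒳) :
    ∫⁻ y, ENNReal.ofReal (splitWeight P Λ t b (x, y) / splitProb Λ t b) ∂(outcomeKernel P t x)
      = 1 := by
  have hm : Measurable (fun y => splitWeight P Λ t b (x, y)) :=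
    (measurable_splitWeight P hΛ t b).comp measurable_prodMk_left
  have hi : Integrable (fun y => splitWeight P Λ t b (x, y)) (outcomeKernel P t x) :=
    Integrable.of_bound hm.aestronglyMeasurable 1 (Filter.Eventually.of_forall fun y => by
      have h := splitWeight_mem P hΛ t b (x, y)
      rw [Real.norm_eq_abs, abs_of_nonneg h.1]; exact h.2)
  rw [← ofReal_integral_eq_lintegral_ofReal (hi.div_const _) (Filter.Eventually.of_forall fun y =>
    div_nonneg (splitWeight_mem P hΛ t b (x, y)).1 (splitProb_pos hΛ t b).le), integral_div,
    integral_splitWeight P hΛ, div_self (splitProb_pos hΛ t b).ne', ENNReal.ofReal_one]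

/-- The law of `Y(t)` given the covariates and the part `b`. -/
def splitKernel (P : ProbabilityMeasure (Obs 𝒳)) (Λ : ℝ) (t : Bool) : Kernel (𝒳 × Bool) ℝ :=
  ((outcomeKernel P t).prodMkRight Bool).withDensity
    (fun v y => ENNReal.ofReal (splitWeight P Λ t v.2 (v.1, y) / splitProb Λ t v.2))

lemma measurable_splitDensity (P : ProbabilityMeasure (Obs 𝒳)) (hΛ : 1 ≤ Λ) (t : Bool) :
    Measurable (Function.uncurry fun (v : 𝒳 × Bool) (y : ℝ) =>
      ENNReal.ofReal (splitWeight P Λ t v.2 (v.1, y) / splitProb Λ t v.2)) := by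
  have h : Measurable (fun w : Bool × (𝒳 × ℝ) =>
      ENNReal.ofReal (splitWeight P Λ t w.1 w.2 / splitProb Λ t w.1)) :=
    measurable_from_prod_countable_right fun b =>
      ((measurable_splitWeight P hΛ t b).div_const (splitProb Λ t b)).ennreal_ofReal
  exact h.comp ((measurable_snd.comp measurable_fst).prodMk
    ((measurable_fst.comp measurable_fst).prodMk measurable_snd))

lemma lintegral_splitKernel (P : ProbabilityMeasure (Obs 𝒳)) (hΛ : 1 ≤ Λ) (t : Bool)
    (v : 𝒳 × Bool) {f : ℝ → ENNReal} (hf : Measurable f) :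
    ∫⁻ y, f y ∂(splitKernel P Λ t v) = ∫⁻ y,
      ENNReal.ofReal (splitWeight P Λ t v.2 (v.1, y) / splitProb Λ t v.2) * f y
        ∂(outcomeKernel P t v.1) := by
  rw [splitKernel, Kernel.lintegral_withDensity _ (measurable_splitDensity P hΛ t) _ hf]
  rfl

lemma isMarkovKernel_splitKernel (P : ProbabilityMeasure (Obs 𝒳)) (hΛ : 1 ≤ Λ) (t : Bool) :
    IsMarkovKernel (splitKernel P Λ t) := by
  refine ⟨fun v => ⟨?_⟩⟩
  rw [← lintegral_one, lintegral_splitKernel P hΛ t v measurable_const]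
  simpa using lintegral_splitWeight P hΛ t v.2 v.1

/-- The probability of the part `b` given the covariates. -/
def partProb (P : ProbabilityMeasure (Obs 𝒳)) (Λ : ℝ) (b : Bool) (x : 𝒳) : ℝ :=
  ∑ a, armProb P a x * splitProb Λ a b

/-- Some arm has positive probability and every split probability is positive, so overlap is not
needed. The kernels below are thereby Markov at every `x`, not just almost everywhere. -/
lemma partProb_pos (P : ProbabilityMeasure (Obs 𝒳)) (hΛ : 1 ≤ Λ) (b : Bool) (x : 𝒳) :
    0 < partProb P Λ b x := by
  have h := armProb_mem P true x
  have h' := armProb_not P true x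
  have s1 := splitProb_pos hΛ true b
  have s2 := splitProb_pos hΛ false b
  simp only [Bool.not_true] at h'
  simp only [partProb, Fintype.sum_bool, h']
  rcases h.1.eq_or_lt with h0 | h0
  · rw [← h0]; simpa using s2
  · have : 0 ≤ (1 - armProb P true x) * splitProb Λ false b :=
      mul_nonneg (by linarith [h.2]) s2.le
    positivity

lemma measurable_partProb (P : ProbabilityMeasure (Obs 𝒳)) (Λ : ℝ) (b : Bool) :
    Measurable (partProb P Λ b) := by
  unfold partProb
  exact Finset.measurable_sum _ fun a _ => (measurable_armProb P a).mul_const _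

/-- The law of the treatment given the covariates and the part `b`. -/
def treatKernel (P : ProbabilityMeasure (Obs 𝒳)) (Λ : ℝ) : Kernel (𝒳 × Bool) Bool :=
  (Kernel.const (𝒳 × Bool) (Measure.count : Measure Bool)).withDensity
    (fun v a => ENNReal.ofReal (armProb P a v.1 * splitProb Λ a v.2 / partProb P Λ v.2 v.1))

lemma measurable_treatDensity (P : ProbabilityMeasure (Obs 𝒳)) (Λ : ℝ) :
    Measurable (Function.uncurry fun (v : 𝒳 × Bool) (a : Bool) =>
      ENNReal.ofReal (armProb P a v.1 * splitProb Λ a v.2 / partProb P Λ v.2 v.1)) := by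
  have h : Measurable (fun w : (Bool × Bool) × 𝒳 => ENNReal.ofReal
      (armProb P w.1.1 w.2 * splitProb Λ w.1.1 w.1.2 / partProb P Λ w.1.2 w.2)) :=
    measurable_from_prod_countable_right fun b =>
      (((measurable_armProb P b.1).mul_const (splitProb Λ b.1 b.2)).div (measurable_partProb P Λ b.2)).ennreal_ofReal
  exact h.comp ((measurable_snd.prodMk (measurable_snd.comp measurable_fst)).prodMk
    (measurable_fst.comp measurable_fst))

lemma lintegral_treatKernel (P : ProbabilityMeasure (Obs 𝒳)) (Λ : ℝ) (v : 𝒳 × Bool)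
    (f : Bool → ENNReal) :
    ∫⁻ a, f a ∂(treatKernel P Λ v) = ∑ a,
      ENNReal.ofReal (armProb P a v.1 * splitProb Λ a v.2 / partProb P Λ v.2 v.1) * f a := by
  rw [treatKernel, Kernel.lintegral_withDensity _ (measurable_treatDensity P Λ) _
    (measurable_of_countable f), Kernel.const_apply, lintegral_count, tsum_fintype]

/-- `partProb` is the normalizing constant in Bayes' rule for the treatment given the part. -/
lemma sum_treat (P : ProbabilityMeasure (Obs 𝒳)) (hΛ : 1 ≤ Λ) (v : 𝒳 × Bool) :
    ∑ a, ENNReal.ofReal (armProb P a v.1 * splitProb Λ a v.2 / partProb P Λ v.2 v.1) = 1 := by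
  have hp := partProb_pos P hΛ v.2 v.1
  rw [← ENNReal.ofReal_sum_of_nonneg fun a _ => div_nonneg
    (mul_nonneg (armProb_mem P a v.1).1 (splitProb_pos hΛ a v.2).le) hp.le, ← Finset.sum_div]
  rw [show ∑ a, armProb P a v.1 * splitProb Λ a v.2 = partProb P Λ v.2 v.1 from rfl,
    div_self hp.ne', ENNReal.ofReal_one]

lemma isMarkovKernel_treatKernel (P : ProbabilityMeasure (Obs 𝒳)) (hΛ : 1 ≤ Λ) :
    IsMarkovKernel (treatKernel P Λ) := by
  refine ⟨fun v => ⟨?_⟩⟩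
  rw [← lintegral_one, lintegral_treatKernel]
  simpa using sum_treat P hΛ v

/-- The law of the covariates and the part. -/
def partLaw (P : ProbabilityMeasure (Obs 𝒳)) (Λ : ℝ) : Measure (𝒳 × Bool) :=
  ((covLaw P).prod Measure.count).withDensity (fun v => ENNReal.ofReal (partProb P Λ v.2 v.1))

lemma lintegral_partLaw (P : ProbabilityMeasure (Obs 𝒳)) (Λ : ℝ) {f : 𝒳 × Bool → ENNReal}
    (hf : Measurable f) :
    ∫⁻ v, f v ∂(partLaw P Λ) =
      ∫⁻ x, ∑ b, ENNReal.ofReal (partProb P Λ b x) * f (x, b) ∂(covLaw P) := by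
  have hd : Measurable (fun v : 𝒳 × Bool => ENNReal.ofReal (partProb P Λ v.2 v.1)) :=
    measurable_from_prod_countable_left fun b => (measurable_partProb P Λ b).ennreal_ofReal
  rw [partLaw, lintegral_withDensity_eq_lintegral_mul _ hd hf,
    lintegral_prod _ (hd.mul hf).aemeasurable]
  refine lintegral_congr fun x => ?_
  rw [lintegral_count, tsum_fintype]
  rfl

lemma sum_partProb (P : ProbabilityMeasure (Obs 𝒳)) (hΛ : 1 ≤ Λ) (x : 𝒳) :
    ∑ b, partProb P Λ b x = 1 := by
  have h1 := splitProb_add hΛ true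
  have h0 := splitProb_add hΛ false
  have h' := armProb_not P true x
  simp only [Bool.not_true] at h'
  simp only [partProb, Fintype.sum_bool, h']
  linear_combination armProb P true x * h1 + (1 - armProb P true x) * h0

lemma isProbabilityMeasure_partLaw (P : ProbabilityMeasure (Obs 𝒳)) (hΛ : 1 ≤ Λ) :
    IsProbabilityMeasure (partLaw P Λ) := by
  refine ⟨?_⟩
  rw [← lintegral_one, lintegral_partLaw P Λ measurable_const]
  simp only [mul_one]
  rw [show (fun x => ∑ b, ENNReal.ofReal (partProb P Λ b x)) = fun _ => 1 from ?_]
  · simp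
  · ext x
    rw [← ENNReal.ofReal_sum_of_nonneg fun b _ => (partProb_pos P hΛ b x).le, sum_partProb P hΛ,
      ENNReal.ofReal_one]

end Splitting

/-! ### The extremal law: observed and counterfactual marginals. -/

section Extremal
variable {𝒳 : Type*} [MeasurableSpace 𝒳] {k : ℕ} {Λ : ℝ}

/-- The law of the full data whose confounder encodes, through `code`, whether the outcomes are in
the lower or the upper part of their conditional laws. -/
def extremalMeasure (P : ProbabilityMeasure (Obs 𝒳)) (Λ : ℝ)
    (code : Bool → EuclideanSpace ℝ (Fin k)) : Measure (Full 𝒳 k) :=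
  (partLaw P Λ ⊗ₘ ((splitKernel P Λ true ×ₖ splitKernel P Λ false) ×ₖ treatKernel P Λ)).map
    (fun w => (w.1.1, w.2.1, w.2.2, code w.1.2))

lemma measurable_extremal_map (code : Bool → EuclideanSpace ℝ (Fin k)) :
    Measurable (fun w : (𝒳 × Bool) × (ℝ × ℝ) × Bool =>
      ((w.1.1, w.2.1, w.2.2, code w.1.2) : Full 𝒳 k)) := by
  have hc : Measurable code := measurable_of_countable code
  exact (measurable_fst.comp measurable_fst).prodMk ((measurable_fst.comp measurable_snd).prodMk
    ((measurable_snd.comp measurable_snd).prodMk (hc.comp (measurable_snd.comp measurable_fst))))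

lemma isProbabilityMeasure_extremalMeasure (P : ProbabilityMeasure (Obs 𝒳)) (hΛ : 1 ≤ Λ)
    (code : Bool → EuclideanSpace ℝ (Fin k)) : IsProbabilityMeasure (extremalMeasure P Λ code) := by
  have := isMarkovKernel_splitKernel P hΛ true
  have := isMarkovKernel_splitKernel P hΛ false
  have := isMarkovKernel_treatKernel P hΛ
  have := isProbabilityMeasure_partLaw P hΛ
  exact Measure.isProbabilityMeasure_map (measurable_extremal_map code).aemeasurable

/-- The extremal law, as a probability measure. -/
def extremalLaw (P : ProbabilityMeasure (Obs 𝒳)) (hΛ : 1 ≤ Λ)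
    (code : Bool → EuclideanSpace ℝ (Fin k)) : ProbabilityMeasure (Full 𝒳 k) :=
  ⟨extremalMeasure P Λ code, isProbabilityMeasure_extremalMeasure P hΛ code⟩

lemma coe_extremalLaw (P : ProbabilityMeasure (Obs 𝒳)) (hΛ : 1 ≤ Λ)
    (code : Bool → EuclideanSpace ℝ (Fin k)) :
    (extremalLaw P hΛ code : Measure (Full 𝒳 k)) = extremalMeasure P Λ code := rfl

/-- The two outcomes are drawn independently given covariates and part. Each arm only looks at one
of them, so their coupling plays no role. -/
lemma map_outcome_prod (P : ProbabilityMeasure (Obs 𝒳)) (hΛ : 1 ≤ Λ) (t : Bool) (v : 𝒳 × Bool) :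
    ((splitKernel P Λ true v).prod (splitKernel P Λ false v)).map (outcome t) =
      splitKernel P Λ t v := by
  have := isMarkovKernel_splitKernel P hΛ true
  have := isMarkovKernel_splitKernel P hΛ false
  cases t
  · exact (Measure.map_snd_prod).trans (by simp)
  · exact (Measure.map_fst_prod).trans (by simp)

/-- The density of the law of `Y(t)` given `A = a` with respect to that given `A = t`. -/
def counterDensity (P : ProbabilityMeasure (Obs 𝒳)) (Λ : ℝ) (t a : Bool) (w : 𝒳 × ℝ) : ℝ :=
  ∑ b, splitProb Λ a b * (splitWeight P Λ t b w / splitProb Λ t b)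

lemma measurable_counterDensity (P : ProbabilityMeasure (Obs 𝒳)) (hΛ : 1 ≤ Λ) (t a : Bool) :
    Measurable (counterDensity P Λ t a) :=
  Finset.measurable_sum _ fun b _ => ((measurable_splitWeight P hΛ t b).div_const _).const_mul _

/-- In its own arm the parts are mixed in the proportions in which the law was cut, which returns
the whole law. This is why the extremal law induces `P`. -/
lemma counterDensity_self (P : ProbabilityMeasure (Obs 𝒳)) (hΛ : 1 ≤ Λ) (t : Bool) (w : 𝒳 × ℝ) :
    counterDensity P Λ t t w = 1 := by
  rw [counterDensity, ← splitWeight_add P Λ t w, Fintype.sum_bool]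
  rw [mul_div_cancel₀ _ (splitProb_pos hΛ t true).ne', mul_div_cancel₀ _
    (splitProb_pos hΛ t false).ne']

/-- Sum out the part: `partProb` cancels, so given `X` arm `a` and part `b` occur together with
probability `armProb P a` times `splitProb Λ a b`. Given `A = a`, the outcome `Y(t)` is therefore
the mixture of its two parts with weights `splitProb Λ a`. -/
lemma lintegral_extremalMeasure (P : ProbabilityMeasure (Obs 𝒳)) (hΛ : 1 ≤ Λ)
    (code : Bool → EuclideanSpace ℝ (Fin k)) (t : Bool) {f : 𝒳 → Bool → ℝ → ENNReal}
    (hf : Measurable (fun w : (𝒳 × Bool) × ℝ => f w.1.1 w.1.2 w.2)) :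
    ∫⁻ o, f o.x o.a (o.yt t) ∂(extremalMeasure P Λ code) =
      ∫⁻ x, ∑ a, ENNReal.ofReal (armProb P a x) *
        ∫⁻ y, ENNReal.ofReal (counterDensity P Λ t a (x, y)) * f x a y ∂(outcomeKernel P t x)
          ∂(covLaw P) := by
  have := isMarkovKernel_splitKernel P hΛ true
  have := isMarkovKernel_splitKernel P hΛ false
  have := isMarkovKernel_splitKernel P hΛ t
  have := isMarkovKernel_treatKernel P hΛ
  have := isProbabilityMeasure_partLaw P hΛ
  have ho := measurable_outcome t
  have hg : Measurable (fun o : Full 𝒳 k => f o.x o.a (o.yt t)) :=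
    hf.comp ((Full.measurable_x.prodMk Full.measurable_a).prodMk (Full.measurable_yt t))
  have hg' : Measurable (fun w : (𝒳 × Bool) × (ℝ × ℝ) × Bool =>
      f w.1.1 w.2.2 (outcome t w.2.1)) :=
    hf.comp (((measurable_fst.comp measurable_fst).prodMk
      (measurable_snd.comp measurable_snd)).prodMk
        (ho.comp (measurable_fst.comp measurable_snd)))
  have hfx : ∀ x a, Measurable (fun y => f x a y) := fun x a =>
    hf.comp (measurable_prodMk_left (x := (x, a)))
  have hinner : ∀ v : 𝒳 × Bool,
      ∫⁻ b, f v.1 b.2 (outcome t b.1) ∂(((splitKernel P Λ true ×ₖ splitKernel P Λ false) ×ₖ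
        treatKernel P Λ) v) =
      ∑ a, ENNReal.ofReal (armProb P a v.1 * splitProb Λ a v.2 / partProb P Λ v.2 v.1) *
        ∫⁻ y, ENNReal.ofReal (splitWeight P Λ t v.2 (v.1, y) / splitProb Λ t v.2) * f v.1 a y
          ∂(outcomeKernel P t v.1) := by
    intro v
    rw [Kernel.prod_apply, Kernel.prod_apply]
    refine (lintegral_prod_symm _ (hg'.comp (measurable_prodMk_left (x := v))).aemeasurable).trans ?_
    rw [lintegral_treatKernel]
    refine Finset.sum_congr rfl fun a _ => ?_
    rw [← lintegral_splitKernel P hΛ t v (hfx v.1 a), ← map_outcome_prod P hΛ t v,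
      lintegral_map (hfx v.1 a) ho]
    rfl
  have hL : Measurable fun v : 𝒳 × Bool => ∫⁻ b, f v.1 b.2 (outcome t b.1)
      ∂(((splitKernel P Λ true ×ₖ splitKernel P Λ false) ×ₖ treatKernel P Λ) v) :=
    hg'.lintegral_kernel_prod_right'
  rw [extremalMeasure, lintegral_map hg (measurable_extremal_map code)]
  refine (Measure.lintegral_compProd hg').trans ?_
  rw [lintegral_partLaw P Λ hL]
  refine lintegral_congr fun x => ?_
  simp only [hinner]
  simp only [Finset.mul_sum]
  rw [Finset.sum_comm]
  refine Finset.sum_congr rfl fun a _ => ?_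
  have hw : ∀ b, Measurable (fun y => splitWeight P Λ t b (x, y)) := fun b =>
    (measurable_splitWeight P hΛ t b).comp measurable_prodMk_left
  have hpa := (armProb_mem P a x).1
  have h1 : ∀ y, ENNReal.ofReal (counterDensity P Λ t a (x, y)) * f x a y =
      ∑ b, ENNReal.ofReal (splitProb Λ a b) *
        (ENNReal.ofReal (splitWeight P Λ t b (x, y) / splitProb Λ t b) * f x a y) := by
    intro y
    rw [counterDensity, ENNReal.ofReal_sum_of_nonneg, Finset.sum_mul]
    · refine Finset.sum_congr rfl fun b _ => ?_
      rw [ENNReal.ofReal_mul (splitProb_pos hΛ a b).le, mul_assoc]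
    · exact fun b _ => mul_nonneg (splitProb_pos hΛ a b).le
        (div_nonneg (splitWeight_mem P hΛ t b _).1 (splitProb_pos hΛ t b).le)
  have hwm : ∀ b, Measurable (fun y =>
      ENNReal.ofReal (splitWeight P Λ t b (x, y) / splitProb Λ t b) * f x a y) := fun b =>
    ((hw b).div_const _).ennreal_ofReal.mul (hfx x a)
  simp only [h1]
  rw [lintegral_finsetSum _ fun b _ => (hwm b).const_mul _, Finset.mul_sum]
  refine Finset.sum_congr rfl fun b _ => ?_
  have hpb := partProb_pos P hΛ b x
  rw [lintegral_const_mul _ (hwm b), ← mul_assoc,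
    ← mul_assoc, ← ENNReal.ofReal_mul hpb.le, ← ENNReal.ofReal_mul hpa,
    mul_div_cancel₀ _ hpb.ne']

lemma observedLaw_extremalLaw (P : ProbabilityMeasure (Obs 𝒳)) (hΛ : 1 ≤ Λ)
    (code : Bool → EuclideanSpace ℝ (Fin k)) : observedLaw (extremalLaw P hΛ code) = P := by
  refine Subtype.ext ?_
  change (observedLaw (extremalLaw P hΛ code) : Measure (Obs 𝒳)) = (P : Measure (Obs 𝒳))
  rw [coe_observedLaw, coe_extremalLaw]
  refine Measure.ext_of_lintegral _ fun f hf => ?_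
  have hm : Measurable (fun w : (𝒳 × Bool) × ℝ => f (w.1.1, w.2, w.1.2)) := by fun_prop
  have hmt : ∀ t, Measurable (fun w : (𝒳 × Bool) × ℝ =>
      if w.1.2 = t then f (w.1.1, w.2, t) else 0) := fun t => by
    refine Measurable.ite ?_ (by fun_prop) measurable_const
    exact (measurable_snd.comp measurable_fst) (measurableSet_singleton t)
  have hP : ∫⁻ z, f z ∂(P : Measure (Obs 𝒳)) = _ :=
    lintegral_obs P (f := fun x a y => f (x, y, a)) hm
  rw [lintegral_map hf Full.measurable_obs, hP]
  -- Only one potential outcome is seen in each arm, so the formula for a single `Y(t)` suffices.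
  have hsplit : ∀ o : Full 𝒳 k, f o.obs =
      ∑ t, (if o.a = t then f (o.x, o.yt t, t) else 0) := by
    intro o
    rw [Finset.sum_ite_eq]
    simp [Full.obs, Full.yt, outcome]
  simp only [hsplit]
  have hmo : ∀ t, Measurable (fun o : Full 𝒳 k => if o.a = t then f (o.x, o.yt t, t) else 0) :=
    fun t => (hmt t).comp
      ((Full.measurable_x.prodMk Full.measurable_a).prodMk (Full.measurable_yt t))
  rw [lintegral_finsetSum _ fun t _ => hmo t]
  have hterm : ∀ t, ∫⁻ o, (if o.a = t then f (o.x, o.yt t, t) else 0)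
      ∂(extremalMeasure P Λ code) =
      ∫⁻ x, ENNReal.ofReal (armProb P t x) * ∫⁻ y, f (x, y, t) ∂(outcomeKernel P t x)
        ∂(covLaw P) := by
    intro t
    refine (lintegral_extremalMeasure P hΛ code t
      (f := fun x a y => if a = t then f (x, y, t) else 0) (hmt t)).trans ?_
    refine lintegral_congr fun x => ?_
    rw [Finset.sum_eq_single t]
    · simp [counterDensity_self P hΛ]
    · intro s _ hs; simp [hs]
    · simp
  simp only [hterm]
  rw [lintegral_finsetSum]
  intro t _
  have hft : Measurable (fun w : 𝒳 × ℝ => f (w.1, w.2, t)) := by fun_prop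
  exact (measurable_armProb P t).ennreal_ofReal.mul hft.lintegral_kernel_prod_right'

lemma counterLaw_extremalLaw (P : ProbabilityMeasure (Obs 𝒳)) (hΛ : 1 ≤ Λ)
    (code : Bool → EuclideanSpace ℝ (Fin k)) (t : Bool) :
    counterLaw (extremalLaw P hΛ code) t =
      (swapLaw P t).withDensity (fun w => ENNReal.ofReal (counterDensity P Λ t (!t) w)) := by
  have hd := (measurable_counterDensity P hΛ t (!t)).ennreal_ofReal
  refine Measure.ext_of_lintegral _ fun f hf => ?_
  have hm : Measurable (fun w : (𝒳 × Bool) × ℝ => if w.1.2 = !t then f (w.1.1, w.2) else 0) := by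
    refine Measurable.ite ?_ (by fun_prop) measurable_const
    exact (measurable_snd.comp measurable_fst) (measurableSet_singleton _)
  rw [lintegral_counterLaw _ t hf, lintegral_withDensity_eq_lintegral_mul _ hd hf,
    lintegral_swapLaw P t (hd.mul hf), ← lintegral_indicator (Full.measurableSet_a _),
    coe_extremalLaw]
  refine Eq.trans (lintegral_congr fun o => ?_) ((lintegral_extremalMeasure P hΛ code t
      (f := fun x a y => if a = !t then f (x, y) else 0) hm).trans ?_)
  · simp [Set.indicator_apply]
  · refine lintegral_congr fun x => ?_
    rw [Finset.sum_eq_single (!t)]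
    · simp [armProb_not]
    · intro s _ hs; simp [hs]
    · simp

lemma counterDensity_mem (P : ProbabilityMeasure (Obs 𝒳)) (hΛ : 1 ≤ Λ) (t a : Bool) (w : 𝒳 × ℝ) :
    counterDensity P Λ t a w ∈
      Set.Icc 0 (∑ b, splitProb Λ a b * (1 / splitProb Λ t b)) := by
  refine ⟨Finset.sum_nonneg fun b _ => mul_nonneg (splitProb_pos hΛ a b).le
    (div_nonneg (splitWeight_mem P hΛ t b _).1 (splitProb_pos hΛ t b).le),
    Finset.sum_le_sum fun b _ => mul_le_mul_of_nonneg_left ?_ (splitProb_pos hΛ a b).le⟩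
  exact div_le_div_of_nonneg_right (splitWeight_mem P hΛ t b _).2 (splitProb_pos hΛ t b).le

/-- Away from the cut exactly one of the parts carries the outcome. At the cut an atom may be shared
between both, hence the exclusion. -/
lemma counterDensity_eq_slope (P : ProbabilityMeasure (Obs 𝒳)) (Λ : ℝ) (t a : Bool)
    (w : 𝒳 × ℝ) (hw : w.2 ≠ splitQuantile P Λ t w.1) :
    counterDensity P Λ t a w = slope (splitProb Λ a false / splitProb Λ t false)
      (splitProb Λ a true / splitProb Λ t true) (splitQuantile P Λ t w.1) w.2 := by
  rcases lt_or_gt_of_ne hw with h | h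
  · simp [counterDensity, slope, splitWeight, lowerWeight, h, not_le.2 h, div_eq_mul_inv]
  · simp [counterDensity, slope, splitWeight, lowerWeight, h.le, not_lt.2 h.le, hw,
      div_eq_mul_inv]

/-- The construction conditions on `(X, b)` with `b` Boolean, the model on `(X, U)`. Pulling the
kernels back along `decode` makes them kernels over the confounder space; off the range of `code`
their values do not matter. -/
lemma map_extremalMeasure (P : ProbabilityMeasure (Obs 𝒳)) (hΛ : 1 ≤ Λ)
    (code : Bool → EuclideanSpace ℝ (Fin k)) {decode : EuclideanSpace ℝ (Fin k) → Bool}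
    (hdec : Measurable decode) (hcd : ∀ b, decode (code b) = b) :
    (extremalMeasure P Λ code).map (fun o => (o.xu, (o.y1, o.y0), o.a)) =
      (partLaw P Λ).map (fun v => (v.1, code v.2)) ⊗ₘ
        (((splitKernel P Λ true ×ₖ splitKernel P Λ false).comap
          (fun v : 𝒳 × EuclideanSpace ℝ (Fin k) => (v.1, decode v.2))
          (measurable_fst.prodMk (hdec.comp measurable_snd))) ×ₖ
        ((treatKernel P Λ).comap (fun v : 𝒳 × EuclideanSpace ℝ (Fin k) => (v.1, decode v.2))
          (measurable_fst.prodMk (hdec.comp measurable_snd)))) := by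
  have := isMarkovKernel_splitKernel P hΛ true
  have := isMarkovKernel_splitKernel P hΛ false
  have := isMarkovKernel_treatKernel P hΛ
  have := isProbabilityMeasure_partLaw P hΛ
  have hc : Measurable (fun v : 𝒳 × Bool => (v.1, code v.2)) :=
    measurable_fst.prodMk ((measurable_of_countable code).comp measurable_snd)
  have hall : Measurable (fun o : Full 𝒳 k => (o.xu, (o.y1, o.y0), o.a)) :=
    Full.measurable_xu.prodMk (Full.measurable_ys.prodMk Full.measurable_a)
  refine Measure.ext_of_lintegral _ fun f hf => ?_
  rw [extremalMeasure, Measure.map_map hall (measurable_extremal_map code),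
    lintegral_map hf (hall.comp (measurable_extremal_map code))]
  refine (Measure.lintegral_compProd
    (hf.comp (hall.comp (measurable_extremal_map code)))).trans ?_
  rw [Measure.lintegral_compProd hf, lintegral_map hf.lintegral_kernel_prod_right' hc]
  refine lintegral_congr fun v => ?_
  simp only [Kernel.prod_apply, Kernel.comap_apply, hcd]
  rfl

end Extremal

/-! ### The extremal law satisfies the sensitivity model. -/

section ExtremalModel
variable {𝒳 : Type*} [MeasurableSpace 𝒳] [StandardBorelSpace 𝒳] {k : ℕ} {Λ : ℝ}

/-- Bayes' rule in odds form: the prior odds cancel and the likelihood ratio remains. -/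
lemma odds_ratio_eq {p C D : ℝ} (hp : p ∈ Set.Ioo (0 : ℝ) 1) (hC : 0 < C) (hD : 0 < D) :
    odds (p * C / (p * C + (1 - p) * D)) / odds p = C / D := by
  obtain ⟨h0, h1⟩ := hp
  have hq : 0 < 1 - p := by linarith
  have hs : 0 < p * C + (1 - p) * D := by positivity
  have e : 1 - p * C / (p * C + (1 - p) * D) = (1 - p) * D / (p * C + (1 - p) * D) := by
    field_simp; ring
  unfold odds
  rw [e]
  field_simp

/-- The constraint is saturated: the ratio is `1/Λ` on the lower part and `Λ` on the upper part. -/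
lemma splitProb_ratio_mem (hΛ : 1 ≤ Λ) (b : Bool) :
    splitProb Λ true b / splitProb Λ false b ∈ Set.Icc (1 / Λ) Λ := by
  have h0 : 0 < Λ := by linarith
  have h1 : 1 + Λ ≠ 0 := by linarith
  have h2 : 1 / Λ ≤ Λ := by rw [div_le_iff₀ h0]; nlinarith
  have h3 : splitProb Λ true b / splitProb Λ false b = if b then 1 / Λ else Λ := by
    cases b <;> simp [splitProb] <;> field_simp
  rw [h3]
  cases b
  · simpa using h2
  · simpa using h2

/-- Conditional independence is built into the product kernel, and `P(A = 1 | X, U)` is almost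
surely the Bayes posterior. Overlap is needed because degenerate odds would not cancel. -/
lemma marginalSensitivityModel_extremalLaw (P : ProbabilityMeasure (Obs 𝒳)) (hΛ : 1 ≤ Λ)
    (hpos : ∀ᵐ x ∂(covLaw P), armProb P true x ∈ Set.Ioo (0 : ℝ) 1)
    (code : Bool → EuclideanSpace ℝ (Fin k)) {decode : EuclideanSpace ℝ (Fin k) → Bool}
    (hdec : Measurable decode) (hcd : ∀ b, decode (code b) = b) :
    MarginalSensitivityModel Λ (extremalLaw P hΛ code) := by
  have := isMarkovKernel_splitKernel P hΛ true
  have := isMarkovKernel_splitKernel P hΛ false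
  have := isMarkovKernel_treatKernel P hΛ
  have := isProbabilityMeasure_partLaw P hΛ
  obtain ⟨h1, h2⟩ := condIndepFun_of_map_eq (extremalLaw P hΛ code) _ _
    (map_extremalMeasure P hΛ code hdec hcd)
  refine ⟨h1, ?_⟩
  have hx := condProbTreated_observedLaw (extremalLaw P hΛ code)
  rw [covLaw_observedLaw, observedLaw_extremalLaw] at hx
  have hpos' := hpos
  rw [← observedLaw_extremalLaw P hΛ code, covLaw_observedLaw, observedLaw_extremalLaw] at hpos'
  filter_upwards [ae_of_ae_map Full.measurable_xu.aemeasurable h2,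
    ae_of_ae_map Full.measurable_x.aemeasurable hx,
    ae_of_ae_map Full.measurable_x.aemeasurable hpos'] with o ho hxo hpo
  have e1 : condProbTreated (extremalLaw P hΛ code : Measure (Full 𝒳 k)) Full.a Full.xu o.xu =
      armProb P true o.x * splitProb Λ true (decode o.u) / partProb P Λ (decode o.u) o.x := by
    rw [condProbTreated, ho, Kernel.comap_apply, measureReal_def,
      ← lintegral_indicator_one (measurableSet_singleton true), lintegral_treatKernel,
      Fintype.sum_bool]
    simp only [Set.mem_singleton_iff, Set.indicator_of_mem, Pi.one_apply, mul_one]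
    rw [Set.indicator_of_notMem (by simp), mul_zero, add_zero, ENNReal.toReal_ofReal]
    · rfl
    · exact div_nonneg (mul_nonneg (armProb_mem P _ _).1 (splitProb_pos hΛ _ _).le)
        (partProb_pos P hΛ _ _).le
  have e2 : condProbTreated (extremalLaw P hΛ code : Measure (Full 𝒳 k)) Full.a Full.x o.x =
      armProb P true o.x := by
    rw [← hxo]; simp [armProb, propensity]
  have e3 : partProb P Λ (decode o.u) o.x = armProb P true o.x * splitProb Λ true (decode o.u) +
      (1 - armProb P true o.x) * splitProb Λ false (decode o.u) := by
    have h' := armProb_not P true o.x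
    simp only [Bool.not_true] at h'
    simp only [partProb, Fintype.sum_bool, h']
  rw [e1, e2, e3, odds_ratio_eq hpo (splitProb_pos hΛ _ _) (splitProb_pos hΛ _ _)]
  exact splitProb_ratio_mem hΛ _

/-- A binary variable can be encoded as a confounder. -/
lemma exists_code (hk : 0 < k) : ∃ (code : Bool → EuclideanSpace ℝ (Fin k))
    (decode : EuclideanSpace ℝ (Fin k) → Bool), Measurable decode ∧
      ∀ b, decode (code b) = b := by
  classical
  -- The confounder space must contain two points; this is what `k ≥ 1` is for.
  have : Nonempty (Fin k) := ⟨⟨0, hk⟩⟩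
  obtain ⟨u, hu⟩ := exists_ne (0 : EuclideanSpace ℝ (Fin k))
  refine ⟨fun b => if b then 0 else u, fun v => decide (v = 0), ?_, fun b => ?_⟩
  · refine measurable_to_bool ?_
    have : (fun v : EuclideanSpace ℝ (Fin k) => decide (v = 0)) ⁻¹' {true} = {0} := by
      ext v; simp
    rw [this]
    exact measurableSet_singleton 0
  · cases b <;> simp [hu]

end ExtremalModel

/-! ### Pointwise Lipschitz bounds and derivatives along a segment of nuisances. -/

section PathCalculus

/-- The segment from `u` to `v`. -/
def seg (u v r : ℝ) : ℝ := u + r * (v - u)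

lemma seg_zero (u v : ℝ) : seg u v 0 = u := by simp [seg]

lemma hasDerivAt_seg (u v r : ℝ) : HasDerivAt (seg u v) (v - u) r := by
  have h := ((hasDerivAt_id r).mul_const (v - u)).const_add u
  rw [one_mul] at h
  exact h

lemma abs_seg_sub (u v r s : ℝ) : |seg u v r - seg u v s| ≤ (|u| + |v|) * |r - s| := by
  have : seg u v r - seg u v s = (v - u) * (r - s) := by unfold seg; ring
  rw [this, abs_mul]
  exact mul_le_mul_of_nonneg_right ((abs_sub v u).trans (by linarith)) (abs_nonneg _)

lemma abs_seg_le (u v : ℝ) {r : ℝ} (hr : |r| ≤ 1) : |seg u v r| ≤ 2 * |u| + |v| := by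
  have h := abs_seg_sub u v r 0
  rw [seg_zero, sub_zero] at h
  have h2 : (|u| + |v|) * |r| ≤ (|u| + |v|) * 1 :=
    mul_le_mul_of_nonneg_left hr (by positivity)
  have h3 : |seg u v r| ≤ |seg u v r - u| + |u| := by
    have := abs_add_le (seg u v r - u) u
    simpa using this
  linarith

/-- Positive and negative parts are 1-Lipschitz, so the bound holds across the kink, where the
derivative in `q` may fail to exist. -/
lemma abs_tilt_sub (c d q q' y : ℝ) :
    |tilt c d q y - tilt c d q' y| ≤ (1 + |c| + |d|) * |q - q'| := by
  rw [tilt_eq_max_min, tilt_eq_max_min]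
  have h1 : |max (y - q) 0 - max (y - q') 0| ≤ |q - q'| := by
    refine (abs_max_sub_max_le_abs (y - q) (y - q') 0).trans (le_of_eq ?_)
    rw [show y - q - (y - q') = -(q - q') by ring, abs_neg]
  have h2 : |min (y - q) 0 - min (y - q') 0| ≤ |q - q'| := by
    have := abs_max_sub_max_le_abs (q - y) (q' - y) 0
    have e : ∀ s : ℝ, min (y - s) 0 = - max (s - y) 0 := fun s => by
      rw [min_def, max_def]; split_ifs <;> linarith
    rw [e, e, show -max (q - y) 0 - -max (q' - y) 0 = -(max (q - y) 0 - max (q' - y) 0) by ring,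
      abs_neg]
    refine this.trans (le_of_eq ?_)
    congr 1; ring
  calc _ = |(q - q') + (c * (max (y - q) 0 - max (y - q') 0) +
        d * (min (y - q) 0 - min (y - q') 0))| := by congr 1; ring
    _ ≤ |q - q'| + (|c| * |q - q'| + |d| * |q - q'|) := by
        refine (abs_add_le _ _).trans (add_le_add le_rfl ((abs_add_le _ _).trans ?_))
        rw [abs_mul, abs_mul]
        gcongr
    _ = _ := by ring

/-- Bounds for the reciprocal of a segment that stays positive. -/
lemma seg_inv_bounds {p p' ε : ℝ} (hp : 0 < p) (hε : 0 < ε)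
    (h1 : 0 ≤ seg p p' ε) (h2 : 0 ≤ seg p p' (-ε)) {r s : ℝ} (hr : |r| ≤ ε / 2)
    (hs : |s| ≤ ε / 2) :
    |p' - p| ≤ p / ε ∧ 0 < seg p p' r ∧ |1 / seg p p' r| ≤ 2 * (1 / p) ∧
      |1 / seg p p' r - 1 / seg p p' s| ≤ 4 / ε * (1 / p) * |r - s| := by
  unfold seg at h1 h2
  -- Nonnegativity at the two endpoints bounds the increment from both sides.
  have hd : |p' - p| ≤ p / ε := by
    rw [abs_le, ← neg_div, div_le_iff₀ hε, le_div_iff₀ hε]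
    constructor <;> linarith
  -- On the inner half of the interval at most half of `p` is lost.
  have key : ∀ r : ℝ, |r| ≤ ε / 2 → p / 2 ≤ seg p p' r := by
    intro r hr
    have : |r * (p' - p)| ≤ ε / 2 * (p / ε) := by
      rw [abs_mul]; exact mul_le_mul hr hd (abs_nonneg _) (by positivity)
    have e : ε / 2 * (p / ε) = p / 2 := by field_simp
    rw [e] at this
    have := (abs_le.1 this).1
    unfold seg; linarith
  have hr' := key r hr
  have hs' := key s hs
  have hr0 : 0 < seg p p' r := by linarith
  have hs0 : 0 < seg p p' s := by linarith
  have ir : 1 / seg p p' r ≤ 2 * (1 / p) := by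
    have : 1 / seg p p' r ≤ 1 / (p / 2) := one_div_le_one_div_of_le (by linarith) hr'
    refine this.trans (le_of_eq ?_); field_simp
  have is : 1 / seg p p' s ≤ 2 * (1 / p) := by
    have : 1 / seg p p' s ≤ 1 / (p / 2) := one_div_le_one_div_of_le (by linarith) hs'
    refine this.trans (le_of_eq ?_); field_simp
  refine ⟨hd, hr0, ?_, ?_⟩
  · rwa [abs_of_pos (by positivity)]
  · have e : 1 / seg p p' r - 1 / seg p p' s =
        -((p' - p) * (r - s)) * (1 / seg p p' r * (1 / seg p p' s)) := by
      rw [div_sub_div _ _ hr0.ne' hs0.ne']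
      have : 1 * seg p p' s - seg p p' r * 1 = -((p' - p) * (r - s)) := by unfold seg; ring
      rw [this]; field_simp
    rw [e, abs_mul, abs_neg, abs_mul, abs_of_pos (by positivity : 0 < 1 / seg p p' r *
      (1 / seg p p' s))]
    calc |p' - p| * |r - s| * (1 / seg p p' r * (1 / seg p p' s))
        ≤ p / ε * |r - s| * (2 * (1 / p) * (2 * (1 / p))) := by
          gcongr
      _ = _ := by field_simp; norm_num

/-- One observation's score along a segment of nuisances. -/
def pathScore (c d π i y p p' q q' R R' r : ℝ) : ℝ :=
  π * (i * (y - tilt c d (seg q q' r) y) + seg R R' r +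
    i * (1 / seg p p' r * (tilt c d (seg q q' r) y - seg R R' r)))

/-- Off the arm only `R` moves; on the arm the inverse weight costs a factor `1 / p`. Keeping `i /
p` in the constant, instead of a uniform bound, leaves an expression that inverse probability
weighting shows to be integrable. -/
lemma abs_pathScore_sub {c d π i y p p' q q' R R' ε r s : ℝ} (hπ : π ∈ Set.Icc (0 : ℝ) 1)
    (hi : i = 0 ∨ i = 1) (hp : 0 < p) (hp1 : p ≤ 1) (hε : 0 < ε) (hε1 : ε ≤ 1)
    (h1 : 0 ≤ seg p p' ε) (h2 : 0 ≤ seg p p' (-ε)) (hr : |r| ≤ ε / 2) (hs : |s| ≤ ε / 2) :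
    |pathScore c d π i y p p' q q' R R' r - pathScore c d π i y p p' q q' R R' s| ≤
      ((2 * |R| + |R'|) + i * (1 / p * ((1 + |c| + |d|) * (3 + 4 / ε) *
        (|y| + (2 * |q| + |q'|) + (2 * |R| + |R'|))))) * |r - s| := by
  set K := 1 + |c| + |d| with hK
  set T := |y| + (2 * |q| + |q'|) + (2 * |R| + |R'|) with hT
  have hK1 : 1 ≤ K := by have := abs_nonneg c; have := abs_nonneg d; linarith
  have hT0 : 0 ≤ T := by positivity
  have hTR : 2 * |R| + |R'| ≤ T := by
    have := abs_nonneg y; have := abs_nonneg q; have := abs_nonneg q'; linarith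
  have hrs := abs_nonneg (r - s)
  have hR : |seg R R' r - seg R R' s| ≤ (2 * |R| + |R'|) * |r - s| :=
    (abs_seg_sub R R' r s).trans (mul_le_mul_of_nonneg_right (by linarith [abs_nonneg R]) hrs)
  have hg : |tilt c d (seg q q' r) y - tilt c d (seg q q' s) y| ≤
      K * ((2 * |q| + |q'|) * |r - s|) := by
    refine (abs_tilt_sub c d _ _ y).trans ?_
    refine mul_le_mul_of_nonneg_left ((abs_seg_sub q q' r s).trans ?_) (by linarith)
    exact mul_le_mul_of_nonneg_right (by linarith [abs_nonneg q]) hrs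
  have hg' : K * ((2 * |q| + |q'|) * |r - s|) ≤ K * T * |r - s| := by
    rw [mul_assoc]
    refine mul_le_mul_of_nonneg_left (mul_le_mul_of_nonneg_right ?_ hrs) (by linarith)
    have := abs_nonneg y; have := abs_nonneg R; have := abs_nonneg R'; linarith
  obtain ⟨-, hpr, hir, hirs⟩ := seg_inv_bounds hp hε h1 h2 hr hs
  have hpp : 1 ≤ 1 / p := by rw [le_div_iff₀ hp]; linarith
  have hh : |(tilt c d (seg q q' r) y - seg R R' r) - (tilt c d (seg q q' s) y - seg R R' s)| ≤
      K * T * |r - s| := by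
    have e : (tilt c d (seg q q' r) y - seg R R' r) - (tilt c d (seg q q' s) y - seg R R' s) =
      (tilt c d (seg q q' r) y - tilt c d (seg q q' s) y) - (seg R R' r - seg R R' s) := by ring
    rw [e]
    refine (abs_sub _ _).trans ((add_le_add hg hR).trans ?_)
    have : (2 * |R| + |R'|) * |r - s| ≤ K * ((2 * |R| + |R'|) * |r - s|) :=
      le_mul_of_one_le_left (by positivity) hK1
    have : 0 ≤ K * (|y| * |r - s|) := by positivity
    rw [hT]; nlinarith
  have hhs : |tilt c d (seg q q' s) y - seg R R' s| ≤ K * T := by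
    have a1 := abs_tilt_le c d (seg q q' s) y
    have a2 := abs_seg_le q q' (hs.trans (by linarith))
    have a3 := abs_seg_le R R' (hs.trans (by linarith))
    refine (abs_sub _ _).trans ?_
    have a4 : K * (|y| + |seg q q' s|) ≤ K * (|y| + (2 * |q| + |q'|)) := by gcongr
    have a5 : 2 * |R| + |R'| ≤ K * (2 * |R| + |R'|) :=
      le_mul_of_one_le_left (by positivity) hK1
    rw [hT, mul_add K]
    linarith
  have hprod : |1 / seg p p' r * (tilt c d (seg q q' r) y - seg R R' r) -
      1 / seg p p' s * (tilt c d (seg q q' s) y - seg R R' s)| ≤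
      (1 / p) * (K * (2 + 4 / ε) * T) * |r - s| := by
    have e : 1 / seg p p' r * (tilt c d (seg q q' r) y - seg R R' r) -
      1 / seg p p' s * (tilt c d (seg q q' s) y - seg R R' s) =
      1 / seg p p' r * ((tilt c d (seg q q' r) y - seg R R' r) -
        (tilt c d (seg q q' s) y - seg R R' s)) +
      (1 / seg p p' r - 1 / seg p p' s) * (tilt c d (seg q q' s) y - seg R R' s) := by ring
    rw [e]
    refine (abs_add_le _ _).trans ?_
    rw [abs_mul, abs_mul]
    calc _ ≤ 2 * (1 / p) * (K * T * |r - s|) + 4 / ε * (1 / p) * |r - s| * (K * T) := by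
          gcongr
      _ = _ := by ring
  have hbr : |pathScore c d π i y p p' q q' R R' r - pathScore c d π i y p p' q q' R R' s| ≤
      |i * -(tilt c d (seg q q' r) y - tilt c d (seg q q' s) y) + (seg R R' r - seg R R' s) +
        i * (1 / seg p p' r * (tilt c d (seg q q' r) y - seg R R' r) -
      1 / seg p p' s * (tilt c d (seg q q' s) y - seg R R' s))| := by
    have e : pathScore c d π i y p p' q q' R R' r - pathScore c d π i y p p' q q' R R' s =
      π * (i * -(tilt c d (seg q q' r) y - tilt c d (seg q q' s) y) + (seg R R' r - seg R R' s) +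
        i * (1 / seg p p' r * (tilt c d (seg q q' r) y - seg R R' r) -
      1 / seg p p' s * (tilt c d (seg q q' s) y - seg R R' s))) := by unfold pathScore; ring
    rw [e, abs_mul, abs_of_nonneg hπ.1]
    exact mul_le_of_le_one_left (abs_nonneg _) hπ.2
  refine hbr.trans ?_
  rcases hi with rfl | rfl
  · simpa using hR
  · simp only [one_mul]
    refine (abs_add_three _ _ _).trans ?_
    rw [abs_neg]
    -- Since `p ≤ 1`, the unweighted change of the tilt is absorbed into the weighted one; this
    -- raises the constant from `2 + 4 / ε` to `3 + 4 / ε`.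
    have h5 : K * T * |r - s| ≤ 1 / p * (K * T) * |r - s| :=
      mul_le_mul_of_nonneg_right (le_mul_of_one_le_left (by positivity) hpp) hrs
    have e2 : ((2 * |R| + |R'|) + 1 / p * (K * (3 + 4 / ε) * T)) * |r - s| =
      1 / p * (K * T) * |r - s| + (2 * |R| + |R'|) * |r - s| +
        (1 / p) * (K * (2 + 4 / ε) * T) * |r - s| := by ring
    rw [e2]
    linarith

/-- Away from the kink the slope is constant for small `r`, so the tilt is affine in `r` there. -/
lemma hasDerivAt_tilt_seg {c d q q' y : ℝ} (hy : y ≠ q) :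
    HasDerivAt (fun r => tilt c d (seg q q' r) y) ((q' - q) * (1 - slope c d q y)) 0 := by
  have hc : Filter.Tendsto (seg q q') (nhds 0) (nhds q) := by
    have := (hasDerivAt_seg q q' 0).continuousAt.tendsto
    rwa [seg_zero] at this
  have hs : ∀ᶠ r in nhds (0 : ℝ), slope c d (seg q q' r) y = slope c d q y := by
    rcases lt_or_gt_of_ne hy with h | h
    · filter_upwards [hc.eventually (lt_mem_nhds h)] with r hr
      simp [slope, not_le.2 h, not_le.2 hr]
    · filter_upwards [hc.eventually (gt_mem_nhds h)] with r hr
      simp [slope, h.le, (le_of_lt hr)]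
  have hd : HasDerivAt (fun r => seg q q' r + slope c d q y * (y - seg q q' r))
      ((q' - q) * (1 - slope c d q y)) 0 := by
    have h := (hasDerivAt_seg q q' 0).add
      (((hasDerivAt_seg q q' 0).const_sub y).const_mul (slope c d q y))
    exact h.congr_deriv (by ring)
  refine hd.congr_of_eventuallyEq ?_
  filter_upwards [hs] with r hr
  rw [tilt, hr]

/-- The derivative is arranged as an arm term, a covariate term and an inversely weighted arm term,
so that `integral_ind_mul`, `integral_covLaw` and `integral_ipw` apply one by one. Outside the arm
the outcome does not enter, so `y = q` is allowed. -/
lemma hasDerivAt_pathScore {c d π i y p p' q q' R R' : ℝ} (hi : i = 0 ∨ (i = 1 ∧ y ≠ q))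
    (hp : 0 < p) :
    HasDerivAt (pathScore c d π i y p p' q q' R R')
      (i * -(π * ((q' - q) * (1 - slope c d q y))) + π * (R' - R) +
        i * (1 / p * (π * ((q' - q) * (1 - slope c d q y)) - π * (R' - R) -
          π * ((p' - p) / p * (tilt c d q y - R))))) 0 := by
  have hR := hasDerivAt_seg R R' 0
  rcases hi with rfl | ⟨rfl, hy⟩
  · have e : pathScore c d π 0 y p p' q q' R R' = fun r => π * seg R R' r := by
      ext r; simp [pathScore]
    rw [e]
    simpa using! hR.const_mul π
  · have hg := hasDerivAt_tilt_seg (c := c) (d := d) (q' := q') hy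
    have hp0 : seg p p' 0 ≠ 0 := by rw [seg_zero]; exact hp.ne'
    have hinv := (hasDerivAt_seg p p' 0).fun_inv hp0
    have h := (((hg.const_sub y).add hR).add (hinv.mul (hg.sub hR))).const_mul π
    have e : pathScore c d π 1 y p p' q q' R R' = fun r =>
        π * ((y - tilt c d (seg q q' r) y) + seg R R' r +
          (seg p p' r)⁻¹ * (tilt c d (seg q q' r) y - seg R R' r)) := by
      ext r; simp [pathScore]
    rw [e]
    refine HasDerivAt.congr_deriv h ?_
    simp only [seg_zero, Pi.sub_apply]
    field_simp
    ring

end PathCalculus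

/-! ### Orthogonality of the score of one arm. -/

section Orthogonality
variable {𝒳 : Type*} [MeasurableSpace 𝒳]

/-- The factor depending on `x` alone leaves the inner integral, so conditional centering suffices.
-/
lemma integral_compProd_eq_zero {ν : Measure 𝒳} [SFinite ν] {κ : Kernel 𝒳 ℝ} [IsSFiniteKernel κ]
    {g : 𝒳 → ℝ} {h : 𝒳 → ℝ → ℝ} (hi : Integrable (fun w : 𝒳 × ℝ => g w.1 * h w.1 w.2) (ν ⊗ₘ κ))
    (h0 : ∀ᵐ x ∂ν, ∫ y, h x y ∂(κ x) = 0) : ∫ w, g w.1 * h w.1 w.2 ∂(ν ⊗ₘ κ) = 0 := by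
  rw [Measure.integral_compProd hi]
  refine integral_eq_zero_of_ae ?_
  filter_upwards [h0] with x hx
  simp only [integral_const_mul, hx, mul_zero, Pi.zero_apply]

/-- No atoms at `q` under the observed law means no atoms of the conditional laws. -/
lemma ae_outcomeKernel_singleton (P : ProbabilityMeasure (Obs 𝒳)) (t : Bool)
    (hpos : ∀ᵐ x ∂(covLaw P), 0 < armProb P t x) {q : 𝒳 → ℝ} (hq : Measurable q)
    (h : (P : Measure (Obs 𝒳)) {z | z.a = t ∧ z.y = q z.x} = 0) :
    ∀ᵐ x ∂(covLaw P), outcomeKernel P t x {q x} = 0 := by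
  have hs : MeasurableSet {w : 𝒳 × ℝ | w.2 = q w.1} :=
    measurableSet_eq_fun measurable_snd (hq.comp measurable_fst)
  have h1 : armLaw P t {w | w.2 = q w.1} = 0 := by
    rw [armLaw, Measure.map_apply Obs.measurable_xy hs,
      Measure.restrict_apply (Obs.measurable_xy hs)]
    refine measure_mono_null ?_ h
    rintro z ⟨hz1, hz2⟩
    exact ⟨hz2, hz1⟩
  -- Positivity of the propensity makes `baseLaw` absolutely continuous with respect to the law of
  -- the arm.
  have h2 : baseLaw P t {w | w.2 = q w.1} = 0 := by
    rw [baseLaw_eq_withDensity P t hpos]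
    exact withDensity_absolutelyContinuous _ _ h1
  have h3 : ∀ᵐ w ∂(covLaw P ⊗ₘ outcomeKernel P t), w.2 ≠ q w.1 := by
    rw [ae_iff]; simpa using! h2
  filter_upwards [Measure.ae_ae_of_ae_compProd h3] with x hx
  rw [ae_iff] at hx
  simpa using! hx

/-- The score of one arm is Neyman orthogonal. -/
lemma hasDerivAt_integral_armScore (P : ProbabilityMeasure (Obs 𝒳)) (t : Bool)
    (hpos : ∀ᵐ x ∂(covLaw P), 0 < armProb P t x)
    (hy : Integrable (fun w : 𝒳 × ℝ => w.2) (baseLaw P t)) (c d : ℝ) {π p' q q' R R' : 𝒳 → ℝ}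
    (hπ : Measurable π) (hπ01 : ∀ x, π x ∈ Set.Icc (0 : ℝ) 1) (hp' : Measurable p')
    (hq : Measurable q) (hq' : Measurable q') (hR : Measurable R) (hR' : Measurable R')
    (hqi : Integrable q (covLaw P)) (hqi' : Integrable q' (covLaw P))
    (hRi : Integrable R (covLaw P)) (hRi' : Integrable R' (covLaw P))
    {ε : ℝ} (hε : 0 < ε) (hε1 : ε ≤ 1)
    (hseg : ∀ᵐ x ∂(covLaw P), 0 ≤ seg (armProb P t x) (p' x) ε ∧
      0 ≤ seg (armProb P t x) (p' x) (-ε))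
    (hatom : ∀ᵐ z ∂(P : Measure (Obs 𝒳)), z.a = t → z.y ≠ q z.x)
    (hslope : ∀ᵐ x ∂(covLaw P), ∫ y, slope c d (q x) y ∂(outcomeKernel P t x) = 1)
    (htilt : ∀ᵐ x ∂(covLaw P), ∫ y, tilt c d (q x) y ∂(outcomeKernel P t x) = R x) :
    (∀ r, |r| ≤ ε / 2 → Integrable (fun z : Obs 𝒳 => pathScore c d (π z.x) (ind (z.a = t)) z.y
      (armProb P t z.x) (p' z.x) (q z.x) (q' z.x) (R z.x) (R' z.x) r) (P : Measure (Obs 𝒳))) ∧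
    HasDerivAt (fun r => ∫ z : Obs 𝒳, pathScore c d (π z.x) (ind (z.a = t)) z.y
      (armProb P t z.x) (p' z.x) (q z.x) (q' z.x) (R z.x) (R' z.x) r ∂(P : Measure (Obs 𝒳)))
      0 0 := by
  have hm := measurable_armProb P t
  have hx := Obs.measurable_x (𝒳 := 𝒳)
  have hyz := Obs.measurable_y (𝒳 := 𝒳)
  have hind : Measurable (fun z : Obs 𝒳 => ind (z.a = t)) :=
    Measurable.ite (Obs.measurableSet_a t) measurable_const measurable_const
  have hsegm : ∀ {u v : 𝒳 → ℝ}, Measurable u → Measurable v → ∀ r,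
      Measurable (fun z : Obs 𝒳 => seg (u z.x) (v z.x) r) := fun hu hv r => by
    unfold seg; fun_prop
  have hF : ∀ r, Measurable (fun z : Obs 𝒳 => pathScore c d (π z.x) (ind (z.a = t)) z.y
      (armProb P t z.x) (p' z.x) (q z.x) (q' z.x) (R z.x) (R' z.x) r) := by
    intro r
    have h1 := measurable_tilt c d (hsegm hq hq' r) hyz
    have h2 := hsegm hR hR' r
    have h3 := hsegm hm hp' r
    unfold pathScore
    fun_prop
  have hae : ∀ {Q : 𝒳 → Prop}, (∀ᵐ x ∂(covLaw P), Q x) → ∀ᵐ z ∂(P : Measure (Obs 𝒳)), Q z.x :=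
    fun h => ae_of_ae_map hx.aemeasurable h
  have hF0 : Integrable (fun z : Obs 𝒳 => pathScore c d (π z.x) (ind (z.a = t)) z.y
      (armProb P t z.x) (p' z.x) (q z.x) (q' z.x) (R z.x) (R' z.x) 0) (P : Measure (Obs 𝒳)) := by
    have h := (integral_armScore P t hpos hy c d hπ hπ01 hq hR hqi hRi).1
    refine h.congr (Filter.Eventually.of_forall fun z => ?_)
    simp only [pathScore, seg_zero, armScore]
  -- the Lipschitz bound
  have hTi : Integrable (fun w : 𝒳 × ℝ => (1 + |c| + |d|) * (3 + 4 / ε) *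
      (|w.2| + (2 * |q w.1| + |q' w.1|) + (2 * |R w.1| + |R' w.1|))) (baseLaw P t) := by
    refine (Integrable.add (hy.abs.add (((integrable_comp_fst t hqi).abs.const_mul 2).add
      (integrable_comp_fst t hqi').abs)) (((integrable_comp_fst t hRi).abs.const_mul 2).add
      (integrable_comp_fst t hRi').abs)).const_mul _
  have hB1 := (integral_ipw P t hpos (by fun_prop) hTi).1
  have hRRm : Measurable (fun x => 2 * |R x| + |R' x|) := by fun_prop
  have hB2 := (integrable_covLaw_iff hRRm).1 ((hRi.abs.const_mul 2).add hRi'.abs)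
  have hB := hB2.add hB1
  have hlip : ∀ᵐ z ∂(P : Measure (Obs 𝒳)), ∀ r s : ℝ, |r| ≤ ε / 2 → |s| ≤ ε / 2 →
      |pathScore c d (π z.x) (ind (z.a = t)) z.y (armProb P t z.x) (p' z.x) (q z.x) (q' z.x)
        (R z.x) (R' z.x) r - pathScore c d (π z.x) (ind (z.a = t)) z.y (armProb P t z.x) (p' z.x)
        (q z.x) (q' z.x) (R z.x) (R' z.x) s| ≤
      ((2 * |R z.x| + |R' z.x|) + ind (z.a = t) * (1 / armProb P t z.x * ((1 + |c| + |d|) *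
        (3 + 4 / ε) * (|z.y| + (2 * |q z.x| + |q' z.x|) + (2 * |R z.x| + |R' z.x|))))) *
        |r - s| := by
    filter_upwards [hae hpos, hae hseg] with z hz1 hz2 r s hr hs
    exact abs_pathScore_sub (hπ01 _) (ind_mem _) hz1 (armProb_mem P t _).2 hε hε1 hz2.1 hz2.2 hr hs
  have hε2 : 0 < ε / 2 := by positivity
  have hint : ∀ r, |r| ≤ ε / 2 → Integrable (fun z : Obs 𝒳 => pathScore c d (π z.x)
      (ind (z.a = t)) z.y (armProb P t z.x) (p' z.x) (q z.x) (q' z.x) (R z.x) (R' z.x) r)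
      (P : Measure (Obs 𝒳)) := by
    intro r hr
    refine (hF0.abs.add (hB.mul_const |r|)).mono' (hF r).aestronglyMeasurable ?_
    filter_upwards [hlip] with z hz
    have h := hz r 0 hr (by simpa using hε2.le)
    rw [sub_zero] at h
    have h2 := abs_sub_abs_le_abs_sub
      (pathScore c d (π z.x) (ind (z.a = t)) z.y (armProb P t z.x) (p' z.x) (q z.x) (q' z.x)
        (R z.x) (R' z.x) r) (pathScore c d (π z.x) (ind (z.a = t)) z.y (armProb P t z.x) (p' z.x)
        (q z.x) (q' z.x) (R z.x) (R' z.x) 0)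
    simp only [Real.norm_eq_abs, Pi.add_apply]
    linarith
  refine ⟨hint, ?_⟩
  -- the derivative of the integrand
  have hsl := measurable_slope c d (hq.comp (measurable_fst (β := ℝ))) measurable_snd
  have htl := measurable_tilt c d (hq.comp (measurable_fst (β := ℝ))) measurable_snd
  simp only [Function.comp_apply] at hsl htl
  have hG : Integrable (fun w : 𝒳 × ℝ => π w.1 * ((q' w.1 - q w.1) *
      (1 - slope c d (q w.1) w.2))) (baseLaw P t) := by
    refine integrable_policy_mul hπ hπ01 (f := fun w => (q' w.1 - q w.1) *
      (1 - slope c d (q w.1) w.2)) ?_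
    refine ((integrable_comp_fst t hqi').sub (integrable_comp_fst t hqi)).mul_bdd
      (c := 1 + (|c| + |d|)) (measurable_const.sub hsl).aestronglyMeasurable
      (Filter.Eventually.of_forall fun w => ?_)
    refine (abs_sub _ _).trans ?_
    rw [abs_one]
    exact add_le_add le_rfl (abs_slope_le c d _ _)
  have hRR : Integrable (fun x => π x * (R' x - R x)) (covLaw P) :=
    (hRi'.sub hRi).bdd_mul (c := 1) hπ.aestronglyMeasurable
      (Filter.Eventually.of_forall fun w => by
        rw [Real.norm_eq_abs, abs_of_nonneg (hπ01 _).1]; exact (hπ01 _).2)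
  have hRRb := integrable_comp_fst t hRR
  have htli : Integrable (fun w : 𝒳 × ℝ => tilt c d (q w.1) w.2) (baseLaw P t) := by
    refine ((hy.abs.add (integrable_comp_fst t hqi).abs).const_mul (1 + |c| + |d|)).mono'
      htl.aestronglyMeasurable (Filter.Eventually.of_forall fun w => ?_)
    exact abs_tilt_le c d _ _
  have hE : Integrable (fun w : 𝒳 × ℝ => π w.1 * ((p' w.1 - armProb P t w.1) / armProb P t w.1 *
      (tilt c d (q w.1) w.2 - R w.1))) (baseLaw P t) := by
    refine integrable_policy_mul hπ hπ01 (f := fun w => (p' w.1 - armProb P t w.1) /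
      armProb P t w.1 * (tilt c d (q w.1) w.2 - R w.1)) ?_
    -- The relative perturbation `(p' - p) / p` is at most `1 / ε` in absolute value, although `p`
    -- need not be bounded below.
    refine (htli.sub (integrable_comp_fst t hRi)).bdd_mul (c := 1 / ε)
      (Measurable.aestronglyMeasurable (by fun_prop)) ?_
    filter_upwards [ae_comp_fst t hpos, ae_comp_fst t hseg] with w hw1 hw2
    have h := (seg_inv_bounds hw1 hε hw2.1 hw2.2 (r := 0) (s := 0) (by simpa using hε2.le)
      (by simpa using hε2.le)).1
    rw [Real.norm_eq_abs, abs_div, abs_of_pos hw1, div_le_iff₀ hw1]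
    refine h.trans (le_of_eq ?_)
    ring
  have hGm : Measurable (fun w : 𝒳 × ℝ => π w.1 * ((q' w.1 - q w.1) *
      (1 - slope c d (q w.1) w.2))) := by fun_prop
  obtain ⟨a1, b1⟩ := integral_ind_mul P t hGm.neg ((hG.mono_measure (armLaw_le_baseLaw P t)).neg)
  obtain ⟨a2, b2⟩ := integral_ipw P t hpos (f := fun w => π w.1 * ((q' w.1 - q w.1) *
      (1 - slope c d (q w.1) w.2)) - π w.1 * (R' w.1 - R w.1) -
      π w.1 * ((p' w.1 - armProb P t w.1) / armProb P t w.1 *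
      (tilt c d (q w.1) w.2 - R w.1))) (by fun_prop) ((hG.sub hRRb).sub hE)
  have hRRm' : Measurable (fun x => π x * (R' x - R x)) := by fun_prop
  have a3 := (integrable_covLaw_iff hRRm').1 hRR
  simp only [Pi.neg_apply] at a1 b1
  simp only at a2 b2
  have a13 : Integrable (fun z : Obs 𝒳 => ind (z.a = t) * -(π z.x * ((q' z.x - q z.x) *
      (1 - slope c d (q z.x) z.y))) + π z.x * (R' z.x - R z.x)) (P : Measure (Obs 𝒳)) := a1.add a3
  -- The Lipschitz version is essential: the absence of atoms is known at `r = 0` only, and for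
  -- other `r` the path may meet the kink with positive probability.
  have key := hasDerivAt_integral_of_dominated_loc_of_lip (μ := (P : Measure (Obs 𝒳)))
    (F := fun r (z : Obs 𝒳) => pathScore c d (π z.x) (ind (z.a = t)) z.y
      (armProb P t z.x) (p' z.x) (q z.x) (q' z.x) (R z.x) (R' z.x) r) (x₀ := (0 : ℝ))
    (s := Metric.ball 0 (ε / 2)) (Metric.ball_mem_nhds _ hε2)
    (Filter.Eventually.of_forall fun r => (hF r).aestronglyMeasurable) hF0
    (a13.add a2).aestronglyMeasurable (bound := _)
    (by
      filter_upwards [hlip] with z hz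
      refine LipschitzOnWith.of_dist_le_mul fun r hr s hs => ?_
      rw [Metric.mem_ball, dist_zero_right, Real.norm_eq_abs] at hr hs
      rw [Real.dist_eq, Real.dist_eq, Real.coe_nnabs]
      exact (hz r s hr.le hs.le).trans (mul_le_mul_of_nonneg_right (le_abs_self _)
        (abs_nonneg _)))
    hB
    (by
      filter_upwards [hae hpos, hatom] with z hz1 hz2
      refine hasDerivAt_pathScore ?_ hz1
      by_cases h : z.a = t
      · exact Or.inr ⟨by simp [ind, h], hz2 h⟩
      · exact Or.inl (by simp [ind, h]))
  refine key.2.congr_deriv ?_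
  have z1 : ∀ᵐ x ∂(covLaw P), ∫ y, (1 - slope c d (q x) y) ∂(outcomeKernel P t x) = 0 := by
    filter_upwards [hslope] with x hx'
    rw [integral_sub (integrable_const _) (integrable_slope _ _), hx']; simp
  have z2 : ∀ᵐ x ∂(covLaw P), ∫ y, (tilt c d (q x) y - R x) ∂(outcomeKernel P t x) = 0 := by
    filter_upwards [htilt,
      ((Measure.integrable_compProd_iff htli.aestronglyMeasurable).1 htli).1] with x hx' hi'
    rw [integral_sub hi' (integrable_const _), hx']; simp
  have hG1 : ∫ w, π w.1 * ((q' w.1 - q w.1) * (1 - slope c d (q w.1) w.2)) ∂(baseLaw P t) = 0 := by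
    have := integral_compProd_eq_zero (ν := covLaw P) (κ := outcomeKernel P t)
      (g := fun x => π x * (q' x - q x)) (h := fun x y => 1 - slope c d (q x) y)
      (hG.congr (Filter.Eventually.of_forall fun w => by simp only; ring)) z1
    rw [← this]
    exact integral_congr_ae (Filter.Eventually.of_forall fun w => by simp only; ring)
  have hG2 : ∫ w, π w.1 * ((q' w.1 - q w.1) * (1 - slope c d (q w.1) w.2)) ∂(armLaw P t) = 0 := by
    have hi := hG.mono_measure (armLaw_le_baseLaw P t)
    rw [armLaw_eq] at hi ⊢
    have := integral_compProd_eq_zero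
      (ν := (covLaw P).withDensity fun x => ENNReal.ofReal (armProb P t x))
      (κ := outcomeKernel P t)
      (g := fun x => π x * (q' x - q x)) (h := fun x y => 1 - slope c d (q x) y)
      (hi.congr (Filter.Eventually.of_forall fun w => by simp only; ring))
      ((withDensity_absolutelyContinuous _ _).ae_le z1)
    rw [← this]
    exact integral_congr_ae (Filter.Eventually.of_forall fun w => by simp only; ring)
  have hE0 : ∫ w, π w.1 * ((p' w.1 - armProb P t w.1) / armProb P t w.1 *
      (tilt c d (q w.1) w.2 - R w.1)) ∂(baseLaw P t) = 0 := by
    have := integral_compProd_eq_zero (ν := covLaw P) (κ := outcomeKernel P t)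
      (g := fun x => π x * ((p' x - armProb P t x) / armProb P t x))
      (h := fun x y => tilt c d (q x) y - R x)
      (hE.congr (Filter.Eventually.of_forall fun w => by simp only; ring)) z2
    rw [← this]
    exact integral_congr_ae (Filter.Eventually.of_forall fun w => by simp only; ring)
  have hRint : ∫ w, π w.1 * (R' w.1 - R w.1) ∂(baseLaw P t) =
      ∫ x, π x * (R' x - R x) ∂(covLaw P) := by
    rw [← fst_baseLaw P t]
    exact (integral_map measurable_fst.aemeasurable hRRm'.aestronglyMeasurable).symm
  have hGR : Integrable (fun w : 𝒳 × ℝ => π w.1 * ((q' w.1 - q w.1) *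
      (1 - slope c d (q w.1) w.2)) - π w.1 * (R' w.1 - R w.1)) (baseLaw P t) := hG.sub hRRb
  refine (integral_add a13 a2).trans ?_
  -- The `q` terms vanish because one minus the slope is centered, the propensity term because the
  -- tilt minus `R` is; the covariate term in `R' - R` cancels against its inversely weighted copy.
  rw [integral_add a1 a3, b1, b2, integral_neg, integral_sub hGR hE, integral_sub hG hRRb,
    hG1, hG2, hE0, hRint, integral_covLaw P hRRm']
  ring

end Orthogonality

/-! ### The full score in terms of the scores of the two arms. -/

section Score
variable {𝒳 : Type*} {Λ : ℝ}

lemma propensity_path (η η' : Nuisance 𝒳) (r : ℝ) (t : Bool) (x : 𝒳) :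
    propensity (η.path η' r).e t x = seg (propensity η.e t x) (propensity η'.e t x) r := by
  cases t
  · simp [propensity, Nuisance.path, seg]; ring
  · simp [propensity, Nuisance.path, seg]

/-- The tail combination is linear in the tails and `1 - e` is affine in `e`, so a segment of
nuisance tuples induces a segment in each argument of the arm scores. -/
lemma psiDelta_path_eq (hΛ : 1 ≤ Λ) (π : 𝒳 → ℝ) (η η' : Nuisance 𝒳) (r : ℝ) (z : Obs 𝒳)
    (he : (η.path η' r).e z.x ∈ Set.Ioo (0 : ℝ) 1) :
    psiDelta Λ π (η.path η' r) z =
      pathScore Λ⁻¹ Λ (π z.x) (ind (z.a = true)) z.y (propensity η.e true z.x)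
        (propensity η'.e true z.x) (η.qMinus z.x true) (η'.qMinus z.x true)
        (Λ * η.rhoOneMinus z.x true + Λ⁻¹ * η.rhoZeroMinus z.x true)
        (Λ * η'.rhoOneMinus z.x true + Λ⁻¹ * η'.rhoZeroMinus z.x true) r -
      pathScore Λ Λ⁻¹ (π z.x) (ind (z.a = false)) z.y (propensity η.e false z.x)
        (propensity η'.e false z.x) (η.qPlus z.x false) (η'.qPlus z.x false)
        (Λ⁻¹ * η.rhoOnePlus z.x false + Λ * η.rhoZeroPlus z.x false)
        (Λ⁻¹ * η'.rhoOnePlus z.x false + Λ * η'.rhoZeroPlus z.x false) r := by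
  have h1 : propensity (η.path η' r).e true z.x ≠ 0 := by simpa [propensity] using he.1.ne'
  have h0 : propensity (η.path η' r).e false z.x ≠ 0 := by
    simpa [propensity] using (sub_pos.2 he.2).ne'
  rw [psiDelta, phiMinus_eq hΛ _ _ _ _ _ _ h1, phiPlus_eq hΛ _ _ _ _ _ _ h0]
  simp only [armScore, propensity_path, pathScore]
  simp only [Nuisance.path]
  rw [mul_sub]
  congr 1
  · rw [show seg (Λ * η.rhoOneMinus z.x true + Λ⁻¹ * η.rhoZeroMinus z.x true)
      (Λ * η'.rhoOneMinus z.x true + Λ⁻¹ * η'.rhoZeroMinus z.x true) r =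
      Λ * (η.rhoOneMinus z.x true + r * (η'.rhoOneMinus z.x true - η.rhoOneMinus z.x true)) +
      Λ⁻¹ * (η.rhoZeroMinus z.x true + r * (η'.rhoZeroMinus z.x true - η.rhoZeroMinus z.x true))
      by unfold seg; ring]
    rfl
  · rw [show seg (Λ⁻¹ * η.rhoOnePlus z.x false + Λ * η.rhoZeroPlus z.x false)
      (Λ⁻¹ * η'.rhoOnePlus z.x false + Λ * η'.rhoZeroPlus z.x false) r =
      Λ⁻¹ * (η.rhoOnePlus z.x false + r * (η'.rhoOnePlus z.x false - η.rhoOnePlus z.x false)) +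
      Λ * (η.rhoZeroPlus z.x false + r * (η'.rhoZeroPlus z.x false - η.rhoZeroPlus z.x false))
      by unfold seg; ring]
    rfl

lemma psiDelta_eq (hΛ : 1 ≤ Λ) (π : 𝒳 → ℝ) (η : Nuisance 𝒳) (z : Obs 𝒳)
    (he : η.e z.x ∈ Set.Ioo (0 : ℝ) 1) :
    psiDelta Λ π η z =
      π z.x * armScore Λ⁻¹ Λ (propensity η.e true) (fun x => η.qMinus x true)
        (fun x => Λ * η.rhoOneMinus x true + Λ⁻¹ * η.rhoZeroMinus x true) true z -
      π z.x * armScore Λ Λ⁻¹ (propensity η.e false) (fun x => η.qPlus x false)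
        (fun x => Λ⁻¹ * η.rhoOnePlus x false + Λ * η.rhoZeroPlus x false) false z := by
  have h1 : propensity η.e true z.x ≠ 0 := by simpa [propensity] using he.1.ne'
  have h0 : propensity η.e false z.x ≠ 0 := by simpa [propensity] using (sub_pos.2 he.2).ne'
  rw [psiDelta, phiMinus_eq hΛ _ _ _ _ _ _ h1, phiPlus_eq hΛ _ _ _ _ _ _ h0, mul_sub]

end Score

/-! ### The worst case is attained and equals the mean of the score. -/

section Value
variable {𝒳 : Type*} [MeasurableSpace 𝒳] {Λ : ℝ}

/-- The extremal mean of `π(X) Y(t)`: minimal for `(c, d) = (1 / Λ, Λ)`, maximal for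
`(c, d) = (Λ, 1 / Λ)`. -/
def armValue (P : ProbabilityMeasure (Obs 𝒳)) (c d : ℝ) (q π : 𝒳 → ℝ) (t : Bool) : ℝ :=
  ∫ w, π w.1 * w.2 ∂(armLaw P t) + ∫ w, π w.1 * tilt c d (q w.1) w.2 ∂(swapLaw P t)

lemma level_minus_mem (hΛ : 1 ≤ Λ) : 0 < 1 / (1 + Λ) ∧ 1 / (1 + Λ) < 1 := by
  have h := splitProb_pos hΛ true true
  have h' := splitProb_lt_one hΛ true true
  simp only [splitProb, if_true] at h h'
  exact ⟨h, h'⟩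

lemma level_plus_mem (hΛ : 1 ≤ Λ) : 0 < Λ / (1 + Λ) ∧ Λ / (1 + Λ) < 1 := by
  have h := splitProb_pos hΛ false true
  have h' := splitProb_lt_one hΛ false true
  simp only [splitProb, Bool.false_eq_true, if_false] at h h'
  exact ⟨h, h'⟩

lemma measurable_tail_sum (P : ProbabilityMeasure (Obs 𝒳)) {α : ℝ} (h0 : 0 < α) (h1 : α < 1)
    (t : Bool) (c d : ℝ) :
    Measurable (fun x => d * lowerTail P (condQuantile P α) x t +
      c * upperTail P (condQuantile P α) x t) := by
  obtain ⟨m1, m2⟩ := measurable_tails P t (measurable_condQuantile P h0 h1 t)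
  exact (m1.const_mul d).add (m2.const_mul c)

lemma integrable_tail_sum {P : ProbabilityMeasure (Obs 𝒳)} {α : ℝ} (h0 : 0 < α) (h1 : α < 1)
    {t : Bool} (hy : Integrable (fun w : 𝒳 × ℝ => w.2) (baseLaw P t)) (c d : ℝ) :
    Integrable (fun x => d * lowerTail P (condQuantile P α) x t +
      c * upperTail P (condQuantile P α) x t) (covLaw P) := by
  obtain ⟨m1, m2⟩ := integrable_tails hy (measurable_condQuantile P h0 h1 t)
  exact (m1.const_mul d).add (m2.const_mul c)

/-- The score is integrable, and its mean is the difference of the extremal means. -/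
lemma integral_psiDelta (hΛ : 1 ≤ Λ) (P : ProbabilityMeasure (Obs 𝒳))
    (hov : ∀ t, ∀ᵐ x ∂(covLaw P), armProb P t x ∈ Set.Ioo (0 : ℝ) 1)
    (hy : ∀ t, Integrable (fun w : 𝒳 × ℝ => w.2) (baseLaw P t))
    {π : 𝒳 → ℝ} (hπ : Measurable π) (hπ01 : ∀ x, π x ∈ Set.Icc (0 : ℝ) 1) :
    Integrable (psiDelta Λ π (trueNuisance Λ P)) (P : Measure (Obs 𝒳)) ∧
      ∫ z, psiDelta Λ π (trueNuisance Λ P) z ∂(P : Measure (Obs 𝒳)) =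
        armValue P Λ⁻¹ Λ (splitQuantile P Λ true) π true -
          armValue P Λ Λ⁻¹ (splitQuantile P Λ false) π false := by
  obtain ⟨l0, l1⟩ := level_minus_mem hΛ
  obtain ⟨u0, u1⟩ := level_plus_mem hΛ
  obtain ⟨i1, e1⟩ := integral_armScore P true ((hov true).mono fun x hx => hx.1) (hy true) Λ⁻¹ Λ
    hπ hπ01 (measurable_condQuantile P l0 l1 true) (measurable_tail_sum P l0 l1 true Λ⁻¹ Λ)
    (integrable_condQuantile (hy true) l0 l1) (integrable_tail_sum l0 l1 (hy true) Λ⁻¹ Λ)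
  obtain ⟨i0, e0⟩ := integral_armScore P false ((hov false).mono fun x hx => hx.1) (hy false) Λ Λ⁻¹
    hπ hπ01 (measurable_condQuantile P u0 u1 false) (measurable_tail_sum P u0 u1 false Λ Λ⁻¹)
    (integrable_condQuantile (hy false) u0 u1) (integrable_tail_sum u0 u1 (hy false) Λ Λ⁻¹)
  have hae := (ae_of_ae_map Obs.measurable_x.aemeasurable (hov true)).mono fun z hz =>
    psiDelta_eq hΛ π (trueNuisance Λ P) z hz
  refine ⟨(i1.sub i0).congr (hae.mono fun z hz => hz.symm), ?_⟩
  rw [integral_congr_ae hae]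
  refine (integral_sub i1 i0).trans ?_
  rw [e1, e0]
  have q1 : splitQuantile P Λ true = fun x => condQuantile P (1 / (1 + Λ)) x true := by
    ext x; simp [splitQuantile, splitProb]
  have q0 : splitQuantile P Λ false = fun x => condQuantile P (Λ / (1 + Λ)) x false := by
    ext x; simp [splitQuantile, splitProb]
  rw [q1, q0]
  rfl

variable [StandardBorelSpace 𝒳] {k : ℕ}

/-- The worst case of the policy improvement is attained, and equals the difference of the
extremal means. -/
lemma isLeast_improvement (hk : 0 < k) (hΛ : 1 ≤ Λ) (P : ProbabilityMeasure (Obs 𝒳))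
    (hov : ∀ t, ∀ᵐ x ∂(covLaw P), armProb P t x ∈ Set.Ioo (0 : ℝ) 1)
    (hy : ∀ t, Integrable (fun w : 𝒳 × ℝ => w.2) (baseLaw P t))
    {π : 𝒳 → ℝ} (hπ : Measurable π) (hπ01 : ∀ x, π x ∈ Set.Icc (0 : ℝ) 1) :
    IsLeast (improvement π '' uncertaintySet k Λ P)
      (armValue P Λ⁻¹ Λ (splitQuantile P Λ true) π true -
        armValue P Λ Λ⁻¹ (splitQuantile P Λ false) π false) := by
  have hqi : ∀ t, Integrable (fun w : 𝒳 × ℝ => splitQuantile P Λ t w.1) (swapLaw P t) := fun t =>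
    (integrable_comp_fst t (integrable_condQuantile (hy t) (splitProb_pos hΛ t true)
      (splitProb_lt_one hΛ t true))).mono_measure (swapLaw_le_baseLaw P t)
  have hyW : ∀ t, Integrable (fun w : 𝒳 × ℝ => w.2) (swapLaw P t) := fun t =>
    (hy t).mono_measure (swapLaw_le_baseLaw P t)
  constructor
  -- A single law minimizes the mean of `π Y(1)` and maximizes that of `π Y(0)`; otherwise the
  -- difference of the two extremes would only be a bound.
  · obtain ⟨code, decode, hdec, hcd⟩ := exists_code hk
    have hM := marginalSensitivityModel_extremalLaw P hΛ (hov true) code hdec hcd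
    have hobs := observedLaw_extremalLaw P hΛ code
    refine ⟨extremalLaw P hΛ code, ⟨hM, hobs⟩, ?_⟩
    rw [(improvement_eq hΛ hM (by rwa [hobs]) hπ hπ01).2, hobs]
    have hN : ∀ t, ∫ w, π w.1 * w.2 ∂(counterLaw (extremalLaw P hΛ code) t) =
        ∫ w, π w.1 * tilt (splitProb Λ (!t) false / splitProb Λ t false)
          (splitProb Λ (!t) true / splitProb Λ t true) (splitQuantile P Λ t w.1) w.2
          ∂(swapLaw P t) := fun t =>
      integral_tilt_eq (measurable_counterDensity P hΛ t (!t))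
        (fun w => (counterDensity_mem P hΛ t (!t) w).1)
        (fun w => (counterDensity_mem P hΛ t (!t) w).2) (counterLaw_extremalLaw P hΛ code t)
        (counterDensity_eq_slope P Λ t (!t)) (by rw [fst_counterLaw, hobs]) hπ hπ01
        (measurable_splitQuantile P hΛ t) (hyW t) (hqi t)
    have h1 : 1 + Λ ≠ 0 := by linarith
    have r1 : splitProb Λ (!true) false / splitProb Λ true false = Λ⁻¹ := by
      simp [splitProb]; field_simp
    have r2 : splitProb Λ (!true) true / splitProb Λ true true = Λ := by
      simp [splitProb]; field_simp
    have r3 : splitProb Λ (!false) false / splitProb Λ false false = Λ := by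
      simp [splitProb]; field_simp
    have r4 : splitProb Λ (!false) true / splitProb Λ false true = Λ⁻¹ := by
      simp [splitProb]; field_simp
    rw [hN, hN, r1, r2, r3, r4]
    rfl
  · rintro _ ⟨Q, ⟨hQ, rfl⟩, rfl⟩
    rw [(improvement_eq hΛ hQ hy hπ hπ01).2]
    have hb : ∀ t, _ := fun t => tilt_bounds hΛ (hQ.counterLaw_le hΛ t) (hQ.swapLaw_le hΛ t)
      (fst_counterLaw Q t) hπ hπ01 (measurable_splitQuantile (observedLaw Q) hΛ t) (hyW t) (hqi t)
    have h1 := (hb true).1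
    have h0 := (hb false).2
    unfold armValue
    linarith

end Value

/-! ### Neyman orthogonality at the true nuisances. -/

section Neyman
variable {𝒳 : Type*} [MeasurableSpace 𝒳] {Λ : ℝ}

/-- Orthogonality of the score of one arm at the true nuisances. -/
lemma hasDerivAt_integral_pathScore (P : ProbabilityMeasure (Obs 𝒳)) (t : Bool)
    (hpos : ∀ᵐ x ∂(covLaw P), 0 < armProb P t x)
    (hy : Integrable (fun w : 𝒳 × ℝ => w.2) (baseLaw P t)) {α c d : ℝ} (h0 : 0 < α) (h1 : α < 1)
    (hcd : d * α + c * (1 - α) = 1) {π p' q' R' : 𝒳 → ℝ}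
    (hπ : Measurable π) (hπ01 : ∀ x, π x ∈ Set.Icc (0 : ℝ) 1) (hp' : Measurable p')
    (hq' : Measurable q') (hR' : Measurable R')
    (hqi' : Integrable q' (covLaw P)) (hRi' : Integrable R' (covLaw P))
    {ε : ℝ} (hε : 0 < ε) (hε1 : ε ≤ 1)
    (hseg : ∀ᵐ x ∂(covLaw P), 0 ≤ seg (armProb P t x) (p' x) ε ∧
      0 ≤ seg (armProb P t x) (p' x) (-ε))
    (hatom : (P : Measure (Obs 𝒳)) {z | z.a = t ∧ z.y = condQuantile P α z.x t} = 0) :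
    (∀ r, |r| ≤ ε / 2 → Integrable (fun z : Obs 𝒳 => pathScore c d (π z.x) (ind (z.a = t)) z.y
      (armProb P t z.x) (p' z.x) (condQuantile P α z.x t) (q' z.x)
      (d * lowerTail P (condQuantile P α) z.x t + c * upperTail P (condQuantile P α) z.x t)
      (R' z.x) r) (P : Measure (Obs 𝒳))) ∧
    HasDerivAt (fun r => ∫ z : Obs 𝒳, pathScore c d (π z.x) (ind (z.a = t)) z.y
      (armProb P t z.x) (p' z.x) (condQuantile P α z.x t) (q' z.x)
      (d * lowerTail P (condQuantile P α) z.x t + c * upperTail P (condQuantile P α) z.x t)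
      (R' z.x) r ∂(P : Measure (Obs 𝒳))) 0 0 := by
  have hq := measurable_condQuantile P h0 h1 t
  have hk := ae_outcomeKernel_singleton P t hpos hq hatom
  have hatom' : ∀ᵐ z ∂(P : Measure (Obs 𝒳)), z.a = t → z.y ≠ condQuantile P α z.x t := by
    rw [ae_iff]
    simpa using! hatom
  refine hasDerivAt_integral_armScore P t hpos hy c d hπ hπ01 hp' hq hq'
    (measurable_tail_sum P h0 h1 t c d) hR' (integrable_condQuantile hy h0 h1) hqi'
    (integrable_tail_sum h0 h1 hy c d) hRi' hε hε1 hseg hatom' ?_ ?_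
  · filter_upwards [hk] with x hx
    exact integral_slope_quantile (outcomeKernel P t x) h0 h1 hcd hx
  · filter_upwards [hk, (integrable_outcomeKernel hy).1] with x hx hi
    exact integral_tilt_quantile (outcomeKernel P t x) h0 h1 hcd hx hi

/-- Neyman orthogonality of the score. -/
lemma hasDerivAt_integral_psiDelta (hΛ : 1 ≤ Λ) (P : ProbabilityMeasure (Obs 𝒳))
    (hov : ∀ t, ∀ᵐ x ∂(covLaw P), armProb P t x ∈ Set.Ioo (0 : ℝ) 1)
    (hy : ∀ t, Integrable (fun w : 𝒳 × ℝ => w.2) (baseLaw P t))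
    {π : 𝒳 → ℝ} (hπ : Measurable π) (hπ01 : ∀ x, π x ∈ Set.Icc (0 : ℝ) 1)
    (ha1 : (P : Measure (Obs 𝒳))
      {z | z.a = true ∧ z.y = (trueNuisance Λ P).qMinus z.x true} = 0)
    (ha0 : (P : Measure (Obs 𝒳))
      {z | z.a = false ∧ z.y = (trueNuisance Λ P).qPlus z.x false} = 0)
    {η' : Nuisance 𝒳} (hη' : η'.Admissible P) {r₀ : ℝ} (hr₀ : 0 < r₀)
    (hseg : ∀ᵐ z ∂(P : Measure (Obs 𝒳)), ∀ r : ℝ, |r| < r₀ →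
      ((trueNuisance Λ P).path η' r).e z.x ∈ Set.Ioo (0 : ℝ) 1) :
    (∀ᶠ r in nhds (0 : ℝ), Integrable (psiDelta Λ π ((trueNuisance Λ P).path η' r))
      (P : Measure (Obs 𝒳))) ∧
    HasDerivAt (fun r : ℝ => ∫ z, psiDelta Λ π ((trueNuisance Λ P).path η' r) z
      ∂(P : Measure (Obs 𝒳))) 0 0 := by
  obtain ⟨l0, l1⟩ := level_minus_mem hΛ
  obtain ⟨u0, u1⟩ := level_plus_mem hΛ
  have hΛ0 : Λ ≠ 0 := by linarith
  have hΛ1 : 1 + Λ ≠ 0 := by linarith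
  -- Strictly less than `r₀`, so that both endpoints `±ε` are admissible, and capped at `1` for the
  -- Lipschitz bound.
  set ε := min 1 (r₀ / 2) with hεd
  have hε : 0 < ε := lt_min one_pos (by positivity)
  have hεr : ε < r₀ := (min_le_right _ _).trans_lt (by linarith)
  have hpm : ∀ t, Measurable (propensity η'.e t) := measurable_propensity hη'.measurable_e
  have hsegx : ∀ t, ∀ᵐ x ∂(covLaw P), 0 ≤ seg (armProb P t x) (propensity η'.e t x) ε ∧
      0 ≤ seg (armProb P t x) (propensity η'.e t x) (-ε) := by
    intro t
    have hm := measurable_armProb P t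
    have hp' := hpm t
    rw [covLaw, ae_map_iff Obs.measurable_x.aemeasurable]
    · filter_upwards [hseg] with z hz
      have key : ∀ r : ℝ, |r| < r₀ → 0 ≤ seg (armProb P t z.x) (propensity η'.e t z.x) r := by
        intro r hr
        have h := hz r hr
        rw [armProb, show condProbTreated (P : Measure (Obs 𝒳)) Obs.a Obs.x =
          (trueNuisance Λ P).e from rfl, ← propensity_path]
        cases t
        · simpa [propensity] using h.2.le
        · simpa [propensity] using h.1.le
      exact ⟨key ε (by rwa [abs_of_pos hε]), key (-ε) (by rwa [abs_neg, abs_of_pos hε])⟩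
    · have m : ∀ r, Measurable (fun x => seg (armProb P t x) (propensity η'.e t x) r) := fun r => by
        unfold seg; fun_prop
      exact (measurableSet_le measurable_const (m ε)).inter
        (measurableSet_le measurable_const (m (-ε)))
  have hcomp : ∀ t : Bool, ∀ f ∈ ({η'.qMinus, η'.qPlus, η'.rhoOneMinus, η'.rhoOnePlus,
      η'.rhoZeroMinus, η'.rhoZeroPlus} : Set (𝒳 → Bool → ℝ)),
      Measurable (fun x => f x t) ∧ Integrable (fun x => f x t) (covLaw P) := fun t f hf =>
    ⟨(hη'.components t f hf).1, (integrable_covLaw_iff (hη'.components t f hf).1).2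
      (hη'.components t f hf).2⟩
  have c1 := hcomp true η'.qMinus (by simp)
  have c2 := hcomp true η'.rhoOneMinus (by simp)
  have c3 := hcomp true η'.rhoZeroMinus (by simp)
  have d1 := hcomp false η'.qPlus (by simp)
  have d2 := hcomp false η'.rhoOnePlus (by simp)
  have d3 := hcomp false η'.rhoZeroPlus (by simp)
  -- The normalization to check is `Λ · 1/(1+Λ) + Λ⁻¹ · Λ/(1+Λ) = 1`; for the control arm slopes and
  -- levels are exchanged.
  obtain ⟨i1, D1⟩ := hasDerivAt_integral_pathScore P true ((hov true).mono fun x hx => hx.1)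
    (hy true) l0 l1 (c := Λ⁻¹) (d := Λ) (by field_simp; ring) hπ hπ01 (hpm true) c1.1
    ((c2.1.const_mul Λ).add (c3.1.const_mul Λ⁻¹)) c1.2
    ((c2.2.const_mul Λ).add (c3.2.const_mul Λ⁻¹)) hε (min_le_left _ _) (hsegx true) ha1
  obtain ⟨i0, D0⟩ := hasDerivAt_integral_pathScore P false ((hov false).mono fun x hx => hx.1)
    (hy false) u0 u1 (c := Λ) (d := Λ⁻¹) (by field_simp; ring) hπ hπ01 (hpm false) d1.1
    ((d2.1.const_mul Λ⁻¹).add (d3.1.const_mul Λ)) d1.2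
    ((d2.2.const_mul Λ⁻¹).add (d3.2.const_mul Λ)) hε (min_le_left _ _) (hsegx false) ha0
  have hnear : ∀ᶠ r in nhds (0 : ℝ), |r| ≤ ε / 2 := by
    filter_upwards [Metric.ball_mem_nhds (0 : ℝ) (half_pos hε)] with r hr
    rw [Metric.mem_ball, dist_zero_right, Real.norm_eq_abs] at hr
    exact hr.le
  have hae := fun (r : ℝ) (hr : |r| ≤ ε / 2) => hseg.mono fun z hz =>
    psiDelta_path_eq hΛ π (trueNuisance Λ P) η' r z (hz r (by linarith))
  constructor
  · filter_upwards [hnear] with r hr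
    exact ((i1 r hr).sub (i0 r hr)).congr ((hae r hr).mono fun z hz => hz.symm)
  · have hD := D1.sub D0
    rw [sub_zero] at hD
    refine hD.congr_of_eventuallyEq ?_
    filter_upwards [hnear] with r hr
    rw [integral_congr_ae (hae r hr)]
    exact integral_sub (i1 r hr) (i0 r hr)

end Neyman

end RobustPolicy

end

theorem proposition2 {𝒳 : Type*} [MeasurableSpace 𝒳] [StandardBorelSpace 𝒳]
    (k : ℕ) (hk : 0 < k) (Λ : ℝ) (hΛ : 1 ≤ Λ)
    (Po : ProbabilityMeasure (RobustPolicy.Full 𝒳 k))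
    (hMSM : RobustPolicy.MarginalSensitivityModel Λ Po)
    (hY1 : Integrable RobustPolicy.Full.y1 (Po : Measure (RobustPolicy.Full 𝒳 k)))
    (hY0 : Integrable RobustPolicy.Full.y0 (Po : Measure (RobustPolicy.Full 𝒳 k)))
    (P : ProbabilityMeasure (RobustPolicy.Obs 𝒳)) (hP : P = RobustPolicy.observedLaw Po)
    (η : RobustPolicy.Nuisance 𝒳) (hη : η = RobustPolicy.trueNuisance Λ P)
    (π : 𝒳 → ℝ) (hπ : Measurable π) (hπ01 : ∀ x, π x ∈ Set.Icc (0 : ℝ) 1) :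
    -- the infimum defining `Δ_Λ(π)` is one of genuine expectations, bounded below
    ((∀ Q ∈ RobustPolicy.uncertaintySet k Λ P,
        Integrable (fun o : RobustPolicy.Full 𝒳 k => π o.x * (o.y1 - o.y0))
          (Q : Measure (RobustPolicy.Full 𝒳 k))) ∧
      BddBelow (RobustPolicy.improvement π '' RobustPolicy.uncertaintySet k Λ P)) ∧
    -- `E[ψ_Δ(Z, π; η)] = Δ_Λ(π)`
    (Integrable (RobustPolicy.psiDelta Λ π η) (P : Measure (RobustPolicy.Obs 𝒳)) ∧
      ∫ z, RobustPolicy.psiDelta Λ π η z ∂(P : Measure (RobustPolicy.Obs 𝒳)) =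
        RobustPolicy.worstCaseImprovement k Λ P π) ∧
    -- Neyman orthogonality, when `Y` has no conditional atoms at the relevant quantiles
    ((P : Measure (RobustPolicy.Obs 𝒳)) {z | z.a = true ∧ z.y = η.qMinus z.x true} = 0 →
      (P : Measure (RobustPolicy.Obs 𝒳)) {z | z.a = false ∧ z.y = η.qPlus z.x false} = 0 →
      ∀ η' : RobustPolicy.Nuisance 𝒳, η'.Admissible P →
        -- for small `r` the perturbed propensity score is still valued in `(0, 1)`
        (∃ r₀ > 0, ∀ᵐ z ∂(P : Measure (RobustPolicy.Obs 𝒳)), ∀ r : ℝ, |r| < r₀ →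
          (η.path η' r).e z.x ∈ Set.Ioo (0 : ℝ) 1) →
        (∀ᶠ r in nhds (0 : ℝ), Integrable (RobustPolicy.psiDelta Λ π (η.path η' r))
          (P : Measure (RobustPolicy.Obs 𝒳))) ∧
        HasDerivAt (fun r : ℝ => ∫ z, RobustPolicy.psiDelta Λ π (η.path η' r) z
          ∂(P : Measure (RobustPolicy.Obs 𝒳))) 0 0) := by
  subst hP hη
  have hov := fun t => hMSM.overlap hΛ t
  -- Integrability under the true law becomes a property of the observed law alone, and so serves
  -- every law in the uncertainty set.
  have hy : ∀ t, Integrable (fun w : 𝒳 × ℝ => w.2)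
      (RobustPolicy.baseLaw (RobustPolicy.observedLaw Po) t) := fun t =>
    RobustPolicy.integrable_baseLaw hΛ hMSM t (by cases t; exacts [hY0, hY1])
  have hleast := RobustPolicy.isLeast_improvement hk hΛ _ hov hy hπ hπ01
  obtain ⟨hint, hmean⟩ := RobustPolicy.integral_psiDelta hΛ _ hov hy hπ hπ01
  -- Being a least element, the value is the genuine infimum, and the default value of `sInf` plays
  -- no role.
  refine ⟨⟨fun Q hQ => ?_, _, hleast.2⟩, ⟨hint, hmean.trans hleast.csInf_eq.symm⟩, ?_⟩
  · exact (RobustPolicy.improvement_eq hΛ hQ.1 (by rw [hQ.2]; exact hy) hπ hπ01).1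
  · rintro ha1 ha0 η' hη' ⟨r₀, hr₀, hseg⟩
    exact RobustPolicy.hasDerivAt_integral_psiDelta hΛ _ hov hy hπ hπ01 ha1 ha0 hη' hr₀ hseg
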